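/- \textbf{Setting.} Consider an episodic nonstationary MDP with measurable state space $\mathcal S$, finite nonempty action set $\mathcal A$, $K$ episodes of $H$ steps, transition kernels $P_h^k(\cdot\mid s,a)$ and measurable deterministic rewards $r_h^k(s,a)\in[0,1]$ ($h\in[H]$, $k\in[K]$). It is a linear MDP: there are a known feature map $\phi:\mathcal S\times\mathcal A\to\mathbb R^d$ ($d\ge1$, measurable in the state), unknown vectors $\theta_{h,k}\in\mathbb R^d$ and unknown $\mathbb R^d$-valued measures (vectors of $d$ signed measures) $\mu_{h,k}$ on $\mathcal S$ such that $P_h^k(B\mid s,a)=\langle\phi(s,a),\mu_{h,k}(B)\rangle$ for all measurable $B$ and $r_h^k(s,a)=\langle\phi(s,a),\theta_{h,k}\rangle$, with $\|\phi(s,a)\|_2\le1$, $\|\theta_{h,k}\|_2\le\sqrt d$ and $\|\mu_{h,k}\|\le\sqrt d$. Here $\|\nu\|:=\sup_B\|\nu(B)\|_2$ over measurable $B\subseteq\mathcal S$, which is $\|\nu(\mathcal S)\|_2$ if the components of $\nu$ are nonnegative. For a deterministic measurable policy $\pi$ let $V^\pi_{h,k}(s)$ be its expected total reward in steps $h,\dots,H$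 of episode $k$ from state $s$, and let $V^*_{h,k}=\sup_\pi V^\pi_{h,k}$. \textbf{Algorithm} (LSVI-UCB-Restart with bonus parameter $\beta$). Let $W\ge1$ be a multiple of $H$. The episodes are cut into consecutive epochs of $W/H$ episodes, i.e. $W$ steps (the last epoch may be shorter). In an episode $k$ of an epoch with first episode $\tau$, put $Q^k_{H+1}=0$ and, for $h=H,\dots,1$, with $\phi_h^l=\phi(s_h^l,a_h^l)$, $$\Lambda_h^k=I+\sum_{l=\tau}^{k-1}\phi_h^l(\phi_h^l)^\top,\qquad w_h^k=(\Lambda_h^k)^{-1}\sum_{l=\tau}^{k-1}\phi_h^l\Big[r_h^l(s_h^l,a_h^l)+\max_aQ_{h+1}^k(s_{h+1}^l,a)\Big],$$ $$Q_h^k(s,a)=\min\Big\{\langle w_h^k,\phi(s,a)\rangle+\beta\sqrt{\phi(s,a)^\top(\Lambda_h^k)^{-1}\phi(s,a)},\,H\Big\}.$$ The agent follows the greedy policy $\pi^k_h(s)\in\arg\max_aQ_h^k(s,a)$ (ties broken by any fixed measurable rule), i.e. $a_h^k=\pi_h^k(s_h^k)$. Given all states observed so far, $s_{h+1}^k$ has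 law $P_h^k(\cdot\mid s_h^k,a_h^k)$; the initial states $s_1^k$ are arbitrary, possibly chosen adversarially depending on the past. \textbf{Theorem.} There is an absolute constant $c_0>0$ such that for every $c\ge c_0$ there is a constant $C>0$, depending only on $c$, with the following property. Let $p\in(0,1)$ and $\beta=c\,dH\sqrt{\log(2dW/p)}$ (no knowledge of the variation is used). Then for each epoch $\mathcal E$, with probability at least $1-p$, $$\sum_{k\in\mathcal E}\Big[V^*_{1,k}(s_1^k)-V^{\pi^k}_{1,k}(s_1^k)\Big]\le C\Big(\sqrt{d^3H^3W}\,\log\tfrac{2dW}{p}+B_{\theta,\mathcal E}\sqrt{d/H}\,W^{3/2}+B_{\mu,\mathcal E}\sqrt{dH}\,W^{3/2}\Big),$$ where $B_{\theta,\mathcal E}=\sum_{k}\sum_{h=1}^H\|\theta_{h,k}-\theta_{h,k-1}\|_2$ and $B_{\mu,\mathcal E}=\sum_{k}\sum_{h=1}^H\|\mu_{h,k}-\mu_{h,k-1}\|$, the sums over $k$ being over all episodes of $\mathcal E$ except its first. -/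

import Mathlib

open MeasureTheory ProbabilityTheory
open scoped RealInnerProductSpace

noncomputable section

namespace NonstatRL

/-- A nonstationary episodic Markov decision process with `K` episodes of `H` steps each. Episodes
`k < K` and steps `h < H` are numbered from `0`; what is stored at other indices is never used.
`P k h (s, a)` is the law of the next state and `r k h s a` is the (deterministic) reward. -/
structure EpisodicMDP (S A : Type*) [MeasurableSpace S] [MeasurableSpace A] (H K : ℕ) where
  P : ℕ → ℕ → Kernel (S × A) S
  r : ℕ → ℕ → S → A → ℝ
  isMarkov : ∀ k < K, ∀ h < H, IsMarkovKernel (P k h)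
  measurable_r : ∀ k < K, ∀ h < H, Measurable (Function.uncurry (r k h))
  r_mem : ∀ k < K, ∀ h < H, ∀ s a, r k h s a ∈ Set.Icc (0 : ℝ) 1

section Value

variable {S A : Type*} [MeasurableSpace S] [MeasurableSpace A] {H K : ℕ}

/-- Law of the state reached `n` steps after being in state `s` at step `h` of episode `k`, when the
actions are chosen by the policy `π` (action `π j x` in state `x` at step `j`). -/
def stateLaw (M : EpisodicMDP S A H K) (k : ℕ) (π : ℕ → S → A) (h : ℕ) (s : S) :
    ℕ → Measure S
  | 0 => Measure.dirac s
  | n + 1 => (stateLaw M k π h s n).bind (fun x => M.P k (h + n) (x, π (h + n) x))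

/-- `V^π_{h,k}(s)`: expected total reward collected in steps `h, …, H - 1` of episode `k` by the
policy `π`, started from `s` at step `h`. -/
def value (M : EpisodicMDP S A H K) (k : ℕ) (π : ℕ → S → A) (h : ℕ) (s : S) : ℝ :=
  ∑ n ∈ Finset.range (H - h),
    ∫ x, M.r k (h + n) x (π (h + n) x) ∂(stateLaw M k π h s n)

/-- `V^*_{h,k}(s)`: supremum of the values of all (measurable, deterministic, Markov) policies. -/
def optValue (M : EpisodicMDP S A H K) (k h : ℕ) (s : S) : ℝ :=
  ⨆ π : {π : ℕ → S → A // ∀ j, Measurable (π j)}, value M k π.1 h s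

end Value

section Linear

variable {S A : Type*} [MeasurableSpace S] [MeasurableSpace A] {H K d : ℕ}

/-- Size of a vector of `d` signed measures: the supremum of `‖ν(B)‖₂` over the measurable sets `B`
(a `VectorMeasure` vanishes on the other sets). For `d` nonnegative measures it is `‖ν(S)‖₂`. -/
def vmNorm (ν : VectorMeasure S (EuclideanSpace ℝ (Fin d))) : ℝ :=
  ⨆ B : Set S, ‖ν B‖

/-- The supremum in `vmNorm` is over a bounded set. -/
theorem bddAbove_vmNorm (ν : VectorMeasure S (EuclideanSpace ℝ (Fin d))) :
    BddAbove (Set.range fun B : Set S => ‖ν B‖) := by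
  refine ⟨ν.bound, ?_⟩
  rintro _ ⟨B, rfl⟩
  exact ν.norm_apply_le_bound

/-- `M` is a linear MDP with known feature map `φ`, reward vectors `θ k h` and vectors `μ k h` of
`d` signed measures, with the usual normalization. -/
structure IsLinearMDP (M : EpisodicMDP S A H K) (φ : S → A → EuclideanSpace ℝ (Fin d))
    (μ : ℕ → ℕ → VectorMeasure S (EuclideanSpace ℝ (Fin d)))
    (θ : ℕ → ℕ → EuclideanSpace ℝ (Fin d)) : Prop where
  measurable_feature : ∀ a, Measurable (fun s => φ s a)
  transition : ∀ k < K, ∀ h < H, ∀ s a, ∀ B, MeasurableSet B →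
    (M.P k h (s, a)).real B = ⟪φ s a, μ k h B⟫
  reward : ∀ k < K, ∀ h < H, ∀ s a, M.r k h s a = ⟪φ s a, θ k h⟫
  norm_feature : ∀ s a, ‖φ s a‖ ≤ 1
  norm_measure : ∀ k < K, ∀ h < H, vmNorm (μ k h) ≤ √d
  norm_reward : ∀ k < K, ∀ h < H, ‖θ k h‖ ≤ √d

end Linear

section Epochs

variable {S : Type*} [MeasurableSpace S] {d : ℕ}

/-- The episodes of the `j`-th epoch, when `N` episodes make one epoch and there are `K` episodes in
total (the last epoch may be cut short). -/
def epoch (N K j : ℕ) : Finset ℕ := Finset.Ico (j * N) (min ((j + 1) * N) K)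

/-- First episode of the epoch that contains episode `k`. -/
def epochStart (N k : ℕ) : ℕ := k / N * N

/-- `B_{θ,ℰ}`: variation of the reward vectors between consecutive episodes of the `j`-th epoch. -/
def rewardVariation (θ : ℕ → ℕ → EuclideanSpace ℝ (Fin d)) (H N K j : ℕ) : ℝ :=
  ∑ k ∈ epoch N K j with k ≠ j * N, ∑ h ∈ Finset.range H, ‖θ k h - θ (k - 1) h‖

/-- `B_{μ,ℰ}`: variation of the transition measures between consecutive episodes of the `j`-th
epoch. -/
def transitionVariation (μ : ℕ → ℕ → VectorMeasure S (EuclideanSpace ℝ (Fin d)))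
    (H N K j : ℕ) : ℝ :=
  ∑ k ∈ epoch N K j with k ≠ j * N, ∑ h ∈ Finset.range H, vmNorm (μ k h - μ (k - 1) h)

end Epochs

section Algorithm

variable {S A : Type*} {d : ℕ}

/-- `Λ_h^k = I + ∑_{l=τ}^{k-1} φ_h^l (φ_h^l)ᵀ`, where `φ_h^l` is the feature of the state `x l h` and
the action `u l h` at step `h` of episode `l`. -/
def gram (φ : S → A → EuclideanSpace ℝ (Fin d)) (x : ℕ → ℕ → S) (u : ℕ → ℕ → A) (τ k h : ℕ) :
    Matrix (Fin d) (Fin d) ℝ :=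
  1 + ∑ l ∈ Finset.Ico τ k,
    Matrix.vecMulVec (φ (x l h) (u l h)).ofLp (φ (x l h) (u l h)).ofLp

/-- The regularized least-squares weights `w_h^k` for the regression target
`r_h^l(s_h^l, a_h^l) + V(s_{h+1}^l)`. -/
def weights (φ : S → A → EuclideanSpace ℝ (Fin d)) (r : ℕ → ℕ → S → A → ℝ)
    (x : ℕ → ℕ → S) (u : ℕ → ℕ → A) (τ k h : ℕ) (V : S → ℝ) : Fin d → ℝ :=
  (gram φ x u τ k h)⁻¹.mulVec (∑ l ∈ Finset.Ico τ k,
    (r l h (x l h) (u l h) + V (x l (h + 1))) • (φ (x l h) (u l h)).ofLp)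

/-- `min {⟨w_h^k, φ(s,a)⟩ + β (φ(s,a)ᵀ (Λ_h^k)⁻¹ φ(s,a))^{1/2}, H}`, with regression target built
from `V`. -/
def qStep (φ : S → A → EuclideanSpace ℝ (Fin d)) (r : ℕ → ℕ → S → A → ℝ) (H : ℕ) (β : ℝ)
    (x : ℕ → ℕ → S) (u : ℕ → ℕ → A) (τ k h : ℕ) (V : S → ℝ) (s : S) (a : A) : ℝ :=
  min (weights φ r x u τ k h V ⬝ᵥ (φ s a).ofLp +
    β * √((φ s a).ofLp ⬝ᵥ (gram φ x u τ k h)⁻¹.mulVec (φ s a).ofLp)) H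

/-- The value estimate `V_h^k(s) = max_a Q_h^k(s, a)` at the step `h = H - n`, that is with `n` steps
to go; it is `0` after the last step. -/
def vEst (φ : S → A → EuclideanSpace ℝ (Fin d)) (r : ℕ → ℕ → S → A → ℝ) (H : ℕ) (β : ℝ)
    (x : ℕ → ℕ → S) (u : ℕ → ℕ → A) (τ k : ℕ) : ℕ → S → ℝ
  | 0 => fun _ => 0
  | n + 1 => fun s =>
      ⨆ a, qStep φ r H β x u τ k (H - (n + 1)) (vEst φ r H β x u τ k n) s a

/-- The action-value estimate `Q_h^k(s, a)` of LSVI-UCB-Restart with `N` episodes per epoch. It uses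
only the data `x l ·`, `u l ·` of the episodes `l < k` in the epoch of `k`. -/
def qEst (φ : S → A → EuclideanSpace ℝ (Fin d)) (r : ℕ → ℕ → S → A → ℝ) (H : ℕ) (β : ℝ) (N : ℕ)
    (x : ℕ → ℕ → S) (u : ℕ → ℕ → A) (k h : ℕ) (s : S) (a : A) : ℝ :=
  qStep φ r H β x u (epochStart N k) k h
    (vEst φ r H β x u (epochStart N k) k (H - (h + 1))) s a

/-- The policy `π^k` executed in episode `k`: greedy for `Q_h^k`, with ties broken by `sel`. -/
def greedyPolicy (φ : S → A → EuclideanSpace ℝ (Fin d)) (r : ℕ → ℕ → S → A → ℝ) (H : ℕ) (β : ℝ)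
    (N : ℕ) (sel : (A → ℝ) → A) (x : ℕ → ℕ → S) (u : ℕ → ℕ → A) (k h : ℕ) (s : S) : A :=
  sel (qEst φ r H β N x u k h s)

end Algorithm

section Interaction

variable {S A Ω : Type*} [MeasurableSpace S] [MeasurableSpace A] {H K d : ℕ}

/-- Information available once the state of step `h` in episode `k` has been observed: the σ-algebra
generated by all states seen so far. (Actions and rewards are functions of these.) -/
abbrev history (H : ℕ) (s : ℕ → ℕ → Ω → S) (k h : ℕ) : MeasurableSpace Ω :=
  ⨆ (l : ℕ) (i : ℕ) (_ : (l < k ∧ i < H) ∨ (l = k ∧ i ≤ h)),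
    MeasurableSpace.comap (s l i) inferInstance

/-- `sel` picks a maximizer of every function on the action set, measurably. -/
structure IsArgmaxRule (sel : (A → ℝ) → A) : Prop where
  measurable : Measurable sel
  isMax : ∀ (q : A → ℝ) (a : A), q a ≤ q (sel q)

/-- The random states `s k h` and actions `u k h` arise by running LSVI-UCB-Restart, with bonus
multiplier `β` and `N` episodes per epoch, on `M`. The initial states `s k 0` are unrestricted: an
adversary may choose them depending on the past. -/
structure IsRun [MeasurableSpace Ω] (Pr : Measure Ω) (M : EpisodicMDP S A H K)
    (φ : S → A → EuclideanSpace ℝ (Fin d)) (β : ℝ) (N : ℕ) (sel : (A → ℝ) → A)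
    (s : ℕ → ℕ → Ω → S) (u : ℕ → ℕ → Ω → A) : Prop where
  measurable_state : ∀ k < K, ∀ h < H, Measurable (s k h)
  action : ∀ k < K, ∀ h < H, ∀ ω, u k h ω =
    greedyPolicy φ M.r H β N sel (fun l i => s l i ω) (fun l i => u l i ω) k h (s k h ω)
  transition : ∀ k < K, ∀ h, h + 1 < H → ∀ B, MeasurableSet B →
    Pr⟦s k (h + 1) ⁻¹' B | history H s k h⟧ =ᵐ[Pr] fun ω => (M.P k h (s k h ω, u k h ω)).real B

/-- Dynamic regret `∑_{k ∈ ℰ} (V^*_{1,k}(s_1^k) - V^{π^k}_{1,k}(s_1^k))` of the `j`-th epoch. -/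
def epochRegret (M : EpisodicMDP S A H K) (φ : S → A → EuclideanSpace ℝ (Fin d)) (β : ℝ) (N : ℕ)
    (sel : (A → ℝ) → A) (x : ℕ → ℕ → S) (u : ℕ → ℕ → A) (j : ℕ) : ℝ :=
  ∑ k ∈ epoch N K j,
    (optValue M k 0 (x k 0) - value M k (greedyPolicy φ M.r H β N sel x u k) 0 (x k 0))

end Interaction

end NonstatRL

end

open NonstatRL

/-! Let `N = W / H` be the number of episodes of an epoch. The proof splits on the size of `√N *
(B_θ + H * B_μ)`. If it exceeds 1, the trivial bound `N * H` on the regret is already below the two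
variation terms (`steps_le_variation_terms`), and nothing random is involved. If it is at most 1,
the drift is harmless: in the ridge regressions it acts as a bias `b l` with `|b l| ≤ B_θ + H *
B_μ`, and the inverse Gram norm of `∑ b l • φ l` is at most `√(∑ (b l)²)`
(`sqrt_dotProduct_inv_regGram_sum_le`), hence at most 1. A constant fits inside the bonus, so the
estimates remain optimistic although `β` ignores the variation, and the stationary analysis of
LSVI-UCB applies.

The main difficulty is the regression noise, because the target value function depends on the data.
For a fixed direction `y` and a fixed test function, Hoeffding's lemma makes the exponential of
`selfNormalizedExponent` a supermartingale along the episodes. The self-normalized norm is the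
maximum of a concave quadratic in `y` (`quadratic_completion`), so control of the exponent on a fine
grid of directions suffices (`dotProduct_inv_regGram_le_of_grid`). The value functions are also
rounded to a grid, of weights and bonus matrices, and one union bound covers both
(`measure_not_gridBound_le`). The number of coordinates is of order `d²`, which is why `β` is
proportional to `d`. The mesh depends on `β`, but enters only through a logarithm, so a large `c`
closes the circle (`bonus_parameter_ge`).

On the good event each regression is accurate up to its bonus (`abs_weights_sub_le`). Backward
induction gives `optimism`; it also shows that the estimates, which the algorithm truncates only
from above, are nonnegative. The regret of an episode is then at most twice the collected bonuses
plus martingale differences (`optValue_sub_value_le`). The bonuses are summed by Cauchy–Schwarz and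
the elliptical potential lemma (`sum_bonus_le`), the differences by a second exponential
supermartingale (`lintegral_exp_gapExponent_le`). -/

namespace NonstatRL

/-! ### Linear algebra of regularized Gram matrices and the elliptical potential. -/

section RegularizedGram

open Matrix

variable {ι : Type*} {d : ℕ}

/-- The regularized Gram matrix `I + ∑ l ∈ s, f l (f l)ᵀ`. -/
def regGram (s : Finset ι) (f : ι → Fin d → ℝ) : Matrix (Fin d) (Fin d) ℝ :=
  1 + ∑ l ∈ s, vecMulVec (f l) (f l)

theorem posDef_regGram (s : Finset ι) (f : ι → Fin d → ℝ) : (regGram s f).PosDef := by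
  refine PosDef.one.add_posSemidef (posSemidef_sum _ fun l _ => ?_)
  simpa using posSemidef_vecMulVec_self_star (f l)

theorem dotProduct_regGram_mulVec (s : Finset ι) (f : ι → Fin d → ℝ) (x y : Fin d → ℝ) :
    x ⬝ᵥ regGram s f *ᵥ y = x ⬝ᵥ y + ∑ l ∈ s, (x ⬝ᵥ f l) * (f l ⬝ᵥ y) := by
  rw [regGram, add_mulVec, one_mulVec, dotProduct_add, Matrix.sum_mulVec, dotProduct_sum]
  congr 1
  refine Finset.sum_congr rfl fun l _ => ?_
  rw [vecMulVec_mulVec, dotProduct_smul]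
  simp

theorem isUnit_det_regGram (s : Finset ι) (f : ι → Fin d → ℝ) : IsUnit (regGram s f).det :=
  (posDef_regGram s f).det_pos.ne'.isUnit

theorem regGram_mulVec_inv_mulVec (s : Finset ι) (f : ι → Fin d → ℝ) (v : Fin d → ℝ) :
    regGram s f *ᵥ ((regGram s f)⁻¹ *ᵥ v) = v := by
  rw [mulVec_mulVec, mul_nonsing_inv _ (isUnit_det_regGram s f), one_mulVec]

theorem inv_regGram_mulVec_mulVec (s : Finset ι) (f : ι → Fin d → ℝ) (v : Fin d → ℝ) :
    (regGram s f)⁻¹ *ᵥ (regGram s f *ᵥ v) = v := by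
  rw [mulVec_mulVec, nonsing_inv_mul _ (isUnit_det_regGram s f), one_mulVec]

theorem transpose_inv_regGram (s : Finset ι) (f : ι → Fin d → ℝ) :
    ((regGram s f)⁻¹)ᵀ = (regGram s f)⁻¹ := by
  have := (posDef_regGram s f).inv.isHermitian
  simpa [IsHermitian] using this

theorem dotProduct_inv_regGram_comm (s : Finset ι) (f : ι → Fin d → ℝ) (x y : Fin d → ℝ) :
    x ⬝ᵥ (regGram s f)⁻¹ *ᵥ y = y ⬝ᵥ (regGram s f)⁻¹ *ᵥ x := by
  rw [dotProduct_mulVec, ← mulVec_transpose, transpose_inv_regGram, dotProduct_comm]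

theorem dotProduct_inv_regGram_nonneg (s : Finset ι) (f : ι → Fin d → ℝ) (x : Fin d → ℝ) :
    0 ≤ x ⬝ᵥ (regGram s f)⁻¹ *ᵥ x := by
  simpa using (posDef_regGram s f).inv.posSemidef.dotProduct_mulVec_nonneg x

/-- Substitute `x = G y` and expand the quadratic form of `G` at `y`. Dropping one of the two
nonnegative parts yields the norm comparisons below. -/
theorem dotProduct_inv_regGram_eq (s : Finset ι) (f : ι → Fin d → ℝ) (x : Fin d → ℝ) :
    x ⬝ᵥ (regGram s f)⁻¹ *ᵥ x =
      (regGram s f)⁻¹ *ᵥ x ⬝ᵥ (regGram s f)⁻¹ *ᵥ x +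
        ∑ l ∈ s, ((regGram s f)⁻¹ *ᵥ x ⬝ᵥ f l) ^ 2 := by
  set y := (regGram s f)⁻¹ *ᵥ x with hy
  have hx : x = regGram s f *ᵥ y := (regGram_mulVec_inv_mulVec s f x).symm
  rw [dotProduct_comm, hx, dotProduct_regGram_mulVec]
  congr 1
  refine Finset.sum_congr rfl fun l _ => ?_
  rw [dotProduct_comm (f l) y, sq]

theorem dotProduct_sq_le (x y : Fin d → ℝ) : (x ⬝ᵥ y) ^ 2 ≤ (x ⬝ᵥ x) * (y ⬝ᵥ y) := by
  have := Finset.sum_mul_sq_le_sq_mul_sq Finset.univ x y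
  simpa [dotProduct, sq] using this

theorem dotProduct_self_nonneg' (x : Fin d → ℝ) : 0 ≤ x ⬝ᵥ x :=
  Finset.sum_nonneg fun i _ => mul_self_nonneg (x i)

theorem inv_regGram_mulVec_self_le (s : Finset ι) (f : ι → Fin d → ℝ) (x : Fin d → ℝ) :
    (regGram s f)⁻¹ *ᵥ x ⬝ᵥ (regGram s f)⁻¹ *ᵥ x ≤ x ⬝ᵥ x := by
  set y := (regGram s f)⁻¹ *ᵥ x with hy
  have h1 : y ⬝ᵥ y ≤ x ⬝ᵥ y := by
    rw [hy, dotProduct_inv_regGram_eq s f x]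
    exact le_add_of_nonneg_right (Finset.sum_nonneg fun l _ => sq_nonneg _)
  have h2 := dotProduct_sq_le x y
  have h3 := dotProduct_self_nonneg' y
  have h4 := dotProduct_self_nonneg' x
  rcases h3.eq_or_lt with h | h
  · rw [← h]; exact h4
  · by_contra hc
    push Not at hc
    nlinarith

theorem dotProduct_inv_regGram_le (s : Finset ι) (f : ι → Fin d → ℝ) (x : Fin d → ℝ) :
    x ⬝ᵥ (regGram s f)⁻¹ *ᵥ x ≤ x ⬝ᵥ x := by
  have h1 := dotProduct_sq_le x ((regGram s f)⁻¹ *ᵥ x)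
  have h2 := inv_regGram_mulVec_self_le s f x
  have h3 := dotProduct_self_nonneg' x
  refine abs_le_of_sq_le_sq' ?_ h3 |>.2
  rw [sq (x ⬝ᵥ x)]
  exact h1.trans (mul_le_mul_of_nonneg_left h2 h3)

/-- Cauchy–Schwarz for the inner product given by the inverse of the Gram matrix. -/
theorem abs_dotProduct_inv_regGram_le (s : Finset ι) (f : ι → Fin d → ℝ) (x y : Fin d → ℝ) :
    |x ⬝ᵥ (regGram s f)⁻¹ *ᵥ y| ≤
      √(x ⬝ᵥ (regGram s f)⁻¹ *ᵥ x) * √(y ⬝ᵥ (regGram s f)⁻¹ *ᵥ y) := by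
  have h := LinearMap.BilinForm.apply_mul_apply_le_of_forall_zero_le
    (Matrix.toBilin' (regGram s f)⁻¹) (fun x => by
      rw [Matrix.toBilin'_apply']; exact dotProduct_inv_regGram_nonneg s f x) x y
  simp only [Matrix.toBilin'_apply'] at h
  rw [dotProduct_inv_regGram_comm s f y x, ← sq] at h
  rw [← Real.sqrt_mul (dotProduct_inv_regGram_nonneg s f x)]
  exact Real.abs_le_sqrt h

/-- With `v` the sum and `y = G⁻¹ v`, Cauchy–Schwarz bounds `v·y = ∑ x l (y·f l)` by `√(∑ x l²)`
times `√(∑ (y·f l)²)`, and the last sum is at most `v·y`. There is no factor depending on `d`; this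
is how drift enters the regression error. -/
theorem sqrt_dotProduct_inv_regGram_sum_le (s : Finset ι) (f : ι → Fin d → ℝ) (x : ι → ℝ) :
    √((∑ l ∈ s, x l • f l) ⬝ᵥ (regGram s f)⁻¹ *ᵥ (∑ l ∈ s, x l • f l)) ≤
      √(∑ l ∈ s, x l ^ 2) := by
  apply Real.sqrt_le_sqrt
  set v := ∑ l ∈ s, x l • f l with hv
  set y := (regGram s f)⁻¹ *ᵥ v with hy
  have h1 : v ⬝ᵥ y = ∑ l ∈ s, x l * (y ⬝ᵥ f l) := by
    rw [dotProduct_comm, hv, dotProduct_sum]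
    simp
  have h2 : ∑ l ∈ s, (y ⬝ᵥ f l) ^ 2 ≤ v ⬝ᵥ y := by
    rw [hy, dotProduct_inv_regGram_eq s f v]
    exact le_add_of_nonneg_left (dotProduct_self_nonneg' _)
  have h3 := Finset.sum_mul_sq_le_sq_mul_sq s x (fun l => y ⬝ᵥ f l)
  rw [← h1] at h3
  have h4 : 0 ≤ ∑ l ∈ s, x l ^ 2 := Finset.sum_nonneg fun l _ => sq_nonneg _
  have h5 : 0 ≤ v ⬝ᵥ y := dotProduct_inv_regGram_nonneg s f v
  rcases h5.eq_or_lt with h | h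
  · rw [← h]; exact h4
  · by_contra hc
    push Not at hc
    nlinarith

/-- Cauchy–Schwarz on basis vectors, using `G⁻¹ ≤ I`. It confines the bonus matrices to a bounded
region that a finite grid can cover. -/
theorem abs_inv_regGram_apply_le (s : Finset ι) (f : ι → Fin d → ℝ) (i j : Fin d) :
    |(regGram s f)⁻¹ i j| ≤ 1 := by
  have h := abs_dotProduct_inv_regGram_le s f (Pi.single i 1) (Pi.single j 1)
  have h1 : ∀ i : Fin d, √(Pi.single i 1 ⬝ᵥ (regGram s f)⁻¹ *ᵥ (Pi.single i 1)) ≤ 1 := by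
    intro i
    rw [Real.sqrt_le_one]
    exact (dotProduct_inv_regGram_le s f _).trans (by simp)
  have h2 : Pi.single i 1 ⬝ᵥ (regGram s f)⁻¹ *ᵥ (Pi.single j 1) = (regGram s f)⁻¹ i j := by
    simp
  rw [h2] at h
  exact h.trans (mul_le_one₀ (h1 i) (Real.sqrt_nonneg _) (h1 j))

/-- The concave quadratic `y ↦ y·v - t/2 yᵀGy` at distance `y - G⁻¹v/t` from its maximizer. -/
theorem quadratic_completion (s : Finset ι) (f : ι → Fin d → ℝ) (v y : Fin d → ℝ) {t : ℝ}
    (ht : t ≠ 0) :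
    v ⬝ᵥ (regGram s f)⁻¹ *ᵥ v / (2 * t) =
      (y ⬝ᵥ v - t / 2 * (y ⬝ᵥ regGram s f *ᵥ y)) +
        t / 2 * ((y - t⁻¹ • ((regGram s f)⁻¹ *ᵥ v)) ⬝ᵥ
          regGram s f *ᵥ (y - t⁻¹ • ((regGram s f)⁻¹ *ᵥ v))) := by
  set G := regGram s f
  set z := G⁻¹ *ᵥ v with hz
  have hv : G *ᵥ z = v := regGram_mulVec_inv_mulVec s f v
  have hzy : z ⬝ᵥ G *ᵥ y = y ⬝ᵥ v := by
    rw [dotProduct_comm, hz, dotProduct_inv_regGram_comm, inv_regGram_mulVec_mulVec,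
      dotProduct_comm]
  rw [mulVec_sub, mulVec_smul, hv, sub_dotProduct, dotProduct_sub, dotProduct_sub,
    smul_dotProduct, smul_dotProduct, dotProduct_smul, dotProduct_smul, hzy, dotProduct_comm z v]
  simp only [smul_eq_mul]
  field_simp
  ring

theorem regGram_insert [DecidableEq ι] {s : Finset ι} {a : ι} (ha : a ∉ s)
    (f : ι → Fin d → ℝ) :
    regGram (insert a s) f = regGram s f + vecMulVec (f a) (f a) := by
  rw [regGram, regGram, Finset.sum_insert ha, add_comm (vecMulVec _ _), add_assoc]

theorem det_regGram_insert [DecidableEq ι] {s : Finset ι} {a : ι} (ha : a ∉ s)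
    (f : ι → Fin d → ℝ) :
    (regGram (insert a s) f).det =
      (regGram s f).det * (1 + f a ⬝ᵥ (regGram s f)⁻¹ *ᵥ f a) := by
  rw [regGram_insert ha, vecMulVec_eq Unit,
    det_add_replicateCol_mul_replicateRow (isUnit_det_regGram s f)]
  congr 1
  rw [det_unique]
  simp [Matrix.mul_apply, dotProduct, mulVec, Finset.sum_mul, Finset.mul_sum, mul_assoc]
  exact Finset.sum_comm

/-- Each eigenvalue is at most the trace, which is at most `d + s.card`; this crude bound costs only
a constant factor inside the logarithm. -/
theorem log_det_regGram_le (s : Finset ι) (f : ι → Fin d → ℝ) (hf : ∀ l ∈ s, f l ⬝ᵥ f l ≤ 1) :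
    Real.log (regGram s f).det ≤ d * Real.log (d + s.card) := by
  have hG := posDef_regGram s f
  have htr : (regGram s f).trace ≤ d + s.card := by
    rw [regGram, trace_add, trace_one, trace_sum, Fintype.card_fin]
    gcongr
    rw [← nsmul_one, ← Finset.sum_const]
    refine Finset.sum_le_sum fun l hl => ?_
    rw [trace_vecMulVec]
    exact hf l hl
  have hsum := hG.isHermitian.trace_eq_sum_eigenvalues
  have hdet := hG.isHermitian.det_eq_prod_eigenvalues
  simp only [RCLike.ofReal_real_eq_id, id_eq] at hsum hdet
  rw [hdet, Real.log_prod fun i _ => (hG.eigenvalues_pos i).ne']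
  have : ∀ i ∈ Finset.univ, Real.log (hG.isHermitian.eigenvalues i) ≤ Real.log (d + s.card) := by
    intro i _
    refine Real.log_le_log (hG.eigenvalues_pos i) (le_trans ?_ htr)
    rw [hsum]
    exact Finset.single_le_sum (f := hG.isHermitian.eigenvalues)
      (fun j _ => (hG.eigenvalues_pos j).le) (Finset.mem_univ i)
  refine (Finset.sum_le_sum this).trans ?_
  simp

/-- The elliptical potential lemma. -/
theorem sum_dotProduct_inv_regGram_le (f : ℕ → Fin d → ℝ) (τ m : ℕ) (hm : τ ≤ m)
    (hf : ∀ l, f l ⬝ᵥ f l ≤ 1) :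
    ∑ k ∈ Finset.Ico τ m, f k ⬝ᵥ (regGram (Finset.Ico τ k) f)⁻¹ *ᵥ f k ≤
      2 * (d * Real.log (d + (m - τ : ℕ))) := by
  have key : ∀ m, τ ≤ m → ∑ k ∈ Finset.Ico τ m, f k ⬝ᵥ (regGram (Finset.Ico τ k) f)⁻¹ *ᵥ f k ≤
      2 * Real.log (regGram (Finset.Ico τ m) f).det := by
    intro m hm
    induction m, hm using Nat.le_induction with
    | base => simp [regGram]
    | succ m hm ih =>
      rw [Finset.sum_Ico_succ_top hm]
      have hins : Finset.Ico τ (m + 1) = insert m (Finset.Ico τ m) := by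
        rw [Finset.insert_Ico_right_eq_Ico_add_one hm]
      rw [hins, det_regGram_insert (by simp)]
      set q := f m ⬝ᵥ (regGram (Finset.Ico τ m) f)⁻¹ *ᵥ f m with hq
      have hq0 : 0 ≤ q := dotProduct_inv_regGram_nonneg _ _ _
      have hq1 : q ≤ 1 := (dotProduct_inv_regGram_le _ _ _).trans (hf m)
      rw [Real.log_mul (posDef_regGram _ f).det_pos.ne' (by positivity)]
      -- This needs `q ≤ 1`, which the regularization by the identity guarantees.
      have : q ≤ 2 * Real.log (1 + q) := by
        have h := Real.one_sub_inv_le_log_of_pos (x := 1 + q) (by positivity)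
        have h' : q / 2 ≤ 1 - (1 + q)⁻¹ := by
          rw [show 1 - (1 + q)⁻¹ = q / (1 + q) by field_simp; ring]
          gcongr
          linarith
        linarith
      linarith
  refine (key m hm).trans ?_
  gcongr
  have := log_det_regGram_le (Finset.Ico τ m) f (fun l _ => hf l)
  simpa using this

end RegularizedGram

/-! ### Policy values and the Bellman equation. -/

section Values

variable {S A : Type*} [MeasurableSpace S] [MeasurableSpace A] {H K : ℕ}

theorem measurable_transition (M : EpisodicMDP S A H K) (k h : ℕ) {π : S → A}
    (hπ : Measurable π) : Measurable fun x => M.P k h (x, π x) :=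
  (M.P k h).measurable.comp (measurable_id.prodMk hπ)

theorem measurable_stateLaw (M : EpisodicMDP S A H K) (k : ℕ) {π : ℕ → S → A}
    (hπ : ∀ j, Measurable (π j)) (h n : ℕ) : Measurable fun s => stateLaw M k π h s n := by
  induction n with
  | zero => exact Measure.measurable_dirac
  | succ n ih => exact (Measure.measurable_bind' (measurable_transition M k _ (hπ _))).comp ih

theorem isProbabilityMeasure_stateLaw (M : EpisodicMDP S A H K) {k : ℕ} (hk : k < K)
    {π : ℕ → S → A} (hπ : ∀ j, Measurable (π j)) (h : ℕ) (s : S) (n : ℕ) (hn : h + n ≤ H) :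
    IsProbabilityMeasure (stateLaw M k π h s n) := by
  induction n with
  | zero => exact Measure.dirac.isProbabilityMeasure
  | succ n ih =>
    have := ih (by omega)
    have hM := M.isMarkov k hk (h + n) (by omega)
    exact isProbabilityMeasure_bind (measurable_transition M k _ (hπ _)).aemeasurable
      (Filter.Eventually.of_forall fun x => hM.isProbabilityMeasure _)

/-- `stateLaw` grows by appending a last transition, whereas the Bellman equation splits off the
first one; associativity of `bind` reconciles the two. -/
theorem stateLaw_succ (M : EpisodicMDP S A H K) (k : ℕ) {π : ℕ → S → A}
    (hπ : ∀ j, Measurable (π j)) (h : ℕ) (s : S) (n : ℕ) :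
    stateLaw M k π h s (n + 1) =
      (M.P k h (s, π h s)).bind fun s' => stateLaw M k π (h + 1) s' n := by
  induction n with
  | zero =>
    change (Measure.dirac s).bind _ = (M.P k h (s, π h s)).bind Measure.dirac
    rw [Measure.dirac_bind (measurable_transition M k _ (hπ _)), Measure.bind_dirac]
    rfl
  | succ n ih =>
    change (stateLaw M k π h s (n + 1)).bind _ = (M.P k h (s, π h s)).bind fun s' =>
      (stateLaw M k π (h + 1) s' n).bind _
    rw [ih, Measure.bind_bind (measurable_stateLaw M k hπ _ _).aemeasurable
      (measurable_transition M k _ (hπ _)).aemeasurable, Nat.add_right_comm h 1 n, ← add_assoc]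

theorem measurable_reward (M : EpisodicMDP S A H K) {k h : ℕ} (hk : k < K) (hh : h < H)
    {π : S → A} (hπ : Measurable π) : Measurable fun x => M.r k h x (π x) :=
  (M.measurable_r k hk h hh).comp (measurable_id.prodMk hπ)

theorem integral_mem_Icc {ν : Measure S} [IsProbabilityMeasure ν] {f : S → ℝ} (hf : Measurable f)
    {a b : ℝ} (hab : ∀ x, f x ∈ Set.Icc a b) : ∫ x, f x ∂ν ∈ Set.Icc a b := by
  have hi : Integrable f ν := Integrable.of_mem_Icc a b hf.aemeasurable (.of_forall hab)
  constructor
  · simpa using integral_mono (integrable_const a) hi fun x => (hab x).1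
  · simpa using integral_mono hi (integrable_const b) fun x => (hab x).2

theorem integral_reward_mem (M : EpisodicMDP S A H K) {k : ℕ} (hk : k < K)
    {π : ℕ → S → A} (hπ : ∀ j, Measurable (π j)) (h : ℕ) (s : S) (n : ℕ) (hn : h + n < H) :
    ∫ x, M.r k (h + n) x (π (h + n) x) ∂(stateLaw M k π h s n) ∈ Set.Icc (0 : ℝ) 1 := by
  have := isProbabilityMeasure_stateLaw M hk hπ h s n hn.le
  exact integral_mem_Icc (measurable_reward M hk hn (hπ _)) fun x => M.r_mem k hk _ hn _ _

theorem value_mem (M : EpisodicMDP S A H K) {k : ℕ} (hk : k < K)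
    {π : ℕ → S → A} (hπ : ∀ j, Measurable (π j)) (h : ℕ) (s : S) :
    value M k π h s ∈ Set.Icc (0 : ℝ) (H - h : ℕ) := by
  have key : ∀ n ∈ Finset.range (H - h),
      ∫ x, M.r k (h + n) x (π (h + n) x) ∂(stateLaw M k π h s n) ∈ Set.Icc (0 : ℝ) 1 := by
    intro n hn
    have := Finset.mem_range.1 hn
    exact integral_reward_mem M hk hπ h s n (by omega)
  constructor
  · exact Finset.sum_nonneg fun n hn => (key n hn).1
  · refine (Finset.sum_le_sum fun n hn => (key n hn).2).trans ?_
    simp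

theorem value_mem' (M : EpisodicMDP S A H K) {k : ℕ} (hk : k < K)
    {π : ℕ → S → A} (hπ : ∀ j, Measurable (π j)) (h : ℕ) (s : S) :
    value M k π h s ∈ Set.Icc (0 : ℝ) H := by
  refine ⟨(value_mem M hk hπ h s).1, (value_mem M hk hπ h s).2.trans ?_⟩
  exact_mod_cast Nat.sub_le H h

theorem measurable_integral_stateLaw (M : EpisodicMDP S A H K) (k : ℕ)
    {π : ℕ → S → A} (hπ : ∀ j, Measurable (π j)) (h n : ℕ) {f : S → ℝ} (hf : Measurable f) :
    Measurable fun s => ∫ x, f x ∂(stateLaw M k π h s n) := by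
  let η : Kernel S S := ⟨fun s => stateLaw M k π h s n, measurable_stateLaw M k hπ h n⟩
  exact (StronglyMeasurable.integral_kernel (κ := η) hf.stronglyMeasurable).measurable

theorem measurable_value (M : EpisodicMDP S A H K) {k : ℕ} (hk : k < K)
    {π : ℕ → S → A} (hπ : ∀ j, Measurable (π j)) (h : ℕ) :
    Measurable fun s => value M k π h s := by
  refine Finset.measurable_sum _ fun n hn => ?_
  have := Finset.mem_range.1 hn
  exact measurable_integral_stateLaw M k hπ h n (measurable_reward M hk (by omega) (hπ _))

theorem value_of_le (M : EpisodicMDP S A H K) (k : ℕ) (π : ℕ → S → A) {h : ℕ} (hh : H ≤ h)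
    (s : S) : value M k π h s = 0 := by
  simp [value, Nat.sub_eq_zero_of_le hh]

/-- The Bellman equation of a policy. -/
theorem value_eq (M : EpisodicMDP S A H K) {k : ℕ} (hk : k < K)
    {π : ℕ → S → A} (hπ : ∀ j, Measurable (π j)) {h : ℕ} (hh : h < H) (s : S) :
    value M k π h s =
      M.r k h s (π h s) + ∫ s', value M k π (h + 1) s' ∂(M.P k h (s, π h s)) := by
  have hM := M.isMarkov k hk h hh
  rw [value, show H - h = (H - (h + 1)) + 1 by omega, Finset.sum_range_succ', add_comm]
  congr 1
  · change ∫ x, M.r k h x (π h x) ∂(Measure.dirac s) = _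
    exact integral_dirac' _ _ (measurable_reward M hk hh (hπ _)).stronglyMeasurable
  · simp only [value]
    rw [integral_finsetSum]
    · refine Finset.sum_congr rfl fun n hn => ?_
      have hn' := Finset.mem_range.1 hn
      let η : Kernel S S :=
        ⟨fun s => stateLaw M k π (h + 1) s n, measurable_stateLaw M k hπ (h + 1) n⟩
      have hpr := isProbabilityMeasure_stateLaw M hk hπ h s (n + 1) (by omega)
      have hm := measurable_reward M hk (show h + (n + 1) < H by omega)
        (hπ (h + (n + 1)))
      rw [stateLaw_succ M k hπ] at hpr ⊢
      rw [show h + 1 + n = h + (n + 1) by omega]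
      exact Kernel.integral_comp (κ := M.P k h) (η := η) (a := (s, π h s))
        (Integrable.of_mem_Icc (μ := (M.P k h (s, π h s)).bind η) 0 1 hm.aemeasurable
          (.of_forall fun x => M.r_mem k hk _ (by omega) _ _))
    · intro n hn
      have hn' := Finset.mem_range.1 hn
      refine Integrable.of_mem_Icc 0 1 (measurable_integral_stateLaw M k hπ (h + 1) n
        (measurable_reward M hk (by omega) (hπ _))).aemeasurable
        (.of_forall fun x => integral_reward_mem M hk hπ (h + 1) x n (by omega))

theorem optValue_le (M : EpisodicMDP S A H K) [Nonempty A] {k h : ℕ} {s : S} {b : ℝ}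
    (hb : ∀ π : ℕ → S → A, (∀ j, Measurable (π j)) → value M k π h s ≤ b) :
    optValue M k h s ≤ b := by
  have : Nonempty {π : ℕ → S → A // ∀ j, Measurable (π j)} :=
    ⟨⟨fun _ _ => Classical.arbitrary A, fun _ => measurable_const⟩⟩
  exact ciSup_le fun π => hb π.1 π.2

end Values

/-! ### Integrating out the next state, and exponential moments. -/

section Disintegration

open scoped ENNReal

variable {Ω D S : Type*} {mΩ : MeasurableSpace Ω} {mD : MeasurableSpace D} [MeasurableSpace S]

/-- If the kernel `κ` is a version of the conditional law of `X` given `Y`, then the expectation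
of `g (Y, X)` can be computed by first integrating out `X`. -/
theorem lintegral_eq_lintegral_kernel {Pr : Measure Ω} [IsProbabilityMeasure Pr] {Y : Ω → D}
    (hY : Measurable Y) {X : Ω → S} (hX : Measurable X) (κ : Kernel D S) [IsMarkovKernel κ]
    (h : ∀ B, MeasurableSet B →
      Pr⟦X ⁻¹' B | MeasurableSpace.comap Y mD⟧ =ᵐ[Pr] fun ω => (κ (Y ω)).real B)
    {g : D × S → ℝ≥0∞} (hg : Measurable g) :
    ∫⁻ ω, g (Y ω, X ω) ∂Pr = ∫⁻ ω, ∫⁻ y, g (Y ω, y) ∂(κ (Y ω)) ∂Pr := by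
  have := Measure.isProbabilityMeasure_map (μ := Pr) hY.aemeasurable
  have hle : MeasurableSpace.comap Y mD ≤ mΩ := hY.comap_le
  -- The joint law is identified on rectangles, so the kernel at hand serves as the conditional law
  -- and no regularity of the state space is needed.
  have hmeas : Pr.map (fun ω => (Y ω, X ω)) = (Pr.map Y) ⊗ₘ κ := by
    have := Measure.isProbabilityMeasure_map (μ := Pr) (hY.prodMk hX).aemeasurable
    refine Measure.ext_prod fun {A B} hA hB => ?_
    rw [Measure.compProd_apply_prod hA hB, Measure.map_apply (hY.prodMk hX) (hA.prod hB),
      setLIntegral_map hA (κ.measurable_coe hB) hY]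
    have hYA : MeasurableSet[MeasurableSpace.comap Y mD] (Y ⁻¹' A) := ⟨A, hA, rfl⟩
    have h1 : ∫ ω in Y ⁻¹' A, (κ (Y ω)).real B ∂Pr = Pr.real (Y ⁻¹' A ∩ X ⁻¹' B) := by
      rw [← setIntegral_congr_ae (hY hA) ((h B hB).mono fun ω hω _ => hω),
        setIntegral_condExp hle ((integrable_const _).indicator (hX hB)) hYA,
        integral_indicator (hX hB), Measure.restrict_restrict (hX hB)]
      simp [Set.inter_comm]
    have h2 : ∫⁻ ω in Y ⁻¹' A, κ (Y ω) B ∂Pr =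
        ENNReal.ofReal (∫ ω in Y ⁻¹' A, (κ (Y ω)).real B ∂Pr) := by
      have hmk : Measurable fun ω => (κ (Y ω)).real B :=
        ((κ.measurable_coe hB).comp hY).ennreal_toReal
      rw [ofReal_integral_eq_lintegral_ofReal]
      · simp [measureReal_def]
      · exact Integrable.of_mem_Icc 0 1 hmk.aemeasurable
          (.of_forall fun ω => ⟨measureReal_nonneg, measureReal_le_one⟩)
      · exact .of_forall fun ω => measureReal_nonneg
    rw [h2, h1, measureReal_def, ENNReal.ofReal_toReal (measure_ne_top _ _)]
    rfl
  rw [← lintegral_map hg (hY.prodMk hX), hmeas, Measure.lintegral_compProd hg,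
    lintegral_map (Measurable.lintegral_kernel_prod_right' hg) hY]

/-- One step of a multiplicative supermartingale. -/
theorem lintegral_mul_le_of_kernel {Pr : Measure Ω} [IsProbabilityMeasure Pr] {Y : Ω → D}
    (hY : Measurable Y) {X : Ω → S} (hX : Measurable X) (κ : Kernel D S) [IsMarkovKernel κ]
    (h : ∀ B, MeasurableSet B →
      Pr⟦X ⁻¹' B | MeasurableSpace.comap Y mD⟧ =ᵐ[Pr] fun ω => (κ (Y ω)).real B)
    {F : D → ℝ≥0∞} (hF : Measurable F) {g : D × S → ℝ≥0∞} (hg : Measurable g)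
    (hle : ∀ e, ∫⁻ y, g (e, y) ∂(κ e) ≤ 1) :
    ∫⁻ ω, F (Y ω) * g (Y ω, X ω) ∂Pr ≤ ∫⁻ ω, F (Y ω) ∂Pr := by
  rw [lintegral_eq_lintegral_kernel hY hX κ h (g := fun z => F z.1 * g z)
    ((hF.comp measurable_fst).mul hg)]
  refine lintegral_mono fun ω => ?_
  change ∫⁻ y, F (Y ω) * g (Y ω, y) ∂(κ (Y ω)) ≤ F (Y ω)
  rw [lintegral_const_mul _ (f := fun y => g (Y ω, y)) (hg.comp measurable_prodMk_left)]
  exact mul_le_of_le_one_right' (hle _)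

/-- Hoeffding's lemma in exponential form. -/
theorem lintegral_exp_le_one {ν : Measure S} [IsProbabilityMeasure ν] {f : S → ℝ}
    (hf : Measurable f) {a b : ℝ} (hab : ∀ y, f y ∈ Set.Icc a b) (c : ℝ) :
    ∫⁻ y, ENNReal.ofReal (Real.exp (c * (f y - ∫ z, f z ∂ν) - c ^ 2 * (b - a) ^ 2 / 8)) ∂ν
      ≤ 1 := by
  have hs := hasSubgaussianMGF_of_mem_Icc (μ := ν) hf.aemeasurable (.of_forall hab)
  have h1 := hs.mgf_le c
  have hi := hs.integrable_exp_mul c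
  rw [mgf] at h1
  have h2 : ((((‖b - a‖₊ / 2) ^ 2 : NNReal) : ℝ)) * c ^ 2 / 2 = c ^ 2 * (b - a) ^ 2 / 8 := by
    simp only [NNReal.coe_pow, NNReal.coe_div, coe_nnnorm, NNReal.coe_ofNat, div_pow,
      Real.norm_eq_abs, sq_abs]
    ring
  rw [h2] at h1
  simp_rw [Real.exp_sub]
  rw [← ofReal_integral_eq_lintegral_ofReal (hi.div_const _)
    (.of_forall fun y => by positivity), integral_div]
  rw [ENNReal.ofReal_le_one, div_le_one (Real.exp_pos _)]
  exact h1

theorem measure_ge_le_exp_neg {Pr : Measure Ω} {Z : Ω → ℝ} (hZ : Measurable Z)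
    (h : ∫⁻ ω, ENNReal.ofReal (Real.exp (Z ω)) ∂Pr ≤ 1) (L : ℝ) :
    Pr {ω | L < Z ω} ≤ ENNReal.ofReal (Real.exp (-L)) := by
  have hm : Measurable fun ω => ENNReal.ofReal (Real.exp (Z ω)) :=
    (Real.measurable_exp.comp hZ).ennreal_ofReal
  have h1 := mul_meas_ge_le_lintegral (μ := Pr) hm (ENNReal.ofReal (Real.exp L))
  have h2 : Pr {ω | L < Z ω} ≤
      Pr {ω | ENNReal.ofReal (Real.exp L) ≤ ENNReal.ofReal (Real.exp (Z ω))} := by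
    refine measure_mono fun ω hω => ENNReal.ofReal_le_ofReal (Real.exp_le_exp.2 (le_of_lt hω))
  rw [Real.exp_neg, ENNReal.ofReal_inv_of_pos (Real.exp_pos _)]
  rw [ENNReal.le_inv_iff_mul_le]
  rw [mul_comm]
  exact (mul_le_mul_right h2 _).trans (h1.trans h)

end Disintegration

/-! ### Expectations of the next state in a linear MDP, by the layer-cake formula. -/

section LinearIntegral

variable {S A : Type*} [MeasurableSpace S] [MeasurableSpace A] {H K d : ℕ}

theorem norm_le_vmNorm (ν : VectorMeasure S (EuclideanSpace ℝ (Fin d))) (B : Set S) :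
    ‖ν B‖ ≤ vmNorm ν :=
  le_ciSup (bddAbove_vmNorm ν) B

theorem vmNorm_nonneg (ν : VectorMeasure S (EuclideanSpace ℝ (Fin d))) : 0 ≤ vmNorm ν :=
  (norm_nonneg _).trans (norm_le_vmNorm ν ∅)

/-- The superlevel sets of a measurable function have measurable vector measure. -/
theorem measurable_vectorMeasure_superlevel (ν : VectorMeasure S (EuclideanSpace ℝ (Fin d)))
    {V : S → ℝ} (hV : Measurable V) : Measurable fun t : ℝ => ν {x | t < V x} := by
  have hset : ∀ t : ℝ, MeasurableSet {x | t < V x} := fun t => measurableSet_lt measurable_const hV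
  suffices h : Measurable fun t : ℝ => (ν {x | t < V x}).ofLp from
    (WithLp.measurable_toLp 2 _).comp h
  refine measurable_pi_iff.2 fun i => ?_
  let pr : EuclideanSpace ℝ (Fin d) →L[ℝ] ℝ := EuclideanSpace.proj i
  let σ : SignedMeasure S := ν.mapRange pr.toLinearMap.toAddMonoidHom pr.continuous
  -- Superlevel sets shrink as `t` grows, so their mass under a finite measure is monotone in `t`.
  -- The Jordan decomposition reduces each coordinate of `ν` to this case.
  have hanti : ∀ κ : Measure S, IsFiniteMeasure κ → Measurable fun t : ℝ => κ.real {x | t < V x} :=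
    fun κ _ => Antitone.measurable fun t t' htt =>
      measureReal_mono fun x (hx : t' < V x) => lt_of_le_of_lt htt hx
  have heq : ∀ t : ℝ, (ν {x | t < V x}).ofLp i =
      σ.toJordanDecomposition.posPart.real {x | t < V x} -
        σ.toJordanDecomposition.negPart.real {x | t < V x} := by
    intro t
    have h1 : (ν {x | t < V x}).ofLp i = σ {x | t < V x} := rfl
    have h2 : σ {x | t < V x} = σ.toJordanDecomposition.toSignedMeasure {x | t < V x} := by
      rw [σ.toSignedMeasure_toJordanDecomposition]
    rw [h1, h2, JordanDecomposition.toSignedMeasure, sub_apply,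
      Measure.toSignedMeasure_apply_measurable (hset t),
      Measure.toSignedMeasure_apply_measurable (hset t)]
  simp_rw [heq]
  exact (hanti _ inferInstance).sub (hanti _ inferInstance)

theorem integral_eq_intervalIntegral_superlevel {ν : Measure S} [IsProbabilityMeasure ν]
    {V : S → ℝ} (hV : Measurable V) {b : ℝ} (hb : 0 ≤ b) (hVb : ∀ x, V x ∈ Set.Icc 0 b) :
    ∫ x, V x ∂ν = ∫ t in (0 : ℝ)..b, ν.real {x | t < V x} := by
  have hi : Integrable V ν := Integrable.of_mem_Icc 0 b hV.aemeasurable (.of_forall hVb)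
  rw [hi.integral_eq_integral_meas_lt (.of_forall fun x => (hVb x).1),
    intervalIntegral.integral_of_le hb]
  refine (setIntegral_eq_of_subset_of_forall_sdiff_eq_zero measurableSet_Ioi
    (fun t ht => ht.1) fun t ht => ?_)
  have : {x | t < V x} = ∅ := by
    ext x
    simp only [Set.mem_ofPred_eq, Set.mem_empty_iff_false, iff_false, not_lt]
    have h2 : ¬ t ≤ b := fun h => ht.2 ⟨ht.1, h⟩
    linarith [(hVb x).2]
  simp [this]

variable {M : EpisodicMDP S A H K} {φ : S → A → EuclideanSpace ℝ (Fin d)}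
  {μ : ℕ → ℕ → VectorMeasure S (EuclideanSpace ℝ (Fin d))}
  {θ : ℕ → ℕ → EuclideanSpace ℝ (Fin d)}

/-- In a linear MDP, expectations of the next state are linear in the feature. -/
theorem exists_integral_eq_inner (hlin : IsLinearMDP M φ μ θ) {k h : ℕ} (hk : k < K) (hh : h < H)
    {V : S → ℝ} (hV : Measurable V) {b : ℝ} (hb : 0 ≤ b) (hVb : ∀ x, V x ∈ Set.Icc 0 b) :
    ∃ m : EuclideanSpace ℝ (Fin d), ‖m‖ ≤ b * √d ∧
      ∀ s a, ∫ x, V x ∂(M.P k h (s, a)) = ⟪φ s a, m⟫ := by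
  have hM := M.isMarkov k hk h hh
  have hnorm : ∀ t : ℝ, ‖μ k h {x | t < V x}‖ ≤ √d := fun t =>
    (norm_le_vmNorm _ _).trans (hlin.norm_measure k hk h hh)
  have hint : IntervalIntegrable (fun t : ℝ => μ k h {x | t < V x}) volume 0 b := by
    refine (intervalIntegrable_const (c := √d)).mono_fun
      (measurable_vectorMeasure_superlevel (μ k h) hV).aestronglyMeasurable
      (.of_forall fun t => ?_)
    simpa [abs_of_nonneg (Real.sqrt_nonneg _)] using hnorm t
  -- Layer cake in place of integration against a vector measure: the integral of `V` is the
  -- integral over levels of the mass of `{t < V}`, and that mass is linear in the feature.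
  refine ⟨∫ t in (0 : ℝ)..b, μ k h {x | t < V x}, ?_, fun s a => ?_⟩
  · refine (intervalIntegral.norm_integral_le_of_norm_le_const fun t _ => hnorm t).trans ?_
    rw [sub_zero, abs_of_nonneg hb, mul_comm]
  · rw [integral_eq_intervalIntegral_superlevel hV hb hVb]
    have := (innerSL ℝ (φ s a)).intervalIntegral_comp_comm hint
    simp only [innerSL_apply_apply] at this
    rw [← this]
    refine intervalIntegral.integral_congr fun t _ => ?_
    exact hlin.transition k hk h hh s a _ (measurableSet_lt measurable_const hV)

/-- At each level `t` the two masses differ by the inner product of a feature of norm at most 1 with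
a difference of the `μ`'s at one set; integrating over `[0, b]` gives the factor `b`. -/
theorem abs_integral_sub_integral_le (hlin : IsLinearMDP M φ μ θ) {k l h : ℕ} (hk : k < K)
    (hl : l < K) (hh : h < H) {V : S → ℝ} (hV : Measurable V) {b : ℝ} (hb : 0 ≤ b)
    (hVb : ∀ x, V x ∈ Set.Icc 0 b) (s : S) (a : A) {v : ℝ}
    (hv : ∀ B, ‖μ k h B - μ l h B‖ ≤ v) :
    |∫ x, V x ∂(M.P k h (s, a)) - ∫ x, V x ∂(M.P l h (s, a))| ≤ b * v := by
  have hM := M.isMarkov k hk h hh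
  have hM' := M.isMarkov l hl h hh
  rw [integral_eq_intervalIntegral_superlevel hV hb hVb,
    integral_eq_intervalIntegral_superlevel hV hb hVb]
  have hint : ∀ ν : Measure S, IsProbabilityMeasure ν →
      IntervalIntegrable (fun t : ℝ => ν.real {x | t < V x}) volume 0 b := fun ν _ =>
    (Antitone.intervalIntegrable fun t t' htt =>
      measureReal_mono fun x (hx : t' < V x) => lt_of_le_of_lt htt hx)
  rw [← intervalIntegral.integral_sub (hint _ inferInstance) (hint _ inferInstance)]
  rw [← Real.norm_eq_abs]
  refine (intervalIntegral.norm_integral_le_of_norm_le_const (C := v) fun t _ => ?_).trans ?_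
  · have hset : MeasurableSet {x | t < V x} := measurableSet_lt measurable_const hV
    rw [hlin.transition k hk h hh s a _ hset, hlin.transition l hl h hh s a _ hset,
      ← inner_sub_right]
    refine (norm_inner_le_norm _ _).trans ?_
    calc _ ≤ 1 * v := mul_le_mul (hlin.norm_feature s a) (hv _) (norm_nonneg _) zero_le_one
      _ = v := one_mul v
  · rw [sub_zero, abs_of_nonneg hb, mul_comm]

/-- The variation over the epoch bounds the distance of two vectors in it. -/
theorem norm_sub_le_sum_variation {E : Type*} [SeminormedAddCommGroup E] {f : ℕ → E}
    {v : ℕ → ℝ} {τ e : ℕ} (hv : ∀ i, ‖f i - f (i - 1)‖ ≤ v i) {k l : ℕ}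
    (hl : τ ≤ l) (hlk : l ≤ k) (hk : k < e) :
    ‖f k - f l‖ ≤ ∑ i ∈ Finset.Ico τ e with i ≠ τ, v i := by
  have hv0 : ∀ i, 0 ≤ v i := fun i => (norm_nonneg _).trans (hv i)
  have h1 : ∀ k, l ≤ k → ‖f k - f l‖ ≤ ∑ i ∈ Finset.Ico (l + 1) (k + 1), v i := by
    intro k hlk
    induction k, hlk using Nat.le_induction with
    | base => simp
    | succ k hk ih =>
      rw [Finset.sum_Ico_succ_top (by omega)]
      have := hv (k + 1)
      rw [Nat.add_sub_cancel] at this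
      calc ‖f (k + 1) - f l‖ = ‖(f k - f l) + (f (k + 1) - f k)‖ := by congr 1; abel
        _ ≤ _ := (norm_add_le _ _).trans (add_le_add ih this)
  refine (h1 k hlk).trans (Finset.sum_le_sum_of_subset_of_nonneg (fun i hi => ?_)
    fun i _ _ => hv0 i)
  simp only [Finset.mem_filter, Finset.mem_Ico] at hi ⊢
  omega

end LinearIntegral

/-! ### Measurability of the algorithm's estimates and actions as functions of the data. -/

section Measurability

open Matrix

variable {S A E : Type*} [MeasurableSpace S] [MeasurableSpace A] {mE : MeasurableSpace E}
  [Finite A] [MeasurableSingletonClass A] {H K d : ℕ}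

theorem measurable_det {G : E → Matrix (Fin d) (Fin d) ℝ}
    (hG : ∀ i j, Measurable fun e => G e i j) : Measurable fun e => (G e).det := by
  simp_rw [det_apply]
  exact Finset.measurable_sum _ fun σ _ =>
    (Finset.measurable_prod _ fun i _ => hG _ _).const_smul _

theorem measurable_matrix_inv {G : E → Matrix (Fin d) (Fin d) ℝ}
    (hG : ∀ i j, Measurable fun e => G e i j) (i j : Fin d) :
    Measurable fun e => (G e)⁻¹ i j := by
  simp_rw [inv_def, Matrix.smul_apply, Ring.inverse_eq_inv', smul_eq_mul, adjugate_apply]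
  refine (measurable_det hG).inv.mul (measurable_det fun k l => ?_)
  simp_rw [updateRow_apply]
  split_ifs
  · exact measurable_const
  · exact hG k l

theorem measurable_mulVec {G : E → Matrix (Fin d) (Fin d) ℝ}
    (hG : ∀ i j, Measurable fun e => G e i j) {v : E → Fin d → ℝ}
    (hv : ∀ i, Measurable fun e => v e i) (i : Fin d) : Measurable fun e => (G e *ᵥ v e) i := by
  simp only [mulVec, dotProduct]
  exact Finset.measurable_sum _ fun j _ => (hG i j).mul (hv j)

theorem measurable_dotProduct {v w : E → Fin d → ℝ} (hv : ∀ i, Measurable fun e => v e i)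
    (hw : ∀ i, Measurable fun e => w e i) : Measurable fun e => v e ⬝ᵥ w e := by
  simp only [dotProduct]
  exact Finset.measurable_sum _ fun j _ => (hv j).mul (hw j)

variable {φ : S → A → EuclideanSpace ℝ (Fin d)}

theorem measurable_feature_apply (hφ : ∀ a, Measurable fun s => φ s a) {x : E → S} {u : E → A}
    (hx : Measurable x) (hu : Measurable u) (i : Fin d) :
    Measurable fun e => (φ (x e) (u e)).ofLp i := by
  have h : Measurable fun z : S × A => (φ z.1 z.2).ofLp i := by
    refine measurable_from_prod_countable_left fun a => ?_
    exact (measurable_pi_apply i).comp ((WithLp.measurable_ofLp 2 _).comp (hφ a))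
  exact h.comp (hx.prodMk hu)

theorem measurable_gram (hφ : ∀ a, Measurable fun s => φ s a) {x : E → ℕ → ℕ → S}
    {u : E → ℕ → ℕ → A} {τ k h : ℕ}
    (hx : ∀ l < k, Measurable fun e => x e l h) (hu : ∀ l < k, Measurable fun e => u e l h)
    (i j : Fin d) : Measurable fun e => gram φ (x e) (u e) τ k h i j := by
  simp only [gram, Matrix.add_apply, Matrix.sum_apply, vecMulVec_apply]
  refine measurable_const.add (Finset.measurable_sum _ fun l hl => ?_)
  have hl' := (Finset.mem_Ico.1 hl).2
  exact (measurable_feature_apply hφ (hx l hl') (hu l hl') i).mul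
    (measurable_feature_apply hφ (hx l hl') (hu l hl') j)

theorem measurable_weights (M : EpisodicMDP S A H K) (hφ : ∀ a, Measurable fun s => φ s a)
    {x : E → ℕ → ℕ → S} {u : E → ℕ → ℕ → A} {τ k h : ℕ} (hk : k ≤ K) (hh : h < H)
    (hx : ∀ l < k, Measurable fun e => x e l h) (hu : ∀ l < k, Measurable fun e => u e l h)
    {V : E → S → ℝ} (hV : ∀ l < k, Measurable fun e => V e (x e l (h + 1))) (i : Fin d) :
    Measurable fun e => weights φ M.r (x e) (u e) τ k h (V e) i := by
  refine measurable_mulVec (measurable_matrix_inv (measurable_gram hφ hx hu)) (fun j => ?_) i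
  simp only [Finset.sum_apply, Pi.smul_apply, smul_eq_mul]
  refine Finset.measurable_sum _ fun l hl => ?_
  have hl' := (Finset.mem_Ico.1 hl).2
  exact (((M.measurable_r l (by omega) h hh).comp ((hx l hl').prodMk (hu l hl'))).add
    (hV l hl')).mul (measurable_feature_apply hφ (hx l hl') (hu l hl') j)

theorem measurable_qStep (M : EpisodicMDP S A H K) (hφ : ∀ a, Measurable fun s => φ s a) {β : ℝ}
    {x : E → ℕ → ℕ → S} {u : E → ℕ → ℕ → A} {τ k h : ℕ} (hk : k ≤ K) (hh : h < H)
    (hx : ∀ l < k, Measurable fun e => x e l h) (hu : ∀ l < k, Measurable fun e => u e l h)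
    {V : E → S → ℝ} (hV : ∀ l < k, Measurable fun e => V e (x e l (h + 1))) (a : A) :
    Measurable fun z : E × S => qStep φ M.r H β (x z.1) (u z.1) τ k h (V z.1) z.2 a := by
  have hf : ∀ i, Measurable fun z : E × S => (φ z.2 a).ofLp i := fun i =>
    measurable_feature_apply hφ measurable_snd measurable_const i
  refine Measurable.min (Measurable.add ?_ (measurable_const.mul (Measurable.sqrt ?_)))
    measurable_const
  · exact measurable_dotProduct (fun i =>
      (measurable_weights M hφ hk hh hx hu hV i).comp measurable_fst) hf
  · exact measurable_dotProduct hf (measurable_mulVec (fun i j =>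
      (measurable_matrix_inv (measurable_gram hφ hx hu) i j).comp measurable_fst) hf)

theorem measurable_vEst (M : EpisodicMDP S A H K) (hφ : ∀ a, Measurable fun s => φ s a) {β : ℝ}
    {x : E → ℕ → ℕ → S} {u : E → ℕ → ℕ → A} {τ k : ℕ} (hk : k ≤ K)
    (hx : ∀ l < k, ∀ i < H, Measurable fun e => x e l i)
    (hu : ∀ l < k, ∀ i < H, Measurable fun e => u e l i) (n : ℕ) (hn : n ≤ H) :
    Measurable fun z : E × S => vEst φ M.r H β (x z.1) (u z.1) τ k n z.2 := by
  induction n with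
  | zero => exact measurable_const
  | succ n ih =>
    refine Measurable.iSup fun a => ?_
    have hlt : H - (n + 1) < H := by omega
    refine measurable_qStep M hφ hk hlt (fun l hl => hx l hl _ hlt) (fun l hl => hu l hl _ hlt)
      (V := fun e => vEst φ M.r H β (x e) (u e) τ k n) (fun l hl => ?_) a
    -- The regression of the last step would refer to a state after the end of the episode, about
    -- which nothing is assumed; there the target function is the constant `0`.
    cases n with
    | zero => exact measurable_const
    | succ n =>
      have h2 : Measurable fun e => (e, x e l (H - (n + 1 + 1) + 1)) :=
        measurable_id'.prodMk (hx l hl _ (by omega))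
      have h3 := (ih (by omega)).comp h2
      simp only [Function.comp_def] at h3
      exact h3

theorem measurable_greedyPolicy (M : EpisodicMDP S A H K) (hφ : ∀ a, Measurable fun s => φ s a)
    {β : ℝ} {N : ℕ} {sel : (A → ℝ) → A} (hsel : IsArgmaxRule sel)
    {x : E → ℕ → ℕ → S} {u : E → ℕ → ℕ → A} {k : ℕ} (hk : k ≤ K)
    (hx : ∀ l < k, ∀ i < H, Measurable fun e => x e l i)
    (hu : ∀ l < k, ∀ i < H, Measurable fun e => u e l i) {h : ℕ} (hh : h < H) :
    Measurable fun z : E × S => greedyPolicy φ M.r H β N sel (x z.1) (u z.1) k h z.2 := by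
  refine hsel.measurable.comp (measurable_pi_iff.2 fun a => ?_)
  refine measurable_qStep M hφ hk hh (fun l hl => hx l hl _ hh) (fun l hl => hu l hl _ hh)
      (V := fun e => vEst φ M.r H β (x e) (u e) (epochStart N k) k (H - (h + 1)))
      (fun l hl => ?_) a
  -- As above, the state with index `H` may be nonmeasurable, but is fed only to the zero function.
  by_cases hlast : h + 1 < H
  · have h2 : Measurable fun e => (e, x e l (h + 1)) :=
      measurable_id'.prodMk (hx l hl _ hlast)
    have h3 := (measurable_vEst (β := β) (τ := epochStart N k) M hφ hk hx hu _
      (Nat.sub_le H (h + 1))).comp h2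
    simp only [Function.comp_def] at h3
    exact h3
  · rw [show H - (h + 1) = 0 by omega]
    exact measurable_const

/-- For frozen data the weights and the Gram matrix are constants, so only the features matter. No
bound on `k` or `h` is required, so the greedy policy is admissible at every index. -/
theorem measurable_greedyPolicy_apply (M : EpisodicMDP S A H K)
    (hφ : ∀ a, Measurable fun s => φ s a) {β : ℝ} {N : ℕ} {sel : (A → ℝ) → A}
    (hsel : IsArgmaxRule sel) (x : ℕ → ℕ → S) (u : ℕ → ℕ → A) (k h : ℕ) :
    Measurable (greedyPolicy φ M.r H β N sel x u k h) := by
  refine hsel.measurable.comp (measurable_pi_iff.2 fun a => ?_)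
  have hf : ∀ i, Measurable fun s : S => (φ s a).ofLp i := fun i =>
    measurable_feature_apply hφ measurable_id measurable_const i
  refine Measurable.min (Measurable.add ?_ (measurable_const.mul (Measurable.sqrt ?_)))
    measurable_const
  · exact measurable_dotProduct (fun i => measurable_const) hf
  · exact measurable_dotProduct hf (measurable_mulVec (G := fun _ => (gram φ x u (epochStart N k) k h)⁻¹)
      (fun i j => measurable_const) hf)

/-- Actions chosen by the algorithm are functions of the states seen so far. -/
theorem measurable_action (M : EpisodicMDP S A H K) (hφ : ∀ a, Measurable fun s => φ s a)
    {β : ℝ} {N : ℕ} {sel : (A → ℝ) → A} (hsel : IsArgmaxRule sel)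
    {x : E → ℕ → ℕ → S} {u : E → ℕ → ℕ → A}
    (hact : ∀ l < K, ∀ i < H, ∀ e,
      u e l i = greedyPolicy φ M.r H β N sel (x e) (u e) l i (x e l i)) {k : ℕ} (hk : k ≤ K)
    (hx : ∀ l < k, ∀ i < H, Measurable fun e => x e l i) :
    ∀ l < k, ∀ i < H, Measurable fun e => u e l i := by
  intro l
  induction l using Nat.strong_induction_on with
  | _ l ih =>
    intro hl i hi
    have h1 : (fun e => u e l i) =
        fun e => greedyPolicy φ M.r H β N sel (x e) (u e) l i (x e l i) :=
      funext fun e => hact l (by omega) i hi e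
    rw [h1]
    have h2 : Measurable fun e => (e, x e l i) := measurable_id'.prodMk (hx l hl i hi)
    have h3 := measurable_greedyPolicy (β := β) (N := N) M hφ hsel (show l ≤ K by omega)
      (fun l' hl' i hi => hx l' (hl'.trans hl) i hi)
      (fun l' hl' i hi => ih l' hl' (hl'.trans hl) i hi) hi
    have h4 := h3.comp h2
    simp only [Function.comp_def] at h4
    exact h4

end Measurability

/-! ### Values of policies that depend on a random parameter. -/

section ParametrizedValue

variable {S A E : Type*} [MeasurableSpace S] [MeasurableSpace A] {mE : MeasurableSpace E} {H K : ℕ}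

theorem measurable_integral_transition (M : EpisodicMDP S A H K) {k h : ℕ} (hk : k < K)
    (hh : h < H) {y : E → S × A} (hy : Measurable y) {f : E → S → ℝ}
    (hf : Measurable fun z : E × S => f z.1 z.2) :
    Measurable fun e => ∫ x, f e x ∂(M.P k h (y e)) := by
  have hM := M.isMarkov k hk h hh
  exact (StronglyMeasurable.integral_kernel_prod_right' (κ := (M.P k h).comap y hy)
    hf.stronglyMeasurable).measurable

/-- Joint measurability of the value of a policy that depends measurably on a parameter. -/
theorem measurable_value_param (M : EpisodicMDP S A H K) {k : ℕ} (hk : k < K)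
    {π : E → ℕ → S → A} (hπ : ∀ e j, Measurable (π e j))
    (hπ' : ∀ j < H, Measurable fun z : E × S => π z.1 j z.2) (n : ℕ) (hn : n ≤ H) :
    Measurable fun z : E × S => value M k (π z.1) (H - n) z.2 := by
  induction n with
  | zero =>
    have : (fun z : E × S => value M k (π z.1) (H - 0) z.2) = fun _ => 0 :=
      funext fun z => value_of_le M k _ (by omega) _
    rw [this]
    exact measurable_const
  | succ n ih =>
    have hlt : H - (n + 1) < H := by omega
    have : (fun z : E × S => value M k (π z.1) (H - (n + 1)) z.2) = fun z =>
        M.r k (H - (n + 1)) z.2 (π z.1 (H - (n + 1)) z.2) +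
          ∫ s', value M k (π z.1) (H - n) s'
            ∂(M.P k (H - (n + 1)) (z.2, π z.1 (H - (n + 1)) z.2)) := by
      funext z
      rw [value_eq M hk (hπ z.1) hlt, show H - (n + 1) + 1 = H - n by omega]
    rw [this]
    refine ((M.measurable_r k hk _ hlt).comp (measurable_snd.prodMk (hπ' _ hlt))).add ?_
    refine measurable_integral_transition M hk hlt
      (y := fun z : E × S => (z.2, π z.1 (H - (n + 1)) z.2))
      (f := fun z s' => value M k (π z.1) (H - n) s')
      (measurable_snd.prodMk (hπ' _ hlt)) ?_
    exact (ih (by omega)).comp ((measurable_fst.comp measurable_fst).prodMk measurable_snd)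

end ParametrizedValue

/-! ### One step of an exponential supermartingale. -/

section ExponentialSupermartingale

variable {Ω D S T : Type*} [MeasurableSpace S] [MeasurableSpace T]

theorem lintegral_exp_add_le_of_comap {mΩ : MeasurableSpace Ω} {mD : MeasurableSpace D} {Pr : Measure Ω}
    [IsProbabilityMeasure Pr] {Y : Ω → D} (hY : Measurable Y) {X : Ω → S} (hX : Measurable X)
    (κ : Kernel T S) [IsMarkovKernel κ] {Z : D → T} (hZ : Measurable Z)
    (h : ∀ B, MeasurableSet B →
      Pr⟦X ⁻¹' B | MeasurableSpace.comap Y mD⟧ =ᵐ[Pr] fun ω => (κ (Z (Y ω))).real B)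
    {f : D × S → ℝ} (hf : Measurable f) {a b : ℝ} (hab : ∀ z, f z ∈ Set.Icc a b)
    {c U : D → ℝ} (hc : Measurable c) (hU : Measurable U) :
    ∫⁻ ω, ENNReal.ofReal (Real.exp (U (Y ω) + (c (Y ω) *
        (f (Y ω, X ω) - ∫ y, f (Y ω, y) ∂(κ (Z (Y ω)))) - c (Y ω) ^ 2 * (b - a) ^ 2 / 8))) ∂Pr
      ≤ ∫⁻ ω, ENNReal.ofReal (Real.exp (U (Y ω))) ∂Pr := by
  have hI : Measurable fun e => ∫ y, f (e, y) ∂(κ (Z e)) :=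
    (StronglyMeasurable.integral_kernel_prod_right' (κ := κ.comap Z hZ)
      hf.stronglyMeasurable).measurable
  have hg : Measurable fun z : D × S => ENNReal.ofReal (Real.exp (c z.1 *
      (f z - ∫ y, f (z.1, y) ∂(κ (Z z.1))) - c z.1 ^ 2 * (b - a) ^ 2 / 8)) := by
    have h1 := hc.comp (measurable_fst : Measurable (Prod.fst : D × S → D))
    have h2 := hI.comp (measurable_fst : Measurable (Prod.fst : D × S → D))
    exact (Real.measurable_exp.comp ((h1.mul (hf.sub h2)).sub
      (((h1.pow_const 2).mul_const _).div_const _))).ennreal_ofReal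
  have := lintegral_mul_le_of_kernel hY hX (κ.comap Z hZ) h
    (F := fun e => ENNReal.ofReal (Real.exp (U e))) (Real.measurable_exp.comp hU).ennreal_ofReal
    hg (fun e => lintegral_exp_le_one (ν := κ (Z e)) (f := fun y => f (e, y))
      (hf.comp measurable_prodMk_left) (fun y => hab _) (c e))
  refine le_trans (le_of_eq ?_) this
  refine lintegral_congr fun ω => ?_
  rw [Real.exp_add, ENNReal.ofReal_mul (Real.exp_pos _).le]

/-- One step of an exponential supermartingale: `X` has conditional law `κ (Z ω)` given `m`. -/
theorem lintegral_exp_add_le {m mΩ : MeasurableSpace Ω} (hm : m ≤ mΩ) {Pr : Measure Ω}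
    [IsProbabilityMeasure Pr] {X : Ω → S} (hX : Measurable X)
    (κ : Kernel T S) [IsMarkovKernel κ] {Z : Ω → T} (hZ : Measurable[m] Z)
    (h : ∀ B, MeasurableSet B → Pr⟦X ⁻¹' B | m⟧ =ᵐ[Pr] fun ω => (κ (Z ω)).real B)
    {f : Ω → S → ℝ} (hf : Measurable[m.prod inferInstance] fun z : Ω × S => f z.1 z.2) {a b : ℝ}
    (hab : ∀ ω y, f ω y ∈ Set.Icc a b)
    {c U : Ω → ℝ} (hc : Measurable[m] c) (hU : Measurable[m] U) :
    ∫⁻ ω, ENNReal.ofReal (Real.exp (U ω + (c ω *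
        (f ω (X ω) - ∫ y, f ω y ∂(κ (Z ω))) - c ω ^ 2 * (b - a) ^ 2 / 8))) ∂Pr
      ≤ ∫⁻ ω, ENNReal.ofReal (Real.exp (U ω)) ∂Pr := by
  -- The identity from the full σ-algebra to `m` plays the role of the observed variable, so that
  -- its comap is `m` itself.
  refine lintegral_exp_add_le_of_comap (mD := m) (Y := id) (measurable_id'' hm) hX κ hZ
    (fun B hB => ?_) hf (fun z => hab z.1 z.2) hc hU
  rw [MeasurableSpace.comap_id]
  exact h B hB

end ExponentialSupermartingale

/-! ### The filtration of observed states. -/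

section HistoryMeasurability

variable {S A Ω : Type*} [MeasurableSpace S] [MeasurableSpace A]

theorem history_le {mΩ : MeasurableSpace Ω} {Pr : Measure Ω} {H K d N : ℕ} {β : ℝ}
    {M : EpisodicMDP S A H K} {φ : S → A → EuclideanSpace ℝ (Fin d)} {sel : (A → ℝ) → A}
    {s : ℕ → ℕ → Ω → S} {u : ℕ → ℕ → Ω → A}
    (hrun : IsRun Pr M φ β N sel s u) {k h : ℕ} (hk : k < K) (hh : h < H) :
    history H s k h ≤ mΩ := by
  refine iSup_le fun l => iSup_le fun i => iSup_le fun hli => ?_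
  exact (hrun.measurable_state l (by omega) i (by omega)).comap_le

theorem measurable_state_history {H k h l i : ℕ} {s : ℕ → ℕ → Ω → S}
    (hli : (l < k ∧ i < H) ∨ (l = k ∧ i ≤ h)) :
    Measurable[history H s k h] (s l i) := by
  refine Measurable.mono (ma := MeasurableSpace.comap (s l i) inferInstance)
    (comap_measurable _) ?_ le_rfl
  exact le_iSup_of_le l (le_iSup_of_le i (le_iSup_of_le hli le_rfl))

end HistoryMeasurability

/-! ### Adaptedness of actions, estimates and values along a run. -/

section RunMeasurability

variable {S A Ω : Type*} [MeasurableSpace S] [MeasurableSpace A] [Finite A]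
  [MeasurableSingletonClass A] {m : MeasurableSpace Ω} {H K d N : ℕ} {β : ℝ}
  {M : EpisodicMDP S A H K} {φ : S → A → EuclideanSpace ℝ (Fin d)} {sel : (A → ℝ) → A}
  {s : ℕ → ℕ → Ω → S} {u : ℕ → ℕ → Ω → A}

theorem measurable_run_action (hφ : ∀ a, Measurable fun s => φ s a) (hsel : IsArgmaxRule sel)
    (hact : ∀ l < K, ∀ i < H, ∀ ω, u l i ω = greedyPolicy φ M.r H β N sel
      (fun l i => s l i ω) (fun l i => u l i ω) l i (s l i ω)) {k : ℕ} (hk : k ≤ K)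
    (hs : ∀ l < k, ∀ i < H, Measurable (s l i)) :
    ∀ l < k, ∀ i < H, Measurable (u l i) :=
  measurable_action M hφ hsel (x := fun ω l i => s l i ω)
    (u := fun ω l i => u l i ω) (fun l hl i hi e => hact l hl i hi e) hk hs

theorem measurable_run_policy (hφ : ∀ a, Measurable fun s => φ s a) (hsel : IsArgmaxRule sel)
    (hact : ∀ l < K, ∀ i < H, ∀ ω, u l i ω = greedyPolicy φ M.r H β N sel
      (fun l i => s l i ω) (fun l i => u l i ω) l i (s l i ω))
    {k h : ℕ} (hk : k ≤ K) (hh : h < H) (hs : ∀ l < k, ∀ i < H, Measurable (s l i)) :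
    Measurable fun z : Ω × S => greedyPolicy φ M.r H β N sel
      (fun l i => s l i z.1) (fun l i => u l i z.1) k h z.2 :=
  measurable_greedyPolicy M hφ hsel (x := fun ω l i => s l i ω)
    (u := fun ω l i => u l i ω) hk hs (measurable_run_action hφ hsel hact hk hs) hh

theorem measurable_run_vEst (hφ : ∀ a, Measurable fun s => φ s a) (hsel : IsArgmaxRule sel)
    (hact : ∀ l < K, ∀ i < H, ∀ ω, u l i ω = greedyPolicy φ M.r H β N sel
      (fun l i => s l i ω) (fun l i => u l i ω) l i (s l i ω))
    (τ : ℕ) {k n : ℕ} (hk : k ≤ K)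
    (hn : n ≤ H) (hs : ∀ l < k, ∀ i < H, Measurable (s l i)) :
    Measurable fun z : Ω × S => vEst φ M.r H β
      (fun l i => s l i z.1) (fun l i => u l i z.1) τ k n z.2 :=
  measurable_vEst M hφ (x := fun ω l i => s l i ω)
    (u := fun ω l i => u l i ω) hk hs (measurable_run_action hφ hsel hact hk hs) n hn

theorem measurable_run_value (hφ : ∀ a, Measurable fun s => φ s a) (hsel : IsArgmaxRule sel)
    (hact : ∀ l < K, ∀ i < H, ∀ ω, u l i ω = greedyPolicy φ M.r H β N sel
      (fun l i => s l i ω) (fun l i => u l i ω) l i (s l i ω)) {k h : ℕ} (hk : k < K)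
    (hh : h ≤ H) (hs : ∀ l < k, ∀ i < H, Measurable (s l i)) :
    Measurable fun z : Ω × S => value M k (greedyPolicy φ M.r H β N sel
      (fun l i => s l i z.1) (fun l i => u l i z.1) k) h z.2 := by
  have := measurable_value_param M hk
    (π := fun ω => greedyPolicy φ M.r H β N sel (fun l i => s l i ω) (fun l i => u l i ω) k)
    (fun ω j => measurable_greedyPolicy_apply M hφ hsel _ _ k j)
    (fun j hj => measurable_run_policy hφ hsel hact hk.le hj hs) (H - h) (Nat.sub_le _ _)
  rwa [Nat.sub_sub_self hh] at this

theorem measurable_run_action_current (hφ : ∀ a, Measurable fun s => φ s a)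
    (hsel : IsArgmaxRule sel) (hact : ∀ l < K, ∀ i < H, ∀ ω, u l i ω = greedyPolicy φ M.r H β N sel
      (fun l i => s l i ω) (fun l i => u l i ω) l i (s l i ω))
    {k h : ℕ} (hk : k < K) (hh : h < H) (hs : ∀ l < k, ∀ i < H, Measurable (s l i))
    (hsk : Measurable (s k h)) : Measurable (u k h) := by
  have hπ := measurable_run_policy hφ hsel hact hk.le hh hs
  have h1 : u k h = fun ω => greedyPolicy φ M.r H β N sel
      (fun l i => s l i ω) (fun l i => u l i ω) k h (s k h ω) :=
    funext fun ω => hact k hk h hh ω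
  have h2 : Measurable fun ω => (ω, s k h ω) := measurable_id'.prodMk hsk
  have h3 := hπ.comp h2
  simp only [Function.comp_def] at h3
  rw [h1]
  exact h3

/-- Log of the exponential supermartingale in direction `y` for the test function `V`. -/
noncomputable def selfNormalizedExponent (M : EpisodicMDP S A H K)
    (φ : S → A → EuclideanSpace ℝ (Fin d))
    (x : ℕ → ℕ → S) (u : ℕ → ℕ → A) (τ k h : ℕ) (y : Fin d → ℝ) (V : S → ℝ) : ℝ :=
  ∑ l ∈ Finset.Ico τ k, ((y ⬝ᵥ (φ (x l h) (u l h)).ofLp) *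
    (V (x l (h + 1)) - ∫ s', V s' ∂(M.P l h (x l h, u l h))) -
      (y ⬝ᵥ (φ (x l h) (u l h)).ofLp) ^ 2 * ((H : ℝ) - 0) ^ 2 / 8)

theorem measurable_selfNormalizedExponent (hφ : ∀ a, Measurable fun s => φ s a)
    (hsel : IsArgmaxRule sel)
    (hact : ∀ l < K, ∀ i < H, ∀ ω, u l i ω = greedyPolicy φ M.r H β N sel
      (fun l i => s l i ω) (fun l i => u l i ω) l i (s l i ω))
    {τ k h : ℕ} (hk : k ≤ K) (hh : h + 1 < H) (hs : ∀ l < k, ∀ i < H, Measurable (s l i))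
    (y : Fin d → ℝ) {V : S → ℝ} (hV : Measurable V) :
    Measurable fun ω => selfNormalizedExponent M φ (fun l i => s l i ω) (fun l i => u l i ω)
      τ k h y V := by
  have hu := measurable_run_action hφ hsel hact hk hs
  refine Finset.measurable_sum _ fun l hl => ?_
  have hl' := (Finset.mem_Ico.1 hl).2
  have h1 := measurable_dotProduct (v := fun _ => y) (fun i => measurable_const)
    (fun i => measurable_feature_apply hφ (hs l hl' h (by omega)) (hu l hl' h (by omega)) i)
  have h2 := measurable_integral_transition M (show l < K by omega) (show h < H by omega)
    ((hs l hl' h (by omega)).prodMk (hu l hl' h (by omega))) (f := fun _ => V)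
    (hV.comp measurable_snd)
  exact (h1.mul ((hV.comp (hs l hl' (h + 1) hh)).sub h2)).sub
    (((h1.pow_const 2).mul_const _).div_const _)

end RunMeasurability

/-! ### Supermartingale for the regression noise. -/

section Concentration

variable {S A Ω : Type*} [MeasurableSpace S] [MeasurableSpace A] [Finite A]
  [MeasurableSingletonClass A] [MeasurableSpace Ω] {Pr : Measure Ω} [IsProbabilityMeasure Pr]
  {H K d N : ℕ} {β : ℝ}
  {M : EpisodicMDP S A H K} {φ : S → A → EuclideanSpace ℝ (Fin d)} {sel : (A → ℝ) → A}
  {s : ℕ → ℕ → Ω → S} {u : ℕ → ℕ → Ω → A}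

/-- Given the history at `(k, h)`, the coefficient `y·φ` is known and only the next state is random,
so Hoeffding's lemma bounds each new factor by 1 in conditional mean. The test function `V` has to
be deterministic; the data-dependent one is reached through a grid. -/
theorem lintegral_exp_selfNormalizedExponent_le (hφ : ∀ a, Measurable fun s => φ s a)
    (hsel : IsArgmaxRule sel) (hrun : IsRun Pr M φ β N sel s u)
    {τ k h : ℕ} (hτ : τ ≤ k) (hk : k ≤ K) (hh : h + 1 < H)
    (y : Fin d → ℝ) {V : S → ℝ} (hV : Measurable V) (hVH : ∀ x, V x ∈ Set.Icc (0 : ℝ) H) :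
    ∫⁻ ω, ENNReal.ofReal (Real.exp (selfNormalizedExponent M φ (fun l i => s l i ω)
      (fun l i => u l i ω) τ k h y V)) ∂Pr ≤ 1 := by
  induction k, hτ using Nat.le_induction with
  | base => simp [selfNormalizedExponent]
  | succ k hτ ih =>
    refine le_trans ?_ (ih (by omega))
    have hkK : k < K := by omega
    have hhH : h < H := by omega
    have hM := M.isMarkov k hkK h hhH
    have hsm : ∀ l < k, ∀ i < H, Measurable[history H s k h] (s l i) := fun l hl i hi =>
      measurable_state_history (Or.inl ⟨hl, hi⟩)
    have hsk : Measurable[history H s k h] (s k h) :=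
      measurable_state_history (Or.inr ⟨rfl, le_rfl⟩)
    have huk := measurable_run_action_current hφ hsel hrun.action hkK hhH hsm hsk
    have hU := measurable_selfNormalizedExponent (τ := τ) hφ hsel hrun.action hkK.le hh hsm y hV
    have hZ : Measurable[history H s k h] fun ω => (s k h ω, u k h ω) := hsk.prodMk huk
    have hc : Measurable[history H s k h] fun ω => y ⬝ᵥ (φ (s k h ω) (u k h ω)).ofLp :=
      measurable_dotProduct (v := fun _ => y) (fun i => measurable_const)
        (fun i => measurable_feature_apply hφ hsk huk i)
    have := lintegral_exp_add_le (history_le hrun hkK hhH)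
      (hrun.measurable_state k hkK (h + 1) hh) (M.P k h) hZ (hrun.transition k hkK h hh)
      (f := fun _ => V) (hV.comp measurable_snd) (fun _ => hVH) hc hU
    refine le_trans (le_of_eq ?_) this
    refine lintegral_congr fun ω => ?_
    rw [selfNormalizedExponent, Finset.sum_Ico_succ_top hτ]
    rfl

end Concentration

/-! ### Supermartingale for the regret. -/

section ValueGap

variable {S A Ω : Type*} [MeasurableSpace S] [MeasurableSpace A] [Finite A] [Nonempty A]
  [MeasurableSingletonClass A]
  {H K d N : ℕ} {β : ℝ}
  {M : EpisodicMDP S A H K} {φ : S → A → EuclideanSpace ℝ (Fin d)} {sel : (A → ℝ) → A}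

/-- The gap at step `i + 1` between the estimated value, truncated at `0`, and the true value of
the executed policy. -/
noncomputable def valueGap (M : EpisodicMDP S A H K) (φ : S → A → EuclideanSpace ℝ (Fin d))
    (β : ℝ) (N : ℕ) (sel : (A → ℝ) → A) (x : ℕ → ℕ → S) (u : ℕ → ℕ → A) (l i : ℕ) (y : S) : ℝ :=
  max (vEst φ M.r H β x u (epochStart N l) l (H - (i + 1)) y) 0 -
    value M l (greedyPolicy φ M.r H β N sel x u l) (i + 1) y

omit [MeasurableSpace S] [MeasurableSpace A] [Finite A] [MeasurableSingletonClass A] in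
theorem vEst_le (r : ℕ → ℕ → S → A → ℝ) (x : ℕ → ℕ → S) (u : ℕ → ℕ → A) (τ k n : ℕ) (y : S) :
    vEst φ r H β x u τ k n y ≤ H := by
  cases n with
  | zero => exact Nat.cast_nonneg H
  | succ n => exact ciSup_le fun a => min_le_right _ _

/-- The truncation at `0` makes the bound valid on every outcome, as Hoeffding's lemma requires;
nonnegativity of the raw estimate is known only on the good event. -/
theorem valueGap_mem (hφ : ∀ a, Measurable fun s => φ s a) (hsel : IsArgmaxRule sel)
    (x : ℕ → ℕ → S) (u : ℕ → ℕ → A) {l : ℕ} (hl : l < K) (i : ℕ) (y : S) :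
    valueGap M φ β N sel x u l i y ∈ Set.Icc (-(H : ℝ)) H := by
  have h1 := value_mem' M hl (measurable_greedyPolicy_apply (N := N) (β := β) M hφ hsel x u l)
    (i + 1) y
  have h2 : max (vEst φ M.r H β x u (epochStart N l) l (H - (i + 1)) y) 0 ≤ H :=
    max_le (vEst_le _ _ _ _ _ _ _) (Nat.cast_nonneg H)
  have h3 := le_max_right (vEst φ M.r H β x u (epochStart N l) l (H - (i + 1)) y) 0
  simp only [valueGap, Set.mem_Icc] at h1 ⊢
  constructor <;> linarith [h1.1, h1.2]

omit [Nonempty A] in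
theorem measurable_valueGap {m : MeasurableSpace Ω} {s : ℕ → ℕ → Ω → S} {u : ℕ → ℕ → Ω → A}
    (hφ : ∀ a, Measurable fun s => φ s a) (hsel : IsArgmaxRule sel)
    (hact : ∀ l < K, ∀ i < H, ∀ ω, u l i ω = greedyPolicy φ M.r H β N sel
      (fun l i => s l i ω) (fun l i => u l i ω) l i (s l i ω))
    {k i : ℕ} (hk : k < K) (hi : i < H) (hs : ∀ l < k, ∀ i < H, Measurable (s l i)) :
    Measurable fun z : Ω × S => valueGap M φ β N sel
      (fun l i => s l i z.1) (fun l i => u l i z.1) k i z.2 :=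
  ((measurable_run_vEst hφ hsel hact _ hk.le (Nat.sub_le _ _) hs).max measurable_const).sub
    (measurable_run_value hφ hsel hact hk (by omega) hs)

/-- One term of the exponent of the regret supermartingale. -/
noncomputable def gapExponent (M : EpisodicMDP S A H K) (φ : S → A → EuclideanSpace ℝ (Fin d))
    (β : ℝ) (N : ℕ) (sel : (A → ℝ) → A) (η : ℝ) (x : ℕ → ℕ → S) (u : ℕ → ℕ → A) (l i : ℕ) : ℝ :=
  (-η) * (valueGap M φ β N sel x u l i (x l (i + 1)) -
    ∫ y, valueGap M φ β N sel x u l i y ∂(M.P l i (x l i, u l i))) -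
      (-η) ^ 2 * ((H : ℝ) - (-H)) ^ 2 / 8

omit [Nonempty A] in
theorem measurable_gapExponent {m : MeasurableSpace Ω} {s : ℕ → ℕ → Ω → S} {u : ℕ → ℕ → Ω → A}
    (hφ : ∀ a, Measurable fun s => φ s a) (hsel : IsArgmaxRule sel)
    (hact : ∀ l < K, ∀ i < H, ∀ ω, u l i ω = greedyPolicy φ M.r H β N sel
      (fun l i => s l i ω) (fun l i => u l i ω) l i (s l i ω))
    {k i : ℕ} (η : ℝ) (hk : k < K) (hi : i < H) (hs : ∀ l < k, ∀ i < H, Measurable (s l i))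
    (hsi : Measurable (s k i)) (hsi' : Measurable (s k (i + 1))) :
    Measurable fun ω => gapExponent M φ β N sel η
      (fun l i => s l i ω) (fun l i => u l i ω) k i := by
  have hg := measurable_valueGap hφ hsel hact hk hi hs
  have hu := measurable_run_action_current hφ hsel hact hk hi hs hsi
  have h1 := hg.comp (measurable_id'.prodMk hsi')
  simp only [Function.comp_def] at h1
  have h2 := measurable_integral_transition M hk hi (hsi.prodMk hu)
    (f := fun ω y => valueGap M φ β N sel (fun l i => s l i ω) (fun l i => u l i ω) k i y) hg
  exact (measurable_const.mul (h1.sub h2)).sub measurable_const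

/-- The estimate and the policy of an episode are fixed by earlier episodes, so each difference is
centered given the history. Only transitions inside an episode contribute; an adversarial initial
state merely joins the history. -/
theorem lintegral_exp_gapExponent_le {mΩ : MeasurableSpace Ω} {Pr : Measure Ω}
    [IsProbabilityMeasure Pr] {s : ℕ → ℕ → Ω → S} {u : ℕ → ℕ → Ω → A}
    (hφ : ∀ a, Measurable fun s => φ s a) (hsel : IsArgmaxRule sel)
    (hrun : IsRun Pr M φ β N sel s u) (η : ℝ) {τ k : ℕ} (hτ : τ ≤ k) (hk : k ≤ K) :
    ∫⁻ ω, ENNReal.ofReal (Real.exp (∑ l ∈ Finset.Ico τ k, ∑ i ∈ Finset.range (H - 1),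
      gapExponent M φ β N sel η (fun l i => s l i ω) (fun l i => u l i ω) l i)) ∂Pr ≤ 1 := by
  induction k, hτ using Nat.le_induction with
  | base => simp
  | succ k hτ ih =>
    refine le_trans ?_ (ih (by omega))
    have hkK : k < K := by omega
    simp_rw [Finset.sum_Ico_succ_top hτ]
    -- Time is ordered lexicographically: the outer induction adds an episode, the inner one its
    -- transitions one at a time.
    suffices h : ∀ n ≤ H - 1, ∫⁻ ω, ENNReal.ofReal (Real.exp (
        (∑ l ∈ Finset.Ico τ k, ∑ i ∈ Finset.range (H - 1), gapExponent M φ β N sel η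
          (fun l i => s l i ω) (fun l i => u l i ω) l i) +
        ∑ i ∈ Finset.range n, gapExponent M φ β N sel η
          (fun l i => s l i ω) (fun l i => u l i ω) k i)) ∂Pr ≤
        ∫⁻ ω, ENNReal.ofReal (Real.exp (∑ l ∈ Finset.Ico τ k, ∑ i ∈ Finset.range (H - 1),
          gapExponent M φ β N sel η (fun l i => s l i ω) (fun l i => u l i ω) l i)) ∂Pr from
      h _ le_rfl
    intro n
    induction n with
    | zero => simp
    | succ n ihn =>
      intro hn
      refine le_trans ?_ (ihn (by omega))
      have hnH : n < H := by omega
      have hnH' : n + 1 < H := by omega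
      have hM := M.isMarkov k hkK n hnH
      have hsm : ∀ l < k, ∀ i < H, Measurable[history H s k n] (s l i) := fun l hl i hi =>
        measurable_state_history (Or.inl ⟨hl, hi⟩)
      have hsk : ∀ i ≤ n, Measurable[history H s k n] (s k i) := fun i hi =>
        measurable_state_history (Or.inr ⟨rfl, hi⟩)
      have huk := measurable_run_action_current hφ hsel hrun.action hkK hnH hsm (hsk n le_rfl)
      have hU : Measurable[history H s k n] fun ω =>
          (∑ l ∈ Finset.Ico τ k, ∑ i ∈ Finset.range (H - 1), gapExponent M φ β N sel η
            (fun l i => s l i ω) (fun l i => u l i ω) l i) +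
          ∑ i ∈ Finset.range n, gapExponent M φ β N sel η
            (fun l i => s l i ω) (fun l i => u l i ω) k i := by
        refine Measurable.add (Finset.measurable_sum _ fun l hl => Finset.measurable_sum _
          fun i hi => ?_) (Finset.measurable_sum _ fun i hi => ?_)
        · have hl' := (Finset.mem_Ico.1 hl).2
          have hi' := Finset.mem_range.1 hi
          exact measurable_gapExponent hφ hsel hrun.action η (by omega) (by omega)
            (fun l' hl'' => hsm l' (by omega)) (hsm l hl' i (by omega))
            (hsm l hl' (i + 1) (by omega))
        · have hi' := Finset.mem_range.1 hi
          exact measurable_gapExponent hφ hsel hrun.action η hkK (by omega) hsm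
            (hsk i (by omega)) (hsk (i + 1) (by omega))
      have := lintegral_exp_add_le (history_le hrun hkK hnH)
        (hrun.measurable_state k hkK (n + 1) hnH') (M.P k n) ((hsk n le_rfl).prodMk huk)
        (hrun.transition k hkK n hnH')
        (f := fun ω y => valueGap M φ β N sel (fun l i => s l i ω) (fun l i => u l i ω) k n y)
        (measurable_valueGap hφ hsel hrun.action hkK hnH hsm)
        (fun ω y => valueGap_mem hφ hsel _ _ hkK n y) (c := fun _ => -η) measurable_const hU
      refine le_trans (le_of_eq ?_) this
      refine lintegral_congr fun ω => ?_
      rw [Finset.sum_range_succ, ← add_assoc]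
      rfl

end ValueGap

/-! ### Grids of directions, and the error of ridge regression. -/

section Rounding

open Matrix

variable {ι : Type*} {d : ℕ}

theorem exists_int_div_near {m : ℕ} (hm : 0 < m) {x R : ℝ} (hx : |x| ≤ R) {n : ℕ}
    (hn : R * m + 1 ≤ n) : ∃ z : ℤ, |z| ≤ n ∧ |z / (m : ℝ) - x| ≤ 1 / m := by
  have hm' : (0 : ℝ) < m := Nat.cast_pos.2 hm
  have h1 := Int.floor_le (x * m)
  have h2 := Int.lt_floor_add_one (x * m)
  have h3 : |x * m| ≤ R * m := by
    rw [abs_mul, abs_of_pos hm']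
    exact mul_le_mul_of_nonneg_right hx hm'.le
  have h4 := abs_le.1 h3
  refine ⟨⌊x * m⌋, ?_, ?_⟩
  · have : |((⌊x * m⌋ : ℤ) : ℝ)| ≤ n := abs_le.2 ⟨by linarith, by linarith⟩
    exact_mod_cast this
  · rw [show (⌊x * m⌋ : ℝ) / m - x = (⌊x * m⌋ - x * m) / m by field_simp, abs_div,
      abs_of_pos hm']
    gcongr
    exact abs_le.2 ⟨by linarith, by linarith⟩

theorem abs_apply_le_sqrt_dotProduct (x : Fin d → ℝ) (i : Fin d) : |x i| ≤ √(x ⬝ᵥ x) := by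
  refine Real.abs_le_sqrt ?_
  rw [sq]
  exact Finset.single_le_sum (f := fun i => x i * x i) (fun j _ => mul_self_nonneg _)
    (Finset.mem_univ i)

theorem dotProduct_self_le_of_abs_le {x : Fin d → ℝ} {b : ℝ} (hx : ∀ i, |x i| ≤ b) :
    x ⬝ᵥ x ≤ d * b ^ 2 := by
  have : ∀ i ∈ Finset.univ, x i * x i ≤ b ^ 2 := fun i _ => by
    rw [← sq, ← sq_abs]
    exact pow_le_pow_left₀ (abs_nonneg _) (hx i) 2
  refine (Finset.sum_le_sum this).trans ?_
  simp

theorem sqrt_dotProduct_sum_smul_le (s : Finset ι) (f : ι → Fin d → ℝ) (e : ι → ℝ) {b : ℝ}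
    (hf : ∀ l ∈ s, f l ⬝ᵥ f l ≤ 1) (he : ∀ l ∈ s, |e l| ≤ b) :
    √((∑ l ∈ s, e l • f l) ⬝ᵥ (∑ l ∈ s, e l • f l)) ≤ s.card * b := by
  have h : ∀ x : Fin d → ℝ, √(x ⬝ᵥ x) = ‖WithLp.toLp 2 x‖ := by
    intro x
    rw [EuclideanSpace.norm_eq]
    simp [dotProduct, sq]
  rw [h]
  have : WithLp.toLp 2 (∑ l ∈ s, e l • f l) = ∑ l ∈ s, e l • WithLp.toLp 2 (f l) := by
    simp [WithLp.toLp_sum]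
  rw [this]
  refine (norm_sum_le _ _).trans ?_
  rw [← nsmul_eq_mul, ← Finset.sum_const]
  refine Finset.sum_le_sum fun l hl => ?_
  rw [norm_smul, ← h, Real.norm_eq_abs]
  exact (mul_le_of_le_one_right (abs_nonneg _) (Real.sqrt_le_one.2 (hf l hl))).trans (he l hl)

/-- A bound on the exponents `y·v - H²/8 ∑ (y·f l)²` over a grid of directions `y` bounds the
self-normalized size of `v`. -/
theorem dotProduct_inv_regGram_le_of_grid (s : Finset ι) (f : ι → Fin d → ℝ) (e : ι → ℝ)
    {H L : ℝ} (hH : 1 ≤ H) (hf : ∀ l ∈ s, f l ⬝ᵥ f l ≤ 1) (he : ∀ l ∈ s, |e l| ≤ H)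
    {m n : ℕ} (hm : 0 < m) (hn : 4 * (s.card : ℝ) * m + 1 ≤ n)
    (hm2 : H ^ 2 * (1 + s.card) * d ≤ 8 * (m : ℝ) ^ 2)
    (hgrid : ∀ z : Fin d → ℤ, (∀ i, |z i| ≤ n) →
      (fun i => z i / (m : ℝ)) ⬝ᵥ (∑ l ∈ s, e l • f l) -
        ∑ l ∈ s, ((fun i => z i / (m : ℝ)) ⬝ᵥ f l) ^ 2 * H ^ 2 / 8 ≤ L) :
    (∑ l ∈ s, e l • f l) ⬝ᵥ (regGram s f)⁻¹ *ᵥ (∑ l ∈ s, e l • f l) ≤ H ^ 2 / 2 * (L + 1) := by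
  set v := ∑ l ∈ s, e l • f l with hv
  have hm' : (0 : ℝ) < m := Nat.cast_pos.2 hm
  -- With this `t` the weight `t / 2` in `quadratic_completion` is the Hoeffding constant `H² / 8`.
  set t : ℝ := H ^ 2 / 4 with ht
  have ht0 : 0 < t := by positivity
  -- The maximizer of the quadratic. Its coordinates are at most `s.card * H / t ≤ 4 * s.card`, so
  -- it lies in the box covered by the grid.
  set y₀ := t⁻¹ • ((regGram s f)⁻¹ *ᵥ v) with hy₀
  have hy₀b : ∀ i, |y₀ i| ≤ 4 * (s.card : ℝ) := by
    intro i
    rw [hy₀, Pi.smul_apply, smul_eq_mul, abs_mul, abs_of_pos (inv_pos.2 ht0)]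
    have h1 := abs_apply_le_sqrt_dotProduct ((regGram s f)⁻¹ *ᵥ v) i
    have h2 := Real.sqrt_le_sqrt (inv_regGram_mulVec_self_le s f v)
    have h3 := sqrt_dotProduct_sum_smul_le s f e hf he
    have h4 : |((regGram s f)⁻¹ *ᵥ v) i| ≤ s.card * H := h1.trans (h2.trans h3)
    have h5 : (0 : ℝ) ≤ s.card := Nat.cast_nonneg _
    rw [inv_mul_le_iff₀ ht0]
    refine h4.trans ?_
    rw [ht]
    nlinarith [mul_nonneg h5 (by linarith : (0 : ℝ) ≤ H), mul_nonneg (mul_nonneg h5 (by linarith : (0 : ℝ) ≤ H)) (by linarith : (0:ℝ) ≤ H - 1)]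
  choose z hz1 hz2 using fun i => exists_int_div_near hm (hy₀b i) hn
  set y : Fin d → ℝ := fun i => z i / (m : ℝ) with hy
  have hcomp := quadratic_completion s f v y ht0.ne'
  have hg := hgrid z hz1
  have hq : ∀ x : Fin d → ℝ, x ⬝ᵥ regGram s f *ᵥ x = x ⬝ᵥ x + ∑ l ∈ s, (x ⬝ᵥ f l) ^ 2 := by
    intro x
    rw [dotProduct_regGram_mulVec]
    congr 1
    exact Finset.sum_congr rfl fun l _ => by rw [dotProduct_comm (f l) x, sq]
  have hδ : (y - y₀) ⬝ᵥ regGram s f *ᵥ (y - y₀) ≤ (1 + s.card) * (d * (1 / m) ^ 2) := by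
    have h1 : (y - y₀) ⬝ᵥ (y - y₀) ≤ d * (1 / (m : ℝ)) ^ 2 := dotProduct_self_le_of_abs_le hz2
    have h2 : ∑ l ∈ s, ((y - y₀) ⬝ᵥ f l) ^ 2 ≤ s.card * (d * (1 / (m : ℝ)) ^ 2) := by
      rw [← nsmul_eq_mul, ← Finset.sum_const]
      refine Finset.sum_le_sum fun l hl => (dotProduct_sq_le _ _).trans ?_
      exact (mul_le_of_le_one_right (dotProduct_self_nonneg' _) (hf l hl)).trans h1
    rw [hq]
    linarith
  -- Moving from the maximizer to the nearby grid point costs at most 1, the `+ 1` of the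
  -- conclusion.
  have hδ2 : t / 2 * ((y - y₀) ⬝ᵥ regGram s f *ᵥ (y - y₀)) ≤ 1 := by
    refine (mul_le_mul_of_nonneg_left hδ (by positivity)).trans ?_
    rw [ht, one_div, inv_pow]
    rw [show H ^ 2 / 4 / 2 * ((1 + (s.card : ℝ)) * (d * ((m : ℝ) ^ 2)⁻¹)) =
      (H ^ 2 * (1 + s.card) * d) / (8 * (m : ℝ) ^ 2) by field_simp; ring]
    exact (div_le_one (by positivity)).2 hm2
  have hle : y ⬝ᵥ v - t / 2 * (y ⬝ᵥ regGram s f *ᵥ y) ≤ L := by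
    refine le_trans ?_ hg
    rw [hq, mul_add, Finset.mul_sum]
    have h1 : 0 ≤ t / 2 * (y ⬝ᵥ y) := mul_nonneg (by positivity) (dotProduct_self_nonneg' _)
    have h2 : ∑ l ∈ s, t / 2 * (y ⬝ᵥ f l) ^ 2 = ∑ l ∈ s, (y ⬝ᵥ f l) ^ 2 * H ^ 2 / 8 :=
      Finset.sum_congr rfl fun l _ => by rw [ht]; ring
    linarith
  have h2t : 2 * t = H ^ 2 / 2 := by rw [ht]; ring
  rw [h2t] at hcomp
  have := (div_le_iff₀ (by positivity)).1 (hcomp.le.trans (add_le_add hle hδ2))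
  linarith

theorem sqrt_sum_sq_le (s : Finset ι) (b : ι → ℝ) {B : ℝ} {N : ℕ} (hN : s.card ≤ N)
    (hB : 0 ≤ B) (hb : ∀ l ∈ s, |b l| ≤ B) : √(∑ l ∈ s, b l ^ 2) ≤ √N * B := by
  rw [Real.sqrt_le_iff]
  refine ⟨by positivity, ?_⟩
  rw [mul_pow, Real.sq_sqrt (Nat.cast_nonneg N)]
  have : ∀ l ∈ s, b l ^ 2 ≤ B ^ 2 := fun l hl => by
    rw [← sq_abs]
    exact pow_le_pow_left₀ (abs_nonneg _) (hb l hl) 2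
  refine (Finset.sum_le_sum this).trans ?_
  rw [Finset.sum_const, nsmul_eq_mul]
  gcongr

/-- Error of ridge regression with bias `b` and noise `e`. -/
theorem abs_ridge_sub_le (s : Finset ι) (f : ι → Fin d → ℝ) (q x : Fin d → ℝ) (y b e : ι → ℝ)
    (hy : ∀ l ∈ s, y l = f l ⬝ᵥ q + b l + e l) :
    |((regGram s f)⁻¹ *ᵥ ∑ l ∈ s, y l • f l) ⬝ᵥ x - x ⬝ᵥ q| ≤
      √(x ⬝ᵥ (regGram s f)⁻¹ *ᵥ x) * (√(∑ l ∈ s, b l ^ 2) +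
        √((∑ l ∈ s, e l • f l) ⬝ᵥ (regGram s f)⁻¹ *ᵥ (∑ l ∈ s, e l • f l)) + √(q ⬝ᵥ q)) := by
  set G := regGram s f with hG
  have h1 : ∑ l ∈ s, y l • f l = (G *ᵥ q - q) + ∑ l ∈ s, b l • f l + ∑ l ∈ s, e l • f l := by
    -- The noiseless, unbiased part of the targets recovers `q` up to the shrinkage `-q` caused by
    -- the regularizer.
    have h2 : G *ᵥ q - q = ∑ l ∈ s, (f l ⬝ᵥ q) • f l := by
      rw [hG, regGram, add_mulVec, one_mulVec, add_sub_cancel_left, Matrix.sum_mulVec]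
      refine Finset.sum_congr rfl fun l _ => ?_
      rw [vecMulVec_mulVec]
      simp
    rw [h2, ← Finset.sum_add_distrib, ← Finset.sum_add_distrib]
    refine Finset.sum_congr rfl fun l hl => ?_
    rw [hy l hl, add_smul, add_smul]
  have h3 : (G⁻¹ *ᵥ ∑ l ∈ s, y l • f l) ⬝ᵥ x - x ⬝ᵥ q =
      x ⬝ᵥ G⁻¹ *ᵥ (∑ l ∈ s, b l • f l) + x ⬝ᵥ G⁻¹ *ᵥ (∑ l ∈ s, e l • f l) - x ⬝ᵥ G⁻¹ *ᵥ q := by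
    rw [h1, mulVec_add, mulVec_add, mulVec_sub, inv_regGram_mulVec_mulVec, dotProduct_comm _ x,
      dotProduct_add, dotProduct_add, dotProduct_sub]
    ring
  rw [h3]
  have ha := abs_dotProduct_inv_regGram_le s f x (∑ l ∈ s, b l • f l)
  have hb := abs_dotProduct_inv_regGram_le s f x (∑ l ∈ s, e l • f l)
  have hc := abs_dotProduct_inv_regGram_le s f x q
  have hx : 0 ≤ √(x ⬝ᵥ G⁻¹ *ᵥ x) := Real.sqrt_nonneg _
  have ha' := mul_le_mul_of_nonneg_left (sqrt_dotProduct_inv_regGram_sum_le s f b) hx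
  have hc' := mul_le_mul_of_nonneg_left
    (Real.sqrt_le_sqrt (dotProduct_inv_regGram_le s f q)) hx
  rw [mul_add, mul_add]
  have ht1 := abs_sub (x ⬝ᵥ G⁻¹ *ᵥ (∑ l ∈ s, b l • f l) + x ⬝ᵥ G⁻¹ *ᵥ (∑ l ∈ s, e l • f l))
    (x ⬝ᵥ G⁻¹ *ᵥ q)
  have ht2 := abs_add_le (x ⬝ᵥ G⁻¹ *ᵥ (∑ l ∈ s, b l • f l)) (x ⬝ᵥ G⁻¹ *ᵥ (∑ l ∈ s, e l • f l))
  linarith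

end Rounding

/-! ### Finite-dimensional family of truncated value functions and its stability. -/

section NetValue

open Matrix

variable {S A : Type*} [Finite A] [Nonempty A] {d : ℕ} {φ : S → A → EuclideanSpace ℝ (Fin d)}

/-- The truncated greedy value function with weights `w` and bonus matrix `G`. -/
noncomputable def netValue (φ : S → A → EuclideanSpace ℝ (Fin d)) (H : ℕ) (β : ℝ)
    (w : Fin d → ℝ) (G : Matrix (Fin d) (Fin d) ℝ) (y : S) : ℝ :=
  max (⨆ a, min (w ⬝ᵥ (φ y a).ofLp + β * √((φ y a).ofLp ⬝ᵥ G *ᵥ (φ y a).ofLp)) H) 0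

omit [Finite A] in
theorem netValue_mem (H : ℕ) (β : ℝ) (w : Fin d → ℝ) (G : Matrix (Fin d) (Fin d) ℝ) (y : S) :
    netValue φ H β w G y ∈ Set.Icc (0 : ℝ) H :=
  ⟨le_max_right _ _, max_le (ciSup_le fun _ => min_le_right _ _) (Nat.cast_nonneg H)⟩

omit [Nonempty A] in
theorem measurable_netValue [MeasurableSpace S] [MeasurableSpace A] [MeasurableSingletonClass A]
    (hφ : ∀ a, Measurable fun s => φ s a) (H : ℕ) (β : ℝ)
    (w : Fin d → ℝ) (G : Matrix (Fin d) (Fin d) ℝ) : Measurable (netValue φ H β w G) := by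
  have hf : ∀ a i, Measurable fun s : S => (φ s a).ofLp i := fun a i =>
    measurable_feature_apply hφ measurable_id measurable_const i
  refine Measurable.max (Measurable.iSup fun a => ?_) measurable_const
  refine Measurable.min (Measurable.add ?_ (measurable_const.mul (Measurable.sqrt ?_)))
    measurable_const
  · exact measurable_dotProduct (fun i => measurable_const) (hf a)
  · exact measurable_dotProduct (hf a) (measurable_mulVec (G := fun _ => G)
      (fun i j => measurable_const) (hf a))

theorem abs_ciSup_sub_ciSup_le {f g : A → ℝ} {ε : ℝ} (h : ∀ a, |f a - g a| ≤ ε) :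
    |(⨆ a, f a) - ⨆ a, g a| ≤ ε := by
  have key : ∀ f g : A → ℝ, (∀ a, |f a - g a| ≤ ε) → (⨆ a, f a) ≤ (⨆ a, g a) + ε := by
    intro f g h
    refine ciSup_le fun a => ?_
    have h1 := le_ciSup (Set.finite_range g).bddAbove a
    have h2 := (abs_le.1 (h a)).2
    linarith
  have h1 := key f g h
  have h2 := key g f fun a => by rw [abs_sub_comm]; exact h a
  exact abs_le.2 ⟨by linarith, by linarith⟩

/-- No sign is assumed: a rounded bonus matrix need not be positive semidefinite, and `√` is `0` at
negative arguments. -/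
theorem abs_sqrt_sub_sqrt_le (x y : ℝ) : |√x - √y| ≤ √|x - y| := by
  have key : ∀ x y : ℝ, √x ≤ √y + √|x - y| := by
    intro x y
    refine (Real.sqrt_le_sqrt (show x ≤ max y 0 + |x - y| from ?_)).trans ?_
    · linarith [le_max_left y 0, le_abs_self (x - y)]
    · have h0 : √(max y 0) = √y := by
        rcases le_total y 0 with h | h
        · simp [max_eq_right h, Real.sqrt_eq_zero_of_nonpos h]
        · rw [max_eq_left h]
      rw [← h0, Real.sqrt_le_iff]
      refine ⟨by positivity, ?_⟩
      rw [add_sq, Real.sq_sqrt (le_max_right _ _), Real.sq_sqrt (abs_nonneg _)]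
      have : 0 ≤ 2 * √(max y 0) * √|x - y| := by positivity
      linarith
  have h1 := key x y
  have h2 := key y x
  rw [abs_sub_comm] at h2
  exact abs_le.2 ⟨by linarith, by linarith⟩

/-- Truncations and suprema over actions are 1-Lipschitz, so only the linear term and the root
matter. The matrix error enters under a root, which forces the mesh to be as fine as `1 / β²`. -/
theorem abs_netValue_sub_le (hφ : ∀ s a, ‖φ s a‖ ≤ 1) (H : ℕ) {β : ℝ} (hβ : 0 ≤ β)
    {w w' : Fin d → ℝ} {G G' : Matrix (Fin d) (Fin d) ℝ} {ε : ℝ}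
    (hw : ∀ i, |w i - w' i| ≤ ε) (hG : ∀ i j, |G i j - G' i j| ≤ ε) (y : S) :
    |netValue φ H β w G y - netValue φ H β w' G' y| ≤ d * ε + β * √(d ^ 2 * ε) := by
  rw [netValue, netValue]
  refine (abs_max_sub_max_le_abs _ _ _).trans (abs_ciSup_sub_ciSup_le fun a => ?_)
  refine (abs_inf_sub_inf_le_abs _ _ _).trans ?_
  set x := (φ y a).ofLp with hx
  have hx1 : ∀ i, |x i| ≤ 1 := fun i => by
    simpa using (PiLp.norm_apply_le (φ y a) i).trans (hφ y a)
  have h1 : |w ⬝ᵥ x - w' ⬝ᵥ x| ≤ d * ε := by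
    rw [← sub_dotProduct]
    refine (Finset.abs_sum_le_sum_abs _ _).trans ?_
    have : ∀ i ∈ Finset.univ, |(w - w') i * x i| ≤ ε := fun i _ => by
      rw [abs_mul]
      exact (mul_le_of_le_one_right (abs_nonneg _) (hx1 i)).trans (hw i)
    refine (Finset.sum_le_sum this).trans ?_
    simp
  have h2 : |x ⬝ᵥ G *ᵥ x - x ⬝ᵥ G' *ᵥ x| ≤ d ^ 2 * ε := by
    rw [← dotProduct_sub, ← sub_mulVec]
    refine (Finset.abs_sum_le_sum_abs _ _).trans ?_
    have : ∀ i ∈ Finset.univ, |x i * ((G - G') *ᵥ x) i| ≤ d * ε := fun i _ => by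
      rw [abs_mul]
      refine (mul_le_of_le_one_left (abs_nonneg _) (hx1 i)).trans ?_
      rw [mulVec, dotProduct]
      refine (Finset.abs_sum_le_sum_abs _ _).trans ?_
      have : ∀ j ∈ Finset.univ, |(G - G') i j * x j| ≤ ε := fun j _ => by
        rw [abs_mul]
        exact (mul_le_of_le_one_right (abs_nonneg _) (hx1 j)).trans (hG i j)
      refine (Finset.sum_le_sum this).trans ?_
      simp
    refine (Finset.sum_le_sum this).trans (le_of_eq ?_)
    simp
    ring
  have h3 := (abs_sqrt_sub_sqrt_le (x ⬝ᵥ G *ᵥ x) (x ⬝ᵥ G' *ᵥ x)).trans (Real.sqrt_le_sqrt h2)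
  calc _ = |(w ⬝ᵥ x - w' ⬝ᵥ x) + β * (√(x ⬝ᵥ G *ᵥ x) - √(x ⬝ᵥ G' *ᵥ x))| := by congr 1; ring
    _ ≤ |w ⬝ᵥ x - w' ⬝ᵥ x| + |β * (√(x ⬝ᵥ G *ᵥ x) - √(x ⬝ᵥ G' *ᵥ x))| := abs_add_le _ _
    _ ≤ _ := by
      rw [abs_mul, abs_of_nonneg hβ]
      exact add_le_add h1 (mul_le_mul_of_nonneg_left h3 hβ)

end NetValue

/-! ### Translation between Euclidean features and coordinate vectors. -/

section Features

variable {S A : Type*} {d : ℕ} {φ : S → A → EuclideanSpace ℝ (Fin d)}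

theorem inner_eq_dotProduct (x y : EuclideanSpace ℝ (Fin d)) : ⟪x, y⟫ = x.ofLp ⬝ᵥ y.ofLp := by
  rw [EuclideanSpace.inner_eq_star_dotProduct, dotProduct_comm]
  rfl

theorem sqrt_dotProduct_self (x : EuclideanSpace ℝ (Fin d)) : √(x.ofLp ⬝ᵥ x.ofLp) = ‖x‖ := by
  rw [← inner_eq_dotProduct, real_inner_self_eq_norm_sq, Real.sqrt_sq (norm_nonneg _)]

theorem feature_dotProduct_self_le {s : S} {a : A} (h : ‖φ s a‖ ≤ 1) :
    (φ s a).ofLp ⬝ᵥ (φ s a).ofLp ≤ 1 := by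
  rw [← Real.sqrt_le_one, sqrt_dotProduct_self]
  exact h

theorem gram_eq_regGram (x : ℕ → ℕ → S) (u : ℕ → ℕ → A) (τ k h : ℕ) :
    gram φ x u τ k h = regGram (Finset.Ico τ k) fun l => (φ (x l h) (u l h)).ofLp := rfl

end Features

/-! ### Accuracy of the regressions on the good event. -/

section Regression

open Matrix

variable {S A : Type*} [MeasurableSpace S] [MeasurableSpace A] [Finite A] [Nonempty A]
  [MeasurableSingletonClass A] {H K d : ℕ} {β : ℝ}
  {M : EpisodicMDP S A H K} {φ : S → A → EuclideanSpace ℝ (Fin d)}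
  {μ : ℕ → ℕ → VectorMeasure S (EuclideanSpace ℝ (Fin d))}
  {θ : ℕ → ℕ → EuclideanSpace ℝ (Fin d)}

/-- The self-normalized exponents are at most `L` for all directions and truncated value functions
whose parameters lie in the grid `{z / m : |z| ≤ n}`. -/
def GridBound (M : EpisodicMDP S A H K) (φ : S → A → EuclideanSpace ℝ (Fin d)) (β : ℝ)
    (m n : ℕ) (L : ℝ) (x : ℕ → ℕ → S) (u : ℕ → ℕ → A) (τ k h : ℕ) : Prop :=
  ∀ z : Fin d ⊕ Fin d ⊕ Fin d × Fin d → ℤ, (∀ i, |z i| ≤ n) →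
    selfNormalizedExponent M φ x u τ k h (fun i => z (Sum.inl i) / (m : ℝ))
      (netValue φ H β (fun i => z (Sum.inr (Sum.inl i)) / (m : ℝ))
        (Matrix.of fun i j => z (Sum.inr (Sum.inr (i, j))) / (m : ℝ))) ≤ L

/-- The noise of the regression for a truncated value function is a small error plus a part that
is small in self-normalized size. -/
theorem exists_noise_decomposition (hlin : IsLinearMDP M φ μ θ) (hβ : 0 ≤ β)
    {x : ℕ → ℕ → S} {u : ℕ → ℕ → A} {τ k h m n N : ℕ} {L : ℝ} (hk : k < K) (hh : h + 1 < H)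
    (hkN : k - τ ≤ N) (hm : 0 < m) (hN : 0 < N)
    (hn : 4 * (N * H : ℝ) * m + 1 ≤ n) (hm2 : (H : ℝ) ^ 2 * (1 + N) * d ≤ 8 * (m : ℝ) ^ 2)
    (hgrid : GridBound M φ β m n L x u τ k h) {w : Fin d → ℝ} {G : Matrix (Fin d) (Fin d) ℝ}
    (hw : ∀ i, |w i| ≤ 2 * (N * H)) (hG : ∀ i j, |G i j| ≤ 1) :
    ∃ b e : ℕ → ℝ, (∀ l, netValue φ H β w G (x l (h + 1)) -
        ∫ y, netValue φ H β w G y ∂(M.P l h (x l h, u l h)) = b l + e l) ∧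
      (∀ l ∈ Finset.Ico τ k, |b l| ≤ 2 * (d * (1 / m) + β * √(d ^ 2 * (1 / m)))) ∧
      (∑ l ∈ Finset.Ico τ k, e l • (φ (x l h) (u l h)).ofLp) ⬝ᵥ (gram φ x u τ k h)⁻¹ *ᵥ
        (∑ l ∈ Finset.Ico τ k, e l • (φ (x l h) (u l h)).ofLp) ≤ (H : ℝ) ^ 2 / 2 * (L + 1) := by
  have hm' : (1 : ℝ) ≤ m := by exact_mod_cast hm
  have hH' : (1 : ℝ) ≤ H := by exact_mod_cast (by omega : 1 ≤ H)
  have hN' : (1 : ℝ) ≤ N := by exact_mod_cast hN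
  have hNH : (1 : ℝ) ≤ N * H := by nlinarith
  choose zw hzw1 hzw2 using fun i => exists_int_div_near hm (hw i)
    (show 2 * (N * H : ℝ) * m + 1 ≤ n by nlinarith)
  choose zG hzG1 hzG2 using fun i j => exists_int_div_near hm (hG i j)
    (show (1 : ℝ) * m + 1 ≤ n by nlinarith)
  set V := netValue φ H β w G with hV
  set V' := netValue φ H β (fun i => zw i / (m : ℝ)) (Matrix.of fun i j => zG i j / (m : ℝ))
    with hV'
  set ε := d * (1 / (m : ℝ)) + β * √(d ^ 2 * (1 / m)) with hε
  have hclose : ∀ y, |V y - V' y| ≤ ε := fun y => by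
    rw [abs_sub_comm]
    exact abs_netValue_sub_le hlin.norm_feature H hβ hzw2 hzG2 y
  have hφ := hlin.measurable_feature
  have hVm : Measurable V := measurable_netValue hφ H β w G
  have hVm' : Measurable V' := measurable_netValue hφ H β _ _
  -- The noise of the rounded function `V'`, to which the grid bound applies; the remainder is at
  -- most twice the sup distance of `V` and `V'`.
  set e : ℕ → ℝ := fun l => V' (x l (h + 1)) - ∫ y, V' y ∂(M.P l h (x l h, u l h)) with he
  refine ⟨fun l => (V (x l (h + 1)) - ∫ y, V y ∂(M.P l h (x l h, u l h))) - e l, e,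
    fun l => by ring, fun l hl => ?_, ?_⟩
  · have hlK : l < K := (Finset.mem_Ico.1 hl).2.trans hk
    have hM := M.isMarkov l hlK h (by omega)
    have h1 := hclose (x l (h + 1))
    have h2 : |∫ y, V y ∂(M.P l h (x l h, u l h)) - ∫ y, V' y ∂(M.P l h (x l h, u l h))| ≤ ε := by
      rw [← integral_sub]
      · exact abs_le.2 (integral_mem_Icc (hVm.sub hVm') fun y => abs_le.1 (hclose y))
      · exact Integrable.of_mem_Icc 0 H hVm.aemeasurable (.of_forall (netValue_mem H β w G))
      · exact Integrable.of_mem_Icc 0 H hVm'.aemeasurable (.of_forall (netValue_mem H β _ _))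
    have h1' := abs_le.1 h1
    have h2' := abs_le.1 h2
    rw [he]
    exact abs_le.2 ⟨by linarith, by linarith⟩
  · rw [gram_eq_regGram]
    have hcard : ((Finset.Ico τ k).card : ℝ) ≤ N := by
      rw [Nat.card_Ico]
      exact_mod_cast hkN
    refine dotProduct_inv_regGram_le_of_grid (Finset.Ico τ k) _ e hH'
      (fun l _ => feature_dotProduct_self_le (hlin.norm_feature _ _)) (fun l hl => ?_) hm (n := n)
      ?_ ?_ fun z hz => ?_
    · have hlK : l < K := (Finset.mem_Ico.1 hl).2.trans hk
      have hM := M.isMarkov l hlK h (by omega)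
      have h1 := netValue_mem (φ := φ) H β (fun i => zw i / (m : ℝ))
        (Matrix.of fun i j => zG i j / (m : ℝ)) (x l (h + 1))
      have h2 := integral_mem_Icc (ν := M.P l h (x l h, u l h)) hVm' (netValue_mem H β _ _)
      rw [he]
      exact abs_le.2 ⟨by linarith [h1.1, h2.2], by linarith [h1.2, h2.1]⟩
    · refine le_trans ?_ hn
      have : ((Finset.Ico τ k).card : ℝ) ≤ N * H := hcard.trans (by nlinarith)
      gcongr
    · refine le_trans ?_ hm2
      gcongr
    -- One grid point carries both the direction and the parameters of the rounded test function.
    · have := hgrid (Sum.elim z (Sum.elim zw fun p => zG p.1 p.2)) (by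
        rintro (i | i | ⟨i, j⟩)
        · exact hz i
        · exact hzw1 i
        · exact hzG1 i j)
      refine le_trans (le_of_eq ?_) this
      rw [selfNormalizedExponent, Finset.sum_sub_distrib, dotProduct_sum]
      simp only [Sum.elim_inl, Sum.elim_inr, sub_zero]
      congr 1
      refine Finset.sum_congr rfl fun l _ => ?_
      rw [dotProduct_smul, smul_eq_mul, mul_comm]

omit [Finite A] [Nonempty A] [MeasurableSingletonClass A] in
/-- Weights of a regression with targets in `[0, H]` are polynomially bounded. -/
theorem abs_weights_le (hlin : IsLinearMDP M φ μ θ) {x : ℕ → ℕ → S} {u : ℕ → ℕ → A}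
    {τ k h N : ℕ} (hk : k < K) (hh : h < H) (hkN : k - τ ≤ N) {V : S → ℝ}
    (hV : ∀ y, V y ∈ Set.Icc (0 : ℝ) H) (i : Fin d) :
    |weights φ M.r x u τ k h V i| ≤ 2 * (N * H) := by
  have hH' : (1 : ℝ) ≤ H := by exact_mod_cast (by omega : 1 ≤ H)
  have hcard : ((Finset.Ico τ k).card : ℝ) ≤ N := by
    rw [Nat.card_Ico]
    exact_mod_cast hkN
  rw [weights, gram_eq_regGram]
  refine (abs_apply_le_sqrt_dotProduct _ i).trans ?_
  refine (Real.sqrt_le_sqrt (inv_regGram_mulVec_self_le _ _ _)).trans ?_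
  refine (sqrt_dotProduct_sum_smul_le (b := 1 + H) _ _ _
    (fun l _ => feature_dotProduct_self_le (hlin.norm_feature _ _)) fun l hl => ?_).trans ?_
  · have h1 := M.r_mem l ((Finset.mem_Ico.1 hl).2.trans hk) h hh (x l h) (u l h)
    have h2 := hV (x l (h + 1))
    exact abs_le.2 ⟨by linarith [h1.1, h2.1], by linarith [h1.2, h2.2]⟩
  · have : (0 : ℝ) ≤ N := Nat.cast_nonneg _
    nlinarith

/-- The estimates of one episode are accurate up to the bonus. -/
theorem abs_weights_sub_le (hlin : IsLinearMDP M φ μ θ)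
    {x : ℕ → ℕ → S} {u : ℕ → ℕ → A} {τ k h m n N i : ℕ} {L Bθ Bμ : ℝ}
    (hk : k < K) (hh : h + (i + 1) = H) (hkN : k - τ ≤ N) (hm : 0 < m) (hN : 0 < N)
    (hn : 4 * (N * H : ℝ) * m + 1 ≤ n) (hm2 : (H : ℝ) ^ 2 * (1 + N) * d ≤ 8 * (m : ℝ) ^ 2)
    (hL : 0 ≤ L) (hgrid : ∀ h, h + 1 < H → GridBound M φ β m n L x u τ k h)
    (hBθ : ∀ l ∈ Finset.Ico τ k, ‖θ k h - θ l h‖ ≤ Bθ)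
    (hBμ : ∀ l ∈ Finset.Ico τ k, ∀ B, ‖μ k h B - μ l h B‖ ≤ Bμ) (hBθ0 : 0 ≤ Bθ) (hBμ0 : 0 ≤ Bμ)
    (hvar : √N * (Bθ + H * Bμ) ≤ 1)
    (hε : √N * (2 * (d * (1 / m) + β * √(d ^ 2 * (1 / m)))) ≤ 2)
    (hβ : 3 + √((H : ℝ) ^ 2 / 2 * (L + 1)) + 2 * H * √d ≤ β)
    (hV : ∀ i' ≤ i, ∀ y, 0 ≤ vEst φ M.r H β x u τ k i' y) (y : S) (a : A) :
    |weights φ M.r x u τ k h (vEst φ M.r H β x u τ k i) ⬝ᵥ (φ y a).ofLp -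
      (M.r k h y a + ∫ y', vEst φ M.r H β x u τ k i y' ∂(M.P k h (y, a)))| ≤
      β * √((φ y a).ofLp ⬝ᵥ (gram φ x u τ k h)⁻¹ *ᵥ (φ y a).ofLp) := by
  have hφ := hlin.measurable_feature
  have hhH : h < H := by omega
  have hH' : (1 : ℝ) ≤ H := by exact_mod_cast (by omega : 1 ≤ H)
  have hβ0 : 0 ≤ β := le_trans (by positivity) hβ
  set ε := d * (1 / (m : ℝ)) + β * √(d ^ 2 * (1 / m)) with hεdef
  have hε0 : 0 ≤ ε := by positivity
  set V := vEst φ M.r H β x u τ k i with hVdef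
  have hVmem : ∀ i' ≤ i, ∀ y, vEst φ M.r H β x u τ k i' y ∈ Set.Icc (0 : ℝ) H :=
    fun i' hi' y => ⟨hV i' hi' y, vEst_le _ _ _ _ _ _ _⟩
  -- Nonnegativity of the estimate makes the truncation at `0` in `netValue` invisible.
  have hnet : ∀ i', i = i' + 1 → V = netValue φ H β
      (weights φ M.r x u τ k (H - (i' + 1)) (vEst φ M.r H β x u τ k i'))
      (gram φ x u τ k (H - (i' + 1)))⁻¹ := by
    intro i' hi'
    subst hi'
    funext y
    have h0 := hV (i' + 1) le_rfl y
    have h1 := max_eq_left h0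
    rw [hVdef, ← h1]
    rfl
  have hVm : Measurable V := by
    rcases i with _ | i'
    · exact measurable_const
    · rw [hnet i' rfl]
      exact measurable_netValue hφ _ _ _ _
  obtain ⟨b', e, hbe, hb', he⟩ : ∃ b e : ℕ → ℝ, (∀ l, V (x l (h + 1)) -
        ∫ y, V y ∂(M.P l h (x l h, u l h)) = b l + e l) ∧
      (∀ l ∈ Finset.Ico τ k, |b l| ≤ 2 * ε) ∧
      (∑ l ∈ Finset.Ico τ k, e l • (φ (x l h) (u l h)).ofLp) ⬝ᵥ (gram φ x u τ k h)⁻¹ *ᵥ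
        (∑ l ∈ Finset.Ico τ k, e l • (φ (x l h) (u l h)).ofLp) ≤ (H : ℝ) ^ 2 / 2 * (L + 1) := by
    -- At the last step the target function is zero, so there is no noise and no grid bound is
    -- needed.
    rcases i with _ | i'
    · refine ⟨fun _ => 0, fun _ => 0, fun l => ?_, fun l _ => by simpa using hε0, ?_⟩
      · simp [hVdef, vEst]
      · simp only [zero_smul, Finset.sum_const_zero, mulVec_zero, dotProduct_zero]
        positivity
    · rw [hnet i' rfl]
      refine exists_noise_decomposition hlin hβ0 hk (by omega) hkN hm hN hn hm2
        (hgrid h (by omega))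
        (fun j => abs_weights_le hlin hk (by omega) hkN (hVmem i' (by omega)) j) fun j j' => ?_
      rw [gram_eq_regGram]
      exact abs_inv_regGram_apply_le _ _ _ _
  obtain ⟨v, hv, hPv⟩ := exists_integral_eq_inner hlin hk hhH hVm (Nat.cast_nonneg H)
    (hVmem i le_rfl)
  -- The total bias: drift of the rewards, drift of the transitions, and rounding of the value
  -- function.
  set b : ℕ → ℝ := fun l => ⟪φ (x l h) (u l h), θ l h - θ k h⟫ +
    (∫ y, V y ∂(M.P l h (x l h, u l h)) - ∫ y, V y ∂(M.P k h (x l h, u l h))) + b' l with hb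
  have hbB : ∀ l ∈ Finset.Ico τ k, |b l| ≤ Bθ + H * Bμ + 2 * ε := by
    intro l hl
    have hlK : l < K := (Finset.mem_Ico.1 hl).2.trans hk
    have h1 : |⟪φ (x l h) (u l h), θ l h - θ k h⟫| ≤ Bθ := by
      refine (abs_real_inner_le_norm _ _).trans ?_
      rw [norm_sub_rev]
      exact (mul_le_of_le_one_left (norm_nonneg _) (hlin.norm_feature _ _)).trans (hBθ l hl)
    have h2 : |∫ y, V y ∂(M.P l h (x l h, u l h)) - ∫ y, V y ∂(M.P k h (x l h, u l h))| ≤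
        H * Bμ := by
      rw [abs_sub_comm]
      exact abs_integral_sub_integral_le hlin hk hlK hhH hVm (Nat.cast_nonneg H)
        (hVmem i le_rfl) _ _ (hBμ l hl)
    refine (abs_add_le _ _).trans (add_le_add ((abs_add_le _ _).trans (add_le_add h1 h2)) (hb' l hl))
  set q : EuclideanSpace ℝ (Fin d) := θ k h + v with hq
  have hqn : √(q.ofLp ⬝ᵥ q.ofLp) ≤ 2 * H * √d := by
    rw [sqrt_dotProduct_self]
    refine (norm_add_le _ _).trans ?_
    have := hlin.norm_reward k hk h hhH
    nlinarith [Real.sqrt_nonneg (d : ℝ)]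
  have hqφ : ∀ y a, (φ y a).ofLp ⬝ᵥ q.ofLp = M.r k h y a + ∫ y', V y' ∂(M.P k h (y, a)) := by
    intro y a
    rw [← inner_eq_dotProduct, hq, inner_add_right, hPv, hlin.reward k hk h hhH]
  have hmain := abs_ridge_sub_le (Finset.Ico τ k) (fun l => (φ (x l h) (u l h)).ofLp) q.ofLp
    (φ y a).ofLp (fun l => M.r l h (x l h) (u l h) + V (x l (h + 1))) b e (fun l hl => by
      have hlK : l < K := (Finset.mem_Ico.1 hl).2.trans hk
      have h1 := hbe l
      simp only [hb]
      rw [hqφ, hlin.reward l hlK h hhH, hlin.reward k hk h hhH, inner_sub_right]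
      linarith)
  rw [hqφ] at hmain
  refine hmain.trans ?_
  rw [mul_comm, gram_eq_regGram]
  refine mul_le_mul_of_nonneg_right ?_ (Real.sqrt_nonneg _)
  have h1 := sqrt_sum_sq_le (Finset.Ico τ k) b (B := Bθ + H * Bμ + 2 * ε) (N := N)
    (by rwa [Nat.card_Ico]) (by positivity) hbB
  have h2 := Real.sqrt_le_sqrt he
  rw [gram_eq_regGram] at h2
  -- Drift contributes at most 1, by the small-variation hypothesis, and rounding at most 2.
  have h3 : √(N : ℝ) * (Bθ + H * Bμ + 2 * ε) ≤ 3 := by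
    rw [mul_add]
    linarith
  linarith

end Regression

/-! ### Optimism and the regret decomposition of one episode. -/

section Optimism

open Matrix

variable {S A : Type*} [MeasurableSpace S] [MeasurableSpace A] [Finite A] [Nonempty A]
  [MeasurableSingletonClass A] {H K d : ℕ} {β : ℝ}
  {M : EpisodicMDP S A H K} {φ : S → A → EuclideanSpace ℝ (Fin d)}

/-- The elliptical norm of the feature at `(y, a)`, without the factor `β`. -/
noncomputable def bonus (φ : S → A → EuclideanSpace ℝ (Fin d)) (x : ℕ → ℕ → S) (u : ℕ → ℕ → A)
    (τ k h : ℕ) (y : S) (a : A) : ℝ :=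
  √((φ y a).ofLp ⬝ᵥ (gram φ x u τ k h)⁻¹ *ᵥ (φ y a).ofLp)

/-- The regression of step `h = H - (i + 1)` is accurate up to `β` times the bonus. -/
def IsAccurate (M : EpisodicMDP S A H K) (φ : S → A → EuclideanSpace ℝ (Fin d)) (β : ℝ)
    (x : ℕ → ℕ → S) (u : ℕ → ℕ → A) (τ k i : ℕ) : Prop :=
  ∀ y a, |weights φ M.r x u τ k (H - (i + 1)) (vEst φ M.r H β x u τ k i) ⬝ᵥ (φ y a).ofLp -
    (M.r k (H - (i + 1)) y a +
      ∫ y', vEst φ M.r H β x u τ k i y' ∂(M.P k (H - (i + 1)) (y, a)))| ≤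
    β * bonus φ x u τ k (H - (i + 1)) y a

omit [Nonempty A] in
theorem measurable_vEst_apply (hφ : ∀ a, Measurable fun s => φ s a) (r : ℕ → ℕ → S → A → ℝ)
    (x : ℕ → ℕ → S) (u : ℕ → ℕ → A) (τ k i : ℕ) : Measurable (vEst φ r H β x u τ k i) := by
  cases i with
  | zero => exact measurable_const
  | succ i =>
    have hf : ∀ a j, Measurable fun s : S => (φ s a).ofLp j := fun a j =>
      measurable_feature_apply hφ measurable_id measurable_const j
    refine Measurable.iSup fun a => Measurable.min (Measurable.add ?_
      (measurable_const.mul (Measurable.sqrt ?_))) measurable_const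
    · exact measurable_dotProduct (fun i => measurable_const) (hf a)
    · exact measurable_dotProduct (hf a) (measurable_mulVec
        (G := fun _ => (gram φ x u τ k (H - (i + 1)))⁻¹) (fun i j => measurable_const) (hf a))

/-- The bonus outweighs the regression error and the Bellman operator is monotone; the cap at `H` is
harmless because no policy is worth more than `H`. -/
theorem value_le_vEst_succ (hφ : ∀ a, Measurable fun s => φ s a) {x : ℕ → ℕ → S}
    {u : ℕ → ℕ → A} {τ k i : ℕ} (hk : k < K) (hi : i + 1 ≤ H)
    (hacc : IsAccurate M φ β x u τ k i) (h0 : ∀ y, 0 ≤ vEst φ M.r H β x u τ k i y)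
    {π : ℕ → S → A} (hπ : ∀ j, Measurable (π j))
    (hle : ∀ y, value M k π (H - i) y ≤ vEst φ M.r H β x u τ k i y) (y : S) :
    value M k π (H - (i + 1)) y ≤ vEst φ M.r H β x u τ k (i + 1) y := by
  have hlt : H - (i + 1) < H := by omega
  have hM := M.isMarkov k hk _ hlt
  have hbd : BddAbove (Set.range fun a => qStep φ M.r H β x u τ k (H - (i + 1))
      (vEst φ M.r H β x u τ k i) y a) := (Set.finite_range _).bddAbove
  refine le_trans ?_ (le_ciSup hbd (π (H - (i + 1)) y))
  refine le_min ?_ (value_mem' M hk hπ _ y).2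
  rw [value_eq M hk hπ hlt, show H - (i + 1) + 1 = H - i by omega]
  have h1 := (abs_le.1 (hacc y (π (H - (i + 1)) y))).1
  have h2 : ∫ y', value M k π (H - i) y' ∂(M.P k (H - (i + 1)) (y, π (H - (i + 1)) y)) ≤
      ∫ y', vEst φ M.r H β x u τ k i y' ∂(M.P k (H - (i + 1)) (y, π (H - (i + 1)) y)) := by
    refine integral_mono ?_ ?_ hle
    · exact Integrable.of_mem_Icc 0 H (measurable_value M hk hπ _).aemeasurable
        (.of_forall fun y => value_mem' M hk hπ _ y)
    · exact Integrable.of_mem_Icc 0 H (measurable_vEst_apply hφ _ _ _ _ _ _).aemeasurable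
        (.of_forall fun y => ⟨h0 y, vEst_le _ _ _ _ _ _ _⟩)
  rw [bonus] at h1
  linarith

/-- Optimism: if the regressions are accurate as long as the estimates used in them are
nonnegative, then the estimates dominate the values of all policies. -/
theorem optimism (hφ : ∀ a, Measurable fun s => φ s a) {x : ℕ → ℕ → S} {u : ℕ → ℕ → A}
    {τ k : ℕ} (hk : k < K)
    (hacc : ∀ i, i + 1 ≤ H → (∀ i' ≤ i, ∀ y, 0 ≤ vEst φ M.r H β x u τ k i' y) →
      IsAccurate M φ β x u τ k i) (i : ℕ) (hi : i ≤ H) :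
    (∀ i' ≤ i, ∀ y, 0 ≤ vEst φ M.r H β x u τ k i' y) ∧
      ∀ π : ℕ → S → A, (∀ j, Measurable (π j)) → ∀ y,
        value M k π (H - i) y ≤ vEst φ M.r H β x u τ k i y := by
  induction i with
  | zero =>
    refine ⟨fun i' hi' y => ?_, fun π _ y => ?_⟩
    · rw [Nat.le_zero.1 hi']
      exact le_rfl
    · rw [value_of_le M k π (by omega)]
      exact le_rfl
  | succ i ih =>
    obtain ⟨h0, hle⟩ := ih (by omega)
    have h1 : ∀ π : ℕ → S → A, (∀ j, Measurable (π j)) → ∀ y,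
        value M k π (H - (i + 1)) y ≤ vEst φ M.r H β x u τ k (i + 1) y := fun π hπ =>
      value_le_vEst_succ hφ hk hi (hacc i hi h0) (h0 i le_rfl) hπ (hle π hπ)
    refine ⟨fun i' hi' y => ?_, h1⟩
    rcases Nat.le_succ_iff.1 hi' with h | h
    · exact h0 i' h y
    · rw [h]
      -- Any policy has nonnegative value, so dominating a constant one already makes the estimate
      -- nonnegative and keeps the induction going.
      have hπ : ∀ j : ℕ, Measurable ((fun _ _ => Classical.arbitrary A : ℕ → S → A) j) :=
        fun _ => measurable_const
      exact (value_mem M hk hπ _ y).1.trans (h1 _ hπ y)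

variable {sel : (A → ℝ) → A} {N : ℕ}

/-- The executed action attains the maximum in the estimate. The bonus appears twice: once added by
the algorithm, once as the regression error. -/
theorem vEst_succ_sub_value_le (hφ : ∀ a, Measurable fun s => φ s a) (hsel : IsArgmaxRule sel)
    {x : ℕ → ℕ → S} {u : ℕ → ℕ → A} {k i : ℕ} (hk : k < K) (hi : i + 1 ≤ H)
    (hacc : IsAccurate M φ β x u (epochStart N k) k i)
    (h0 : ∀ y, 0 ≤ vEst φ M.r H β x u (epochStart N k) k i y) (y : S) :
    vEst φ M.r H β x u (epochStart N k) k (i + 1) y -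
        value M k (greedyPolicy φ M.r H β N sel x u k) (H - (i + 1)) y ≤
      2 * β * bonus φ x u (epochStart N k) k (H - (i + 1)) y
        (greedyPolicy φ M.r H β N sel x u k (H - (i + 1)) y) +
      ∫ y', valueGap M φ β N sel x u k (H - (i + 1)) y'
        ∂(M.P k (H - (i + 1)) (y, greedyPolicy φ M.r H β N sel x u k (H - (i + 1)) y)) := by
  set π := greedyPolicy φ M.r H β N sel x u k with hπdef
  have hπ : ∀ j, Measurable (π j) := measurable_greedyPolicy_apply M hφ hsel x u k
  have hlt : H - (i + 1) < H := by omega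
  have hM := M.isMarkov k hk _ hlt
  have hidx : H - (H - (i + 1) + 1) = i := by omega
  have h1 : vEst φ M.r H β x u (epochStart N k) k (i + 1) y ≤
      weights φ M.r x u (epochStart N k) k (H - (i + 1))
        (vEst φ M.r H β x u (epochStart N k) k i) ⬝ᵥ (φ y (π (H - (i + 1)) y)).ofLp +
      β * bonus φ x u (epochStart N k) k (H - (i + 1)) y (π (H - (i + 1)) y) := by
    refine (ciSup_le fun a => ?_).trans (min_le_left _ (H : ℝ))
    have := hsel.isMax (qEst φ M.r H β N x u k (H - (i + 1)) y) a
    simp only [qEst, hidx] at this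
    refine this.trans (le_of_eq ?_)
    rw [hπdef]
    simp only [greedyPolicy]
    rfl
  have h2 := (abs_le.1 (hacc y (π (H - (i + 1)) y))).2
  have h3 : ∫ y', valueGap M φ β N sel x u k (H - (i + 1)) y'
        ∂(M.P k (H - (i + 1)) (y, π (H - (i + 1)) y)) =
      (∫ y', vEst φ M.r H β x u (epochStart N k) k i y'
        ∂(M.P k (H - (i + 1)) (y, π (H - (i + 1)) y))) -
      ∫ y', value M k π (H - (i + 1) + 1) y'
        ∂(M.P k (H - (i + 1)) (y, π (H - (i + 1)) y)) := by
    rw [← integral_sub]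
    · refine integral_congr_ae (.of_forall fun y' => ?_)
      simp only [valueGap, hidx]
      rw [max_eq_left (h0 y')]
    · exact Integrable.of_mem_Icc 0 H (measurable_vEst_apply hφ _ _ _ _ _ _).aemeasurable
        (.of_forall fun y => ⟨h0 y, vEst_le _ _ _ _ _ _ _⟩)
    · exact Integrable.of_mem_Icc 0 H (measurable_value M hk hπ _).aemeasurable
        (.of_forall fun y => value_mem' M hk hπ _ y)
  rw [value_eq M hk hπ hlt, h3]
  linarith

/-- The regret of one episode is at most the bonuses collected plus martingale differences. -/
theorem vEst_sub_value_le_sum (hφ : ∀ a, Measurable fun s => φ s a) (hsel : IsArgmaxRule sel)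
    {x : ℕ → ℕ → S} {u : ℕ → ℕ → A} {k : ℕ} (hk : k < K)
    (hact : ∀ h < H, u k h = greedyPolicy φ M.r H β N sel x u k h (x k h))
    (hacc : ∀ i, i + 1 ≤ H → IsAccurate M φ β x u (epochStart N k) k i)
    (h0 : ∀ i ≤ H, ∀ y, 0 ≤ vEst φ M.r H β x u (epochStart N k) k i y) (i : ℕ) (hi : i + 1 ≤ H) :
    vEst φ M.r H β x u (epochStart N k) k (i + 1) (x k (H - (i + 1))) -
        value M k (greedyPolicy φ M.r H β N sel x u k) (H - (i + 1)) (x k (H - (i + 1))) ≤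
      ∑ h ∈ Finset.Ico (H - (i + 1)) H,
        2 * β * bonus φ x u (epochStart N k) k h (x k h) (u k h) +
      ∑ h ∈ Finset.Ico (H - (i + 1)) (H - 1),
        (∫ y', valueGap M φ β N sel x u k h y' ∂(M.P k h (x k h, u k h)) -
          valueGap M φ β N sel x u k h (x k (h + 1))) := by
  have hstep := fun i (hi : i + 1 ≤ H) => vEst_succ_sub_value_le hφ hsel hk hi (hacc i hi)
    (h0 i (by omega)) (x k (H - (i + 1)))
  induction i with
  | zero =>
    have h1 := hstep 0 hi
    rw [← hact _ (by omega)] at h1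
    -- After the last step both the estimate and the value vanish, which is why the martingale sum
    -- stops at `H - 1`.
    have h2 : ∀ y', valueGap M φ β N sel x u k (H - (0 + 1)) y' = 0 := by
      intro y'
      rw [valueGap, value_of_le M k _ (by omega), show H - (H - (0 + 1) + 1) = 0 by omega]
      simp [vEst]
    simp only [h2, integral_zero, add_zero] at h1
    rw [Finset.sum_eq_sum_Ico_succ_bot (show H - (0 + 1) < H by omega),
      Finset.Ico_eq_empty (show ¬ H - (0 + 1) + 1 < H by omega),
      Finset.Ico_eq_empty (show ¬ H - (0 + 1) < H - 1 by omega)]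
    simpa using h1
  | succ i ih =>
    have h1 := hstep (i + 1) hi
    rw [← hact _ (by omega)] at h1
    have h2 := ih (by omega)
    have hidx : H - (i + 1 + 1) + 1 = H - (i + 1) := by omega
    rw [Finset.sum_eq_sum_Ico_succ_bot (show H - (i + 1 + 1) < H by omega),
      Finset.sum_eq_sum_Ico_succ_bot (show H - (i + 1 + 1) < H - 1 by omega), hidx]
    have h3 : valueGap M φ β N sel x u k (H - (i + 1 + 1)) (x k (H - (i + 1))) =
        vEst φ M.r H β x u (epochStart N k) k (i + 1) (x k (H - (i + 1))) -
        value M k (greedyPolicy φ M.r H β N sel x u k) (H - (i + 1)) (x k (H - (i + 1))) := by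
      rw [valueGap, hidx, show H - (H - (i + 1)) = i + 1 by omega,
        max_eq_left (h0 (i + 1) (by omega) _)]
    linarith

/-- The regret of one episode, for accurate regressions. -/
theorem optValue_sub_value_le (hφ : ∀ a, Measurable fun s => φ s a) (hsel : IsArgmaxRule sel)
    {x : ℕ → ℕ → S} {u : ℕ → ℕ → A} {k : ℕ} (hk : k < K) (hH : 0 < H)
    (hact : ∀ h < H, u k h = greedyPolicy φ M.r H β N sel x u k h (x k h))
    (hacc : ∀ i, i + 1 ≤ H →
      (∀ i' ≤ i, ∀ y, 0 ≤ vEst φ M.r H β x u (epochStart N k) k i' y) →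
      IsAccurate M φ β x u (epochStart N k) k i) :
    optValue M k 0 (x k 0) - value M k (greedyPolicy φ M.r H β N sel x u k) 0 (x k 0) ≤
      ∑ h ∈ Finset.range H, 2 * β * bonus φ x u (epochStart N k) k h (x k h) (u k h) +
      ∑ h ∈ Finset.range (H - 1),
        (∫ y', valueGap M φ β N sel x u k h y' ∂(M.P k h (x k h, u k h)) -
          valueGap M φ β N sel x u k h (x k (h + 1))) := by
  obtain ⟨h0, hle⟩ := optimism hφ hk hacc H le_rfl
  have hacc' : ∀ i, i + 1 ≤ H → IsAccurate M φ β x u (epochStart N k) k i := fun i hi =>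
    hacc i hi fun i' hi' => h0 i' (by omega)
  have h1 := vEst_sub_value_le_sum hφ hsel hk hact hacc' h0 (H - 1) (by omega)
  rw [Nat.sub_add_cancel hH, Nat.sub_self, ← Finset.range_eq_Ico, ← Finset.range_eq_Ico] at h1
  rw [Nat.sub_self] at hle
  have h2 : optValue M k 0 (x k 0) ≤ vEst φ M.r H β x u (epochStart N k) k H (x k 0) :=
    optValue_le M fun π hπ => hle π hπ _
  linarith

end Optimism

/-! ### Epochs and the variation inside them. -/

section Variation

variable {S : Type*} [MeasurableSpace S] {d : ℕ}

theorem epochStart_of_mem_epoch {N K j k : ℕ} (hk : k ∈ epoch N K j) :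
    epochStart N k = j * N := by
  have h := Finset.mem_Ico.1 hk
  have h2 : k < (j + 1) * N := lt_of_lt_of_le h.2 (min_le_left _ _)
  rw [epochStart, Nat.div_eq_of_lt_le h.1 h2]

theorem lt_of_mem_epoch {N K j k : ℕ} (hk : k ∈ epoch N K j) : k < K :=
  lt_of_lt_of_le (Finset.mem_Ico.1 hk).2 (min_le_right _ _)

theorem sub_le_of_mem_epoch {N K j k : ℕ} (hk : k ∈ epoch N K j) : k - j * N ≤ N := by
  have h := Finset.mem_Ico.1 hk
  have h2 : k < (j + 1) * N := lt_of_lt_of_le h.2 (min_le_left _ _)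
  rw [add_mul, one_mul] at h2
  omega

theorem card_epoch_le (N K j : ℕ) : (epoch N K j).card ≤ N := by
  rw [epoch, Nat.card_Ico]
  have : min ((j + 1) * N) K ≤ j * N + N := (min_le_left _ _).trans (by rw [add_mul, one_mul])
  omega

theorem rewardVariation_nonneg (θ : ℕ → ℕ → EuclideanSpace ℝ (Fin d)) (H N K j : ℕ) :
    0 ≤ rewardVariation θ H N K j :=
  Finset.sum_nonneg fun _ _ => Finset.sum_nonneg fun _ _ => norm_nonneg _

theorem transitionVariation_nonneg
    (μ : ℕ → ℕ → VectorMeasure S (EuclideanSpace ℝ (Fin d))) (H N K j : ℕ) :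
    0 ≤ transitionVariation μ H N K j :=
  Finset.sum_nonneg fun _ _ => Finset.sum_nonneg fun _ _ => vmNorm_nonneg _

theorem norm_sub_le_rewardVariation (θ : ℕ → ℕ → EuclideanSpace ℝ (Fin d)) {H N K j k l h : ℕ}
    (hk : k ∈ epoch N K j) (hl : l ∈ Finset.Ico (j * N) k) (hh : h < H) :
    ‖θ k h - θ l h‖ ≤ rewardVariation θ H N K j := by
  have hl' := Finset.mem_Ico.1 hl
  exact norm_sub_le_sum_variation (f := fun i => θ i h)
    (v := fun i => ∑ h ∈ Finset.range H, ‖θ i h - θ (i - 1) h‖)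
    (fun i => Finset.single_le_sum (f := fun h => ‖θ i h - θ (i - 1) h‖)
      (fun _ _ => norm_nonneg _) (Finset.mem_range.2 hh)) hl'.1 hl'.2.le (Finset.mem_Ico.1 hk).2

theorem norm_sub_le_transitionVariation
    (μ : ℕ → ℕ → VectorMeasure S (EuclideanSpace ℝ (Fin d))) {H N K j k l h : ℕ}
    (hk : k ∈ epoch N K j) (hl : l ∈ Finset.Ico (j * N) k) (hh : h < H) (B : Set S) :
    ‖μ k h B - μ l h B‖ ≤ transitionVariation μ H N K j := by
  have hl' := Finset.mem_Ico.1 hl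
  exact norm_sub_le_sum_variation (f := fun i => μ i h B)
    (v := fun i => ∑ h ∈ Finset.range H, vmNorm (μ i h - μ (i - 1) h))
    (fun i => (norm_le_vmNorm (μ i h - μ (i - 1) h) B).trans
      (Finset.single_le_sum (f := fun h => vmNorm (μ i h - μ (i - 1) h))
        (fun _ _ => vmNorm_nonneg _) (Finset.mem_range.2 hh)))
    hl'.1 hl'.2.le (Finset.mem_Ico.1 hk).2

end Variation

/-! ### Deterministic regret bounds of an epoch. -/

section EpochRegret

open Matrix

variable {S A : Type*} [MeasurableSpace S] [MeasurableSpace A] [Finite A] [Nonempty A]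
  [MeasurableSingletonClass A] {H K d : ℕ} {β : ℝ}
  {M : EpisodicMDP S A H K} {φ : S → A → EuclideanSpace ℝ (Fin d)}
  {μ : ℕ → ℕ → VectorMeasure S (EuclideanSpace ℝ (Fin d))}
  {θ : ℕ → ℕ → EuclideanSpace ℝ (Fin d)} {sel : (A → ℝ) → A} {N : ℕ}

/-- The regret of an epoch never exceeds its number of steps. -/
theorem epochRegret_le_steps (hφ : ∀ a, Measurable fun s => φ s a) (hsel : IsArgmaxRule sel)
    (x : ℕ → ℕ → S) (u : ℕ → ℕ → A) (j : ℕ) :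
    epochRegret M φ β N sel x u j ≤ N * H := by
  have h1 : ∀ k ∈ epoch N K j, optValue M k 0 (x k 0) -
      value M k (greedyPolicy φ M.r H β N sel x u k) 0 (x k 0) ≤ H := by
    intro k hk
    have hkK := lt_of_mem_epoch hk
    have h1 : optValue M k 0 (x k 0) ≤ H :=
      optValue_le M fun π hπ => (value_mem' M hkK hπ 0 _).2
    have h2 := (value_mem' M hkK (measurable_greedyPolicy_apply (N := N) (β := β) M hφ hsel x u k)
      0 (x k 0)).1
    linarith
  refine (Finset.sum_le_sum h1).trans ?_
  rw [Finset.sum_const, nsmul_eq_mul]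
  have : ((epoch N K j).card : ℝ) ≤ N := by exact_mod_cast card_epoch_le N K j
  gcongr

-- Cauchy–Schwarz over the at most `N` episodes reduces the sum, for one fixed step `h`, to the
-- elliptical potential.
omit [MeasurableSpace S] [MeasurableSpace A] [Finite A] [Nonempty A]
  [MeasurableSingletonClass A] in
theorem sum_bonus_le (hφ : ∀ s a, ‖φ s a‖ ≤ 1) (x : ℕ → ℕ → S) (u : ℕ → ℕ → A)
    (hd : 0 < d) (K j h : ℕ) :
    ∑ k ∈ epoch N K j, bonus φ x u (j * N) k h (x k h) (u k h) ≤
      √(N * (2 * (d * Real.log (d + N)))) := by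
  have hd' : (1 : ℝ) ≤ d := by exact_mod_cast hd
  have hN0 : (0 : ℝ) ≤ N := Nat.cast_nonneg N
  have hsum : ∑ k ∈ epoch N K j, bonus φ x u (j * N) k h (x k h) (u k h) ^ 2 ≤
      2 * (d * Real.log (d + N)) := by
    rcases le_total (j * N) (min ((j + 1) * N) K) with hle | hle
    · have h1 := sum_dotProduct_inv_regGram_le (fun k => (φ (x k h) (u k h)).ofLp) (j * N)
        (min ((j + 1) * N) K) hle fun l => feature_dotProduct_self_le (hφ _ _)
      have h2 : ((min ((j + 1) * N) K - j * N : ℕ) : ℝ) ≤ N := by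
        have := card_epoch_le N K j
        rw [epoch, Nat.card_Ico] at this
        exact_mod_cast this
      refine le_trans (le_of_eq (Finset.sum_congr rfl fun k hk => ?_)) (h1.trans ?_)
      · rw [bonus, gram_eq_regGram, Real.sq_sqrt (dotProduct_inv_regGram_nonneg _ _ _)]
      · gcongr
    · rw [epoch, Finset.Ico_eq_empty_of_le hle, Finset.sum_empty]
      have : 0 ≤ Real.log (d + N) := Real.log_nonneg (by linarith)
      positivity
  apply Real.le_sqrt_of_sq_le
  have h1 := sq_sum_le_card_mul_sum_sq (s := epoch N K j)
    (f := fun k => bonus φ x u (j * N) k h (x k h) (u k h))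
  have h2 : ((epoch N K j).card : ℝ) ≤ N := by exact_mod_cast card_epoch_le N K j
  refine h1.trans ?_
  exact mul_le_mul h2 hsum (Finset.sum_nonneg fun _ _ => sq_nonneg _) hN0

/-- The regret of an epoch of small variation, on the event that the regression noise and the
regret martingale are well-behaved. -/
theorem epochRegret_le_of_good (hlin : IsLinearMDP M φ μ θ) (hsel : IsArgmaxRule sel)
    {x : ℕ → ℕ → S} {u : ℕ → ℕ → A} {j m n : ℕ} {L L' η : ℝ} (hd : 0 < d) (hH : 0 < H)
    (hact : ∀ k < K, ∀ h < H, u k h = greedyPolicy φ M.r H β N sel x u k h (x k h))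
    (hm : 0 < m) (hN : 0 < N)
    (hn : 4 * (N * H : ℝ) * m + 1 ≤ n) (hm2 : (H : ℝ) ^ 2 * (1 + N) * d ≤ 8 * (m : ℝ) ^ 2)
    (hL : 0 ≤ L) (hgrid : ∀ k ∈ epoch N K j, ∀ h, h + 1 < H →
      GridBound M φ β m n L x u (j * N) k h)
    (hvar : √N * (rewardVariation θ H N K j + H * transitionVariation μ H N K j) ≤ 1)
    (hε : √N * (2 * (d * (1 / m) + β * √(d ^ 2 * (1 / m)))) ≤ 2)
    (hβ : 3 + √((H : ℝ) ^ 2 / 2 * (L + 1)) + 2 * H * √d ≤ β) (hη : 0 < η)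
    (hgap : ∑ l ∈ epoch N K j, ∑ i ∈ Finset.range (H - 1),
      gapExponent M φ β N sel η x u l i ≤ L') :
    epochRegret M φ β N sel x u j ≤
      2 * β * (H * √(N * (2 * (d * Real.log (d + N))))) +
        (L' / η + η * (H : ℝ) ^ 2 / 2 * (N * H)) := by
  have hφ := hlin.measurable_feature
  have hβ0 : 0 ≤ β := le_trans (by positivity) hβ
  set ζ : ℕ → ℕ → ℝ := fun k h =>
    ∫ y', valueGap M φ β N sel x u k h y' ∂(M.P k h (x k h, u k h)) -
          valueGap M φ β N sel x u k h (x k (h + 1)) with hζ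
  have hper : ∀ k ∈ epoch N K j, optValue M k 0 (x k 0) -
      value M k (greedyPolicy φ M.r H β N sel x u k) 0 (x k 0) ≤
      ∑ h ∈ Finset.range H, 2 * β * bonus φ x u (j * N) k h (x k h) (u k h) +
      ∑ h ∈ Finset.range (H - 1), ζ k h := by
    intro k hk
    have hkK := lt_of_mem_epoch hk
    have hst := epochStart_of_mem_epoch hk
    have := optValue_sub_value_le (N := N) (β := β) hφ hsel hkK hH (hact k hkK)
      (fun i hi hV y a => by
        rw [hst] at hV ⊢
        exact abs_weights_sub_le hlin hkK (show H - (i + 1) + (i + 1) = H by omega)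
          (sub_le_of_mem_epoch hk) hm hN hn hm2 hL (hgrid k hk)
          (fun l hl => norm_sub_le_rewardVariation θ hk hl (by omega))
          (fun l hl B => norm_sub_le_transitionVariation μ hk hl (by omega) B)
          (rewardVariation_nonneg _ _ _ _ _) (transitionVariation_nonneg _ _ _ _ _)
          hvar hε hβ hV y a)
    rw [hst] at this
    exact this
  have hbonus : ∑ k ∈ epoch N K j, ∑ h ∈ Finset.range H,
      2 * β * bonus φ x u (j * N) k h (x k h) (u k h) ≤
      2 * β * (H * √(N * (2 * (d * Real.log (d + N))))) := by
    rw [Finset.sum_comm]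
    have h1 : ∀ h ∈ Finset.range H, ∑ k ∈ epoch N K j,
        2 * β * bonus φ x u (j * N) k h (x k h) (u k h) ≤
        2 * β * √(N * (2 * (d * Real.log (d + N)))) := fun h _ => by
      rw [← Finset.mul_sum]
      exact mul_le_mul_of_nonneg_left (sum_bonus_le hlin.norm_feature x u hd K j h)
        (by positivity)
    refine (Finset.sum_le_sum h1).trans (le_of_eq ?_)
    rw [Finset.sum_const, Finset.card_range, nsmul_eq_mul]
    ring
  have hmart : ∑ k ∈ epoch N K j, ∑ h ∈ Finset.range (H - 1), ζ k h ≤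
      L' / η + η * (H : ℝ) ^ 2 / 2 * (N * H) := by
    -- The gap has range `[-H, H]`, so its Hoeffding term is `η² (2H)² / 8`; dividing by `η` leaves
    -- `η H² / 2` per transition.
    have h1 : ∀ k h, ζ k h = gapExponent M φ β N sel η x u k h / η + η * (H : ℝ) ^ 2 / 2 := by
      intro k h
      rw [gapExponent, hζ]
      field_simp
      ring
    simp_rw [h1, Finset.sum_add_distrib, ← Finset.sum_div]
    refine add_le_add (div_le_div_of_nonneg_right hgap hη.le) ?_
    simp only [Finset.sum_const, Finset.card_range, nsmul_eq_mul]
    have h2 : ((epoch N K j).card : ℝ) ≤ N := by exact_mod_cast card_epoch_le N K j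
    have h3 : ((H - 1 : ℕ) : ℝ) ≤ H := by exact_mod_cast Nat.sub_le H 1
    calc _ =
        η * (H : ℝ) ^ 2 / 2 * ((epoch N K j).card * ((H - 1 : ℕ) : ℝ)) := by ring
      _ ≤ _ := mul_le_mul_of_nonneg_left (mul_le_mul h2 h3 (Nat.cast_nonneg _)
        (Nat.cast_nonneg _)) (by positivity)
  refine (Finset.sum_le_sum hper).trans ?_
  rw [Finset.sum_add_distrib]
  exact add_le_add hbonus hmart

end EpochRegret

/-! ### Probability of the good event. -/

section GoodEvent

open Matrix

variable {S A Ω : Type*} [MeasurableSpace S] [MeasurableSpace A] [Finite A] [Nonempty A]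
  [MeasurableSingletonClass A] {mΩ : MeasurableSpace Ω} {Pr : Measure Ω} [IsProbabilityMeasure Pr]
  {H K d N : ℕ} {β : ℝ} {M : EpisodicMDP S A H K} {φ : S → A → EuclideanSpace ℝ (Fin d)}
  {sel : (A → ℝ) → A} {s : ℕ → ℕ → Ω → S} {u : ℕ → ℕ → Ω → A}

/-- Every grid point gives a deterministic direction and test function, so Markov's inequality for
the supermartingale applies to each. The exponent `d + (d + d * d)` counts direction, weights and
bonus matrix. -/
theorem measure_not_gridBound_le (hφ : ∀ a, Measurable fun s => φ s a) (hsel : IsArgmaxRule sel)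
    (hrun : IsRun Pr M φ β N sel s u) (m n : ℕ) (L : ℝ) {τ k h : ℕ} (hτ : τ ≤ k) (hk : k < K)
    (hh : h + 1 < H) :
    Pr {ω | ¬ GridBound M φ β m n L (fun l i => s l i ω) (fun l i => u l i ω) τ k h} ≤
      ENNReal.ofReal ((2 * n + 1) ^ (d + (d + d * d)) * Real.exp (-L)) := by
  let zs : Finset (Fin d ⊕ Fin d ⊕ Fin d × Fin d → ℤ) :=
    Fintype.piFinset fun _ => Finset.Icc (-(n : ℤ)) n
  have hcard : zs.card = (2 * n + 1) ^ (d + (d + d * d)) := by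
    rw [Fintype.card_piFinset, Finset.prod_const, Int.card_Icc, Finset.card_univ]
    simp only [Fintype.card_sum, Fintype.card_prod, Fintype.card_fin]
    congr 1
    omega
  let V : (Fin d ⊕ Fin d ⊕ Fin d × Fin d → ℤ) → S → ℝ := fun z =>
    netValue φ H β (fun i => z (Sum.inr (Sum.inl i)) / (m : ℝ))
      (Matrix.of fun i j => z (Sum.inr (Sum.inr (i, j))) / (m : ℝ))
  let Z : (Fin d ⊕ Fin d ⊕ Fin d × Fin d → ℤ) → Ω → ℝ := fun z ω =>
    selfNormalizedExponent M φ (fun l i => s l i ω) (fun l i => u l i ω) τ k h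
      (fun i => z (Sum.inl i) / (m : ℝ)) (V z)
  have hsub : {ω | ¬ GridBound M φ β m n L (fun l i => s l i ω) (fun l i => u l i ω) τ k h} ⊆
      ⋃ z ∈ zs, {ω | L < Z z ω} := by
    intro ω hω
    simp only [GridBound, Set.mem_ofPred_eq, not_forall, not_le] at hω
    obtain ⟨z, hz, hlt⟩ := hω
    refine Set.mem_biUnion (x := z) ?_ hlt
    refine Finset.mem_coe.2 (Fintype.mem_piFinset.2 fun i => Finset.mem_Icc.2 ?_)
    exact abs_le.1 (hz i)
  have hZ : ∀ z ∈ zs, Pr {ω | L < Z z ω} ≤ ENNReal.ofReal (Real.exp (-L)) := by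
    intro z _
    have hV : Measurable (V z) := measurable_netValue hφ _ _ _ _
    exact measure_ge_le_exp_neg (measurable_selfNormalizedExponent hφ hsel hrun.action hk.le hh
      (fun l hl i hi => hrun.measurable_state l (hl.trans hk) i hi) _ hV)
      (lintegral_exp_selfNormalizedExponent_le hφ hsel hrun hτ hk.le hh _ hV
        (netValue_mem H β _ _)) L
  refine (measure_mono hsub).trans ((measure_biUnion_finset_le _ _).trans
    ((Finset.sum_le_sum hZ).trans (le_of_eq ?_)))
  rw [Finset.sum_const, hcard, nsmul_eq_mul, ENNReal.ofReal_mul (by positivity)]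
  congr 1
  rw [← ENNReal.ofReal_natCast]
  push_cast
  rfl

theorem measure_gap_le (hφ : ∀ a, Measurable fun s => φ s a) (hsel : IsArgmaxRule sel)
    (hrun : IsRun Pr M φ β N sel s u) (η L : ℝ) (j : ℕ) :
    Pr {ω | L < ∑ l ∈ epoch N K j, ∑ i ∈ Finset.range (H - 1),
      gapExponent M φ β N sel η (fun l i => s l i ω) (fun l i => u l i ω) l i} ≤
      ENNReal.ofReal (Real.exp (-L)) := by
  refine measure_ge_le_exp_neg (Finset.measurable_sum _ fun l hl => Finset.measurable_sum _
    fun i hi => ?_) ?_ L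
  · have hlK := lt_of_mem_epoch hl
    have hi' := Finset.mem_range.1 hi
    exact measurable_gapExponent hφ hsel hrun.action η hlK (by omega)
      (fun l' hl' i hi => hrun.measurable_state l' (hl'.trans hlK) i hi)
      (hrun.measurable_state l hlK i (by omega)) (hrun.measurable_state l hlK (i + 1) (by omega))
  · rcases le_total (j * N) (min ((j + 1) * N) K) with hle | hle
    · exact lintegral_exp_gapExponent_le hφ hsel hrun η hle (min_le_right _ _)
    · simp [epoch, Finset.Ico_eq_empty_of_le hle]

/-- The event on which the regret of an epoch is controlled fails with small probability. -/
theorem measure_bad_le (hφ : ∀ a, Measurable fun s => φ s a) (hsel : IsArgmaxRule sel)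
    (hrun : IsRun Pr M φ β N sel s u) (m n : ℕ) (L L' η : ℝ) (j : ℕ) :
    Pr {ω | ¬ ((∀ k ∈ epoch N K j, ∀ h, h + 1 < H → GridBound M φ β m n L
        (fun l i => s l i ω) (fun l i => u l i ω) (j * N) k h) ∧
      ∑ l ∈ epoch N K j, ∑ i ∈ Finset.range (H - 1),
        gapExponent M φ β N sel η (fun l i => s l i ω) (fun l i => u l i ω) l i ≤ L')} ≤
      ENNReal.ofReal (N * (H * ((2 * n + 1) ^ (d + (d + d * d)) * Real.exp (-L))) +
        Real.exp (-L')) := by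
  have hsub : {ω | ¬ ((∀ k ∈ epoch N K j, ∀ h, h + 1 < H → GridBound M φ β m n L
        (fun l i => s l i ω) (fun l i => u l i ω) (j * N) k h) ∧
      ∑ l ∈ epoch N K j, ∑ i ∈ Finset.range (H - 1),
        gapExponent M φ β N sel η (fun l i => s l i ω) (fun l i => u l i ω) l i ≤ L')} ⊆
      (⋃ k ∈ epoch N K j, ⋃ h ∈ Finset.range (H - 1), {ω | ¬ GridBound M φ β m n L
        (fun l i => s l i ω) (fun l i => u l i ω) (j * N) k h}) ∪
      {ω | L' < ∑ l ∈ epoch N K j, ∑ i ∈ Finset.range (H - 1),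
        gapExponent M φ β N sel η (fun l i => s l i ω) (fun l i => u l i ω) l i} := by
    intro ω hω
    rw [Set.mem_ofPred_eq, not_and_or] at hω
    rcases hω with hω | hω
    · left
      simp only [not_forall] at hω
      obtain ⟨k, hk, h, hh, hb⟩ := hω
      exact Set.mem_biUnion hk (Set.mem_biUnion (Finset.mem_coe.2
        (Finset.mem_range.2 (by omega))) hb)
    · right
      exact not_le.1 hω
  set q : ℝ := (2 * n + 1) ^ (d + (d + d * d)) * Real.exp (-L) with hq
  have hq0 : 0 ≤ q := by positivity
  have hgrid : Pr (⋃ k ∈ epoch N K j, ⋃ h ∈ Finset.range (H - 1), {ω | ¬ GridBound M φ β m n L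
        (fun l i => s l i ω) (fun l i => u l i ω) (j * N) k h}) ≤
      ENNReal.ofReal (N * (H * q)) := by
    have hinner : ∀ k ∈ epoch N K j, Pr (⋃ h ∈ Finset.range (H - 1), {ω | ¬ GridBound M φ β m n L
        (fun l i => s l i ω) (fun l i => u l i ω) (j * N) k h}) ≤ ENNReal.ofReal (H * q) := by
      intro k hk
      refine (measure_biUnion_finset_le _ _).trans ((Finset.sum_le_sum fun h hh =>
        measure_not_gridBound_le hφ hsel hrun m n L (Finset.mem_Ico.1 hk).1 (lt_of_mem_epoch hk)
          (by have := Finset.mem_range.1 hh; omega)).trans ?_)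
      rw [Finset.sum_const, nsmul_eq_mul, Finset.card_range, ← ENNReal.ofReal_natCast,
        ← ENNReal.ofReal_mul (Nat.cast_nonneg _)]
      refine ENNReal.ofReal_le_ofReal (mul_le_mul_of_nonneg_right ?_ hq0)
      exact_mod_cast Nat.sub_le H 1
    refine (measure_biUnion_finset_le _ _).trans ((Finset.sum_le_sum hinner).trans ?_)
    rw [Finset.sum_const, nsmul_eq_mul, ← ENNReal.ofReal_natCast,
      ← ENNReal.ofReal_mul (Nat.cast_nonneg _)]
    refine ENNReal.ofReal_le_ofReal (mul_le_mul_of_nonneg_right ?_ (by positivity))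
    exact_mod_cast card_epoch_le N K j
  refine (measure_mono hsub).trans ((measure_union_le _ _).trans ?_)
  rw [ENNReal.ofReal_add (by positivity) (Real.exp_pos _).le]
  exact add_le_add hgrid (measure_gap_le hφ hsel hrun η L' j)

end GoodEvent

/-! ### Choice of the mesh. -/

section Parameters

/-- The denominator of the grid. -/
noncomputable def gridDenom (d W : ℕ) (β : ℝ) : ℕ := ⌈4 * (d : ℝ) ^ 2 * (W : ℝ) ^ 2 * (1 + β ^ 2)⌉₊

variable {d W : ℕ} {β : ℝ}

theorem le_gridDenom (d W : ℕ) (β : ℝ) :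
    4 * (d : ℝ) ^ 2 * (W : ℝ) ^ 2 * (1 + β ^ 2) ≤ gridDenom d W β :=
  Nat.le_ceil _

theorem one_le_sq_mul_sq (hd : 0 < d) (hW : 0 < W) : 1 ≤ (d : ℝ) ^ 2 * (W : ℝ) ^ 2 := by
  have hd' : (1 : ℝ) ≤ d := by exact_mod_cast hd
  have hW' : (1 : ℝ) ≤ W := by exact_mod_cast hW
  exact one_le_mul_of_one_le_of_one_le (one_le_pow₀ hd') (one_le_pow₀ hW')

theorem gridDenom_le (hd : 0 < d) (hW : 0 < W) :
    (gridDenom d W β : ℝ) ≤ 5 * (d : ℝ) ^ 2 * (W : ℝ) ^ 2 * (1 + β ^ 2) := by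
  have h1 := Nat.ceil_lt_add_one
    (show 0 ≤ 4 * (d : ℝ) ^ 2 * (W : ℝ) ^ 2 * (1 + β ^ 2) by positivity)
  have h2 := one_le_sq_mul_sq hd hW
  have h3 : (1 : ℝ) ≤ (d : ℝ) ^ 2 * (W : ℝ) ^ 2 * (1 + β ^ 2) := by nlinarith [sq_nonneg β]
  rw [gridDenom]
  linarith

theorem four_mul_le_gridDenom (hd : 0 < d) (hW : 0 < W) (β : ℝ) :
    4 * ((d : ℝ) * W) ≤ gridDenom d W β := by
  have hd' : (1 : ℝ) ≤ d := by exact_mod_cast hd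
  have hW' : (1 : ℝ) ≤ W := by exact_mod_cast hW
  have h1 : (1 : ℝ) ≤ d * W := one_le_mul_of_one_le_of_one_le hd' hW'
  refine le_trans ?_ (le_gridDenom d W β)
  nlinarith [mul_nonneg (sq_nonneg ((d : ℝ) * W)) (sq_nonneg β)]

theorem gridDenom_pos (hd : 0 < d) (hW : 0 < W) (β : ℝ) : 0 < gridDenom d W β := by
  have h1 := four_mul_le_gridDenom hd hW β
  have hd' : (0 : ℝ) < d := by exact_mod_cast hd
  have hW' : (0 : ℝ) < W := by exact_mod_cast hW
  have : (0 : ℝ) < gridDenom d W β := lt_of_lt_of_le (by positivity) h1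
  exact_mod_cast this

theorem gridDenom_sq_ge {H N : ℕ} (hd : 0 < d) (hH : 0 < H) (hN : 0 < N) (β : ℝ) :
    (H : ℝ) ^ 2 * (1 + N) * d ≤ 8 * (gridDenom d (H * N) β : ℝ) ^ 2 := by
  have hd' : (1 : ℝ) ≤ d := by exact_mod_cast hd
  have hH' : (1 : ℝ) ≤ H := by exact_mod_cast hH
  have hN' : (1 : ℝ) ≤ N := by exact_mod_cast hN
  have h1 := four_mul_le_gridDenom hd (Nat.mul_pos hH hN) β
  push_cast at h1
  have h2 : (4 * ((d : ℝ) * (H * N))) ^ 2 ≤ (gridDenom d (H * N) β : ℝ) ^ 2 :=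
    pow_le_pow_left₀ (by positivity) h1 2
  have h3 : (1 : ℝ) + N ≤ 2 * N ^ 2 := by nlinarith
  have h4 : (d : ℝ) ≤ d ^ 2 := by nlinarith
  calc (H : ℝ) ^ 2 * (1 + N) * d ≤ (H : ℝ) ^ 2 * (2 * N ^ 2) * d ^ 2 := by gcongr
    _ ≤ (4 * ((d : ℝ) * (H * N))) ^ 2 := by nlinarith [sq_nonneg ((H : ℝ) * N * d)]
    _ ≤ _ := by linarith [sq_nonneg (gridDenom d (H * N) β : ℝ)]

/-- The denominator is at least `4 d² (HN)² (1 + β²)`, which makes the linear error at most `1 /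
(4N)` and the root error at most `1 / (2N)`; the crude `√N ≤ N` then suffices. -/
theorem grid_error_le {H N : ℕ} (hd : 0 < d) (hH : 0 < H) (hN : 0 < N) (hβ : 0 ≤ β) :
    √N * (2 * (d * (1 / (gridDenom d (H * N) β : ℝ)) +
      β * √((d : ℝ) ^ 2 * (1 / gridDenom d (H * N) β)))) ≤ 2 := by
  have hd' : (1 : ℝ) ≤ d := by exact_mod_cast hd
  have hH' : (1 : ℝ) ≤ H := by exact_mod_cast hH
  have hN' : (1 : ℝ) ≤ N := by exact_mod_cast hN
  have hW := Nat.mul_pos hH hN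
  set m : ℝ := (gridDenom d (H * N) β : ℝ) with hm
  have hm0 : 0 < m := Nat.cast_pos.2 (gridDenom_pos hd hW β)
  have h1 := four_mul_le_gridDenom hd hW β
  have h2 := le_gridDenom d (H * N) β
  rw [← hm] at h1 h2
  push_cast at h1 h2
  have hNH : (N : ℝ) ≤ H * N := le_mul_of_one_le_left (by positivity) hH'
  have hsN : √(N : ℝ) ≤ N := Real.sqrt_le_self_iff.2 (Or.inr hN')
  have h3 : d * (1 / m) ≤ 1 / (4 * N) := by
    rw [mul_one_div, div_le_div_iff₀ hm0 (by positivity)]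
    nlinarith
  have h4 : β * √((d : ℝ) ^ 2 * (1 / m)) ≤ 1 / (2 * N) := by
    rw [← abs_of_nonneg hβ, ← Real.sqrt_sq_eq_abs, ← Real.sqrt_mul (sq_nonneg β)]
    apply Real.sqrt_le_iff.2
    refine ⟨by positivity, ?_⟩
    rw [mul_one_div, ← mul_div_assoc, div_pow, div_le_div_iff₀ hm0 (by positivity)]
    have h5 : (N : ℝ) ^ 2 ≤ (H * N) ^ 2 := pow_le_pow_left₀ (by positivity) hNH 2
    have h6 : β ^ 2 * (d : ℝ) ^ 2 * N ^ 2 ≤ (d : ℝ) ^ 2 * (H * N) ^ 2 * (1 + β ^ 2) := by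
      calc β ^ 2 * (d : ℝ) ^ 2 * N ^ 2 ≤ (1 + β ^ 2) * (d : ℝ) ^ 2 * (H * N) ^ 2 := by
            gcongr; linarith
        _ = _ := by ring
    nlinarith
  have h7 : √(N : ℝ) * (2 * (d * (1 / m) + β * √((d : ℝ) ^ 2 * (1 / m)))) ≤
      N * (2 * (1 / (4 * N) + 1 / (2 * N))) := by gcongr
  refine h7.trans ?_
  have : (N : ℝ) * (2 * (1 / (4 * N) + 1 / (2 * N))) = 3 / 2 := by field_simp; norm_num
  rw [this]
  norm_num

end Parameters

/-! ### Logarithmic size of the grid. -/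

section LogBounds

variable {c : ℝ} {d H N : ℕ} {p : ℝ}

theorem two_mul_le_logArg (hd : 0 < d) (hH : 0 < H) (hN : 0 < N) (hp : 0 < p) (hp1 : p < 1) :
    2 * ((d : ℝ) * (H * N)) ≤ 2 * d * (H * N : ℕ) / p := by
  rw [le_div_iff₀ hp]
  push_cast
  have : 0 ≤ 2 * ((d : ℝ) * (H * N)) := by positivity
  nlinarith

theorem log_ge (hd : 0 < d) (hH : 0 < H) (hN : 0 < N) (hp : 0 < p) (hp1 : p < 1) :
    (69 : ℝ) / 100 ≤ Real.log (2 * d * (H * N : ℕ) / p) := by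
  have hd' : (1 : ℝ) ≤ d := by exact_mod_cast hd
  have hHN : (1 : ℝ) ≤ H * N := by exact_mod_cast Nat.mul_pos hH hN
  have h1 : (2 : ℝ) ≤ 2 * d * (H * N : ℕ) / p := by
    refine le_trans ?_ (two_mul_le_logArg hd hH hN hp hp1)
    nlinarith
  have h2 := Real.log_le_log (by norm_num) h1
  linarith [Real.log_two_gt_d9]

/-- The logarithm of the size of the grid. -/
theorem log_grid_le (hc : 20 ≤ c) (hd : 0 < d) (hH : 0 < H) (hN : 0 < N) (hp : 0 < p)
    (hp1 : p < 1) {β : ℝ} (hβ : β = c * d * H * √(Real.log (2 * d * (H * N : ℕ) / p))) :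
    Real.log (2 * (5 * (H * N) * gridDenom d (H * N) β : ℕ) + 1) ≤
      (14 + 3 * c) * Real.log (2 * d * (H * N : ℕ) / p) := by
  have hd' : (1 : ℝ) ≤ d := by exact_mod_cast hd
  have hH' : (1 : ℝ) ≤ H := by exact_mod_cast hH
  have hN' : (1 : ℝ) ≤ N := by exact_mod_cast hN
  have hW := Nat.mul_pos hH hN
  have hyd := two_mul_le_logArg hd hH hN hp hp1
  have hι := log_ge hd hH hN hp hp1
  set y : ℝ := 2 * d * (H * N : ℕ) / p with hy
  set ι := Real.log y with hιdef
  have hHN : (1 : ℝ) ≤ H * N := one_le_mul_of_one_le_of_one_le hH' hN'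
  have hdW : (1 : ℝ) ≤ d * (H * N) := one_le_mul_of_one_le_of_one_le hd' hHN
  have hy0 : 0 < y := by linarith
  have hy1 : 1 ≤ y := by linarith
  have hιy : ι ≤ y := (Real.log_le_sub_one_of_pos hy0).trans (by linarith)
  set m : ℝ := (gridDenom d (H * N) β : ℝ) with hm
  have hm1 : m ≤ 5 * (d : ℝ) ^ 2 * (H * N) ^ 2 * (1 + β ^ 2) := by
    have := gridDenom_le (β := β) hd hW
    push_cast at this
    exact this
  have hm0 : 1 ≤ m := Nat.one_le_cast.2 (gridDenom_pos hd hW β)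
  -- The mesh depends on `β`, but `β` is polynomial in the argument `y` of the logarithm, so the
  -- grid has polynomial size per coordinate.
  have hβ2 : 1 + β ^ 2 ≤ 2 * c ^ 2 * y ^ 3 := by
    have h1 : β ^ 2 = c ^ 2 * ((d : ℝ) * H) ^ 2 * ι := by
      rw [hβ, mul_pow, Real.sq_sqrt (by linarith)]
      ring
    have h2 : (d : ℝ) * H ≤ y := by nlinarith
    have h3 : c ^ 2 * ((d : ℝ) * H) ^ 2 * ι ≤ c ^ 2 * y ^ 2 * y := by gcongr
    have h4 : 1 ≤ c ^ 2 * y ^ 3 :=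
      one_le_mul_of_one_le_of_one_le (one_le_pow₀ (by linarith)) (one_le_pow₀ hy1)
    rw [h1]
    nlinarith
  have hbig : 2 * ((5 * (H * N) * gridDenom d (H * N) β : ℕ) : ℝ) + 1 ≤ 110 * c ^ 2 * y ^ 6 := by
    push_cast
    rw [← hm]
    have h1 : (1 : ℝ) ≤ (H * N) * m := one_le_mul_of_one_le_of_one_le hHN hm0
    have h2 : (H * N : ℝ) ≤ (d * (H * N)) ^ 1 := by
      rw [pow_one]
      exact le_mul_of_one_le_left (by positivity) hd'
    have h3 : (H * N : ℝ) * m ≤ (d * (H * N)) ^ 1 * (5 * (d * (H * N)) ^ 2 * (2 * c ^ 2 * y ^ 3)) := by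
      refine mul_le_mul h2 (hm1.trans ?_) (by positivity) (by positivity)
      rw [mul_pow (d : ℝ) (H * N) 2, ← mul_assoc 5]
      exact mul_le_mul_of_nonneg_left hβ2 (by positivity)
    have h4 : ((d : ℝ) * (H * N)) ^ 3 ≤ y ^ 3 :=
      pow_le_pow_left₀ (by positivity) (by linarith) 3
    have h5 : (d * (H * N) : ℝ) ^ 1 * (5 * (d * (H * N)) ^ 2 * (2 * c ^ 2 * y ^ 3)) ≤
        10 * c ^ 2 * y ^ 6 := by
      calc _ = ((d : ℝ) * (H * N)) ^ 3 * (10 * c ^ 2 * y ^ 3) := by ring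
        _ ≤ y ^ 3 * (10 * c ^ 2 * y ^ 3) := mul_le_mul_of_nonneg_right h4 (by positivity)
        _ = _ := by ring
    nlinarith
  have hlog := Real.log_le_log (by positivity) hbig
  have hc0 : 0 < c := by linarith
  rw [Real.log_mul (by positivity) (by positivity), Real.log_mul (by norm_num) (by positivity),
    Real.log_pow, Real.log_pow, ← hιdef] at hlog
  have h110 : Real.log 110 ≤ 5 := by
    rw [Real.log_le_iff_le_exp (by norm_num)]
    have h1 := Real.exp_one_gt_d9
    calc (110 : ℝ) ≤ (2.7182818283) ^ 5 := by norm_num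
      _ ≤ (Real.exp 1) ^ 5 := pow_le_pow_left₀ (by norm_num) h1.le 5
      _ = Real.exp 5 := by rw [← Real.exp_nat_mul]; norm_num
  have hlc : Real.log c ≤ c := (Real.log_le_sub_one_of_pos hc0).trans (by linarith)
  push_cast at hlog ⊢
  nlinarith

end LogBounds

/-! ### Numerical constants. -/

section Constants

variable {c : ℝ} {d H N : ℕ} {p : ℝ}

/-- The confidence level of the regression noise. -/
noncomputable def noiseLevel (d W n : ℕ) (p : ℝ) : ℝ :=
  Real.log (2 * W / p) + (d + (d + d * d) : ℕ) * Real.log (2 * n + 1)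

theorem noiseLevel_nonneg {W : ℕ} (hW : 0 < W) (hp : 0 < p) (hp1 : p < 1) (n : ℕ) :
    0 ≤ noiseLevel d W n p := by
  have hW' : (1 : ℝ) ≤ W := by exact_mod_cast hW
  refine add_nonneg (Real.log_nonneg ?_) (mul_nonneg (Nat.cast_nonneg _) (Real.log_nonneg ?_))
  · rw [le_div_iff₀ hp]
    linarith
  · have : (0 : ℝ) ≤ n := Nat.cast_nonneg n
    linarith

theorem exp_neg_noiseLevel {W : ℕ} (hW : 0 < W) (hp : 0 < p) (n : ℕ) :
    W * ((2 * n + 1) ^ (d + (d + d * d)) * Real.exp (-noiseLevel d W n p)) = p / 2 := by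
  have hW' : (0 : ℝ) < W := by exact_mod_cast hW
  have hn : (0 : ℝ) < 2 * n + 1 := by positivity
  rw [noiseLevel, ← Real.log_pow, ← Real.log_mul (by positivity) (by positivity), Real.exp_neg,
    Real.exp_log (by positivity)]
  field_simp

/-- The bonus parameter dominates the regression error. -/
theorem bonus_parameter_ge (hc : 20 ≤ c) (hd : 0 < d) (hH : 0 < H) (hN : 0 < N) (hp : 0 < p)
    (hp1 : p < 1) {β : ℝ} (hβ : β = c * d * H * √(Real.log (2 * d * (H * N : ℕ) / p))) :
    3 + √((H : ℝ) ^ 2 / 2 *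
      (noiseLevel d (H * N) (5 * (H * N) * gridDenom d (H * N) β) p + 1)) + 2 * H * √d ≤ β := by
  have hd' : (1 : ℝ) ≤ d := by exact_mod_cast hd
  have hH' : (1 : ℝ) ≤ H := by exact_mod_cast hH
  have hHN : (1 : ℝ) ≤ H * N := by exact_mod_cast Nat.mul_pos hH hN
  have hlg := log_grid_le hc hd hH hN hp hp1 hβ
  have hι := log_ge hd hH hN hp hp1
  have hW0 : (0 : ℝ) < (H * N : ℕ) := by exact_mod_cast Nat.mul_pos hH hN
  have hlog1 : Real.log (2 * (H * N : ℕ) / p) ≤ Real.log (2 * d * (H * N : ℕ) / p) := by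
    refine Real.log_le_log (by positivity) ?_
    gcongr
    linarith
  set ι := Real.log (2 * d * (H * N : ℕ) / p) with hιdef
  have hd2 : (1 : ℝ) ≤ (d : ℝ) ^ 2 := one_le_pow₀ hd'
  -- At most `3 d²` coordinates, each costing `(14 + 3c) ι`; the remaining `3 ι` covers the
  -- confidence term and the `1`, since `ι ≥ 69 / 100`.
  have hL : noiseLevel d (H * N) (5 * (H * N) * gridDenom d (H * N) β) p + 1 ≤
      (d : ℝ) ^ 2 * ι * (45 + 9 * c) := by
    rw [noiseLevel]
    have h1 : ((d + (d + d * d) : ℕ) : ℝ) ≤ 3 * (d : ℝ) ^ 2 := by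
      push_cast
      nlinarith
    have h2 : ((d + (d + d * d) : ℕ) : ℝ) *
        Real.log (2 * (5 * (H * N) * gridDenom d (H * N) β : ℕ) + 1) ≤
        3 * (d : ℝ) ^ 2 * ((14 + 3 * c) * ι) :=
      mul_le_mul h1 hlg (Real.log_nonneg (by
        have : (0 : ℝ) ≤ (5 * (H * N) * gridDenom d (H * N) β : ℕ) := Nat.cast_nonneg _
        linarith)) (by positivity)
    nlinarith
  have hs0 : 0 ≤ √ι := Real.sqrt_nonneg _
  have hsι : √ι ^ 2 = ι := Real.sq_sqrt (by linarith)
  have hs : (5 : ℝ) / 7 ≤ √ι := Real.le_sqrt_of_sq_le (by norm_num; linarith)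
  have hsq : √((H : ℝ) ^ 2 / 2 *
      (noiseLevel d (H * N) (5 * (H * N) * gridDenom d (H * N) β) p + 1)) ≤
      d * H * √ι * (c - 7) := by
    rw [Real.sqrt_le_iff]
    refine ⟨mul_nonneg (by positivity) (by linarith), ?_⟩
    have h1 : (d * H * √ι * (c - 7)) ^ 2 = (H : ℝ) ^ 2 * ((d : ℝ) ^ 2 * ι) * (c - 7) ^ 2 := by
      rw [mul_pow, mul_pow, mul_pow, hsι]
      ring
    rw [h1]
    -- The circle closes here: the noise grows like `√c` while the bonus grows like `c`. The
    -- reserved 7 pays for bias and regularization.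
    have h2 : (45 + 9 * c) / 2 ≤ (c - 7) ^ 2 := by nlinarith
    calc _ ≤ (H : ℝ) ^ 2 / 2 * ((d : ℝ) ^ 2 * ι * (45 + 9 * c)) := by gcongr
      _ = (H : ℝ) ^ 2 * ((d : ℝ) ^ 2 * ι) * ((45 + 9 * c) / 2) := by ring
      _ ≤ _ := mul_le_mul_of_nonneg_left h2
        (mul_nonneg (sq_nonneg _) (mul_nonneg (sq_nonneg _) (by linarith)))
  have hdH : (1 : ℝ) ≤ d * H := one_le_mul_of_one_le_of_one_le hd' hH'
  have hsd : √(d : ℝ) ≤ d := Real.sqrt_le_self_iff.2 (Or.inr hd')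
  have h5 : 3 + 2 * H * √d ≤ 5 * (d * H : ℝ) := by nlinarith
  have h6 : 5 * (d * H : ℝ) ≤ d * H * √ι * 7 := by nlinarith
  have h7 : c * d * H * √ι = d * H * √ι * (c - 7) + d * H * √ι * 7 := by ring
  linarith

/-- The bonuses contribute `2√2 c ≤ 3c` times the leading term. The chosen `η` balances the
confidence term against the accumulated variance up to constants, which contributes the remaining 2.
-/
theorem regret_main_le (hc : 20 ≤ c) (hd : 0 < d) (hH : 0 < H) (hN : 0 < N) (hp : 0 < p)
    (hp1 : p < 1) {β ι η : ℝ} (hι : ι = Real.log (2 * d * (H * N : ℕ) / p))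
    (hβ : β = c * d * H * √ι) (hη : η = √ι / (H * √(H * N))) :
    2 * β * (H * √(N * (2 * (d * Real.log (d + N))))) +
        (Real.log (2 / p) / η + η * (H : ℝ) ^ 2 / 2 * (N * H)) ≤
      (3 * c + 2) * (√((d : ℝ) ^ 3 * (H : ℝ) ^ 3 * (H * N : ℕ)) * ι) := by
  have hd' : (1 : ℝ) ≤ d := by exact_mod_cast hd
  have hH' : (1 : ℝ) ≤ H := by exact_mod_cast hH
  have hN' : (1 : ℝ) ≤ N := by exact_mod_cast hN
  have hHN : (1 : ℝ) ≤ H * N := one_le_mul_of_one_le_of_one_le hH' hN'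
  have hdW : (1 : ℝ) ≤ d * (H * N) := one_le_mul_of_one_le_of_one_le hd' hHN
  have hι1 : 69 / 100 ≤ ι := by rw [hι]; exact log_ge hd hH hN hp hp1
  have hyd := two_mul_le_logArg hd hH hN hp hp1
  have hlogdN : Real.log (d + N) ≤ ι := by
    rw [hι]
    refine Real.log_le_log (by positivity) (le_trans ?_ hyd)
    nlinarith [mul_nonneg (sub_nonneg.2 hd') (sub_nonneg.2 hN'),
      mul_nonneg (mul_nonneg (by linarith : (0 : ℝ) ≤ d) (by linarith : (0 : ℝ) ≤ N))
        (sub_nonneg.2 hH')]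
  have hlog2 : Real.log (2 / p) ≤ ι := by
    rw [hι]
    refine Real.log_le_log (by positivity) ?_
    gcongr
    push_cast
    linarith
  have hι0 : 0 < ι := by linarith
  set σ := √ι with hσ
  have hσ2 : σ ^ 2 = ι := Real.sq_sqrt hι0.le
  have hσ0 : 0 < σ := Real.sqrt_pos.2 hι0
  have hσ1 : 4 / 5 ≤ σ := Real.le_sqrt_of_sq_le (by norm_num; linarith)
  set R := √((H : ℝ) * N) with hR
  have hR0 : 0 < R := Real.sqrt_pos.2 (by linarith)
  have hR2 : R ^ 2 = H * N := Real.sq_sqrt (by linarith)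
  set D := √((d : ℝ) ^ 3 * (H : ℝ) ^ 3 * (H * N : ℕ)) with hD
  have hD2 : D ^ 2 = (d : ℝ) ^ 3 * (H : ℝ) ^ 3 * (H * N) := by
    rw [hD, Real.sq_sqrt (by positivity)]
    push_cast
    ring
  have hD0 : 0 ≤ D := Real.sqrt_nonneg _
  have hHR : H * R ≤ D := by
    refine abs_le_of_sq_le_sq' ?_ hD0 |>.2
    rw [hD2, mul_pow, hR2]
    have h1 : (H : ℝ) ^ 2 ≤ (d : ℝ) ^ 3 * (H : ℝ) ^ 3 := by
      calc (H : ℝ) ^ 2 ≤ (H : ℝ) ^ 3 := pow_le_pow_right₀ hH' (by norm_num)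
        _ ≤ _ := le_mul_of_one_le_left (by positivity) (one_le_pow₀ hd')
    exact mul_le_mul_of_nonneg_right h1 (by linarith)
  have hfirst : 2 * β * (H * √(N * (2 * (d * Real.log (d + N))))) ≤ 3 * c * (D * ι) := by
    have h1 : d * H * (H * √(N * (2 * (d * Real.log (d + N))))) ≤ 3 / 2 * (D * σ) := by
      have h2 : √(N * (2 * (d * Real.log (d + N)))) ≤ √(N * (2 * (d * ι))) := by
        apply Real.sqrt_le_sqrt
        gcongr
      have h3 : √((N : ℝ) * (2 * (d * ι))) ^ 2 = N * (2 * (d * ι)) :=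
        Real.sq_sqrt (by positivity)
      refine (show _ ≤ d * H * (H * √((N : ℝ) * (2 * (d * ι)))) by gcongr).trans ?_
      refine abs_le_of_sq_le_sq' ?_ (by positivity) |>.2
      have h4 : (d * H * (H * √((N : ℝ) * (2 * (d * ι))))) ^ 2 = 2 * (D ^ 2 * ι) := by
        rw [mul_pow, mul_pow _ √_, h3, hD2]
        ring
      have h5 : (3 / 2 * (D * σ)) ^ 2 = 9 / 4 * (D ^ 2 * ι) := by
        rw [← hσ2]
        ring
      rw [h4, h5]
      have : 0 ≤ D ^ 2 * ι := by positivity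
      linarith
    have h6 : 2 * β * (H * √(N * (2 * (d * Real.log (d + N))))) =
        2 * c * σ * (d * H * (H * √(N * (2 * (d * Real.log (d + N)))))) := by
      rw [hβ]
      ring
    rw [h6]
    calc _ ≤ 2 * c * σ * (3 / 2 * (D * σ)) := by
          refine mul_le_mul_of_nonneg_left h1 ?_
          have : 0 ≤ c := by linarith
          positivity
      _ = 3 * c * (D * σ ^ 2) := by ring
      _ = _ := by rw [hσ2]
  have hsecond : Real.log (2 / p) / η + η * (H : ℝ) ^ 2 / 2 * (N * H) ≤ 2 * (D * ι) := by
    have h1 : Real.log (2 / p) / η ≤ H * R * σ := by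
      rw [hη, div_div_eq_mul_div, div_le_iff₀ hσ0]
      calc Real.log (2 / p) * (H * R) ≤ ι * (H * R) := by gcongr
        _ = H * R * σ * σ := by rw [← hσ2]; ring
    have h2 : η * (H : ℝ) ^ 2 / 2 * (N * H) = H * R * σ / 2 := by
      rw [mul_comm (N : ℝ) H, ← hR2, hη]
      field_simp
    have h3 : H * R * σ ≤ D * (5 / 4 * ι) := by
      refine mul_le_mul hHR ?_ hσ0.le hD0
      rw [← hσ2]
      nlinarith
    have h4 : 0 ≤ D * ι := by positivity
    rw [h2]
    linarith
  linarith

/-- Multiply `N * H` by the quantity exceeding 1: since `W = H * N`, the factors `√(d/H) √W` and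
`√(d H) √W` are at least `√N` and `H √N`. -/
theorem steps_le_variation_terms {Bθ Bμ : ℝ} (hBθ : 0 ≤ Bθ) (hBμ : 0 ≤ Bμ) (hd : 0 < d)
    (hH : 0 < H) (h : 1 < √N * (Bθ + H * Bμ)) :
    (N * H : ℝ) ≤ Bθ * √((d : ℝ) / H) * ((H * N : ℕ) : ℝ) ^ (3 / 2 : ℝ) +
      Bμ * √((d : ℝ) * H) * ((H * N : ℕ) : ℝ) ^ (3 / 2 : ℝ) := by
  have hd' : (1 : ℝ) ≤ d := by exact_mod_cast hd
  have hH' : (1 : ℝ) ≤ H := by exact_mod_cast hH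
  have hN0 : (0 : ℝ) ≤ N := Nat.cast_nonneg N
  have hpow : ((H * N : ℕ) : ℝ) ^ (3 / 2 : ℝ) = (N * H) * √(H * N) := by
    rw [show (3 / 2 : ℝ) = 1 + 1 / 2 by norm_num,
      Real.rpow_add_of_nonneg (Nat.cast_nonneg _) (by norm_num) (by norm_num), Real.rpow_one,
      ← Real.sqrt_eq_rpow]
    push_cast
    ring
  have h1 : √(N : ℝ) ≤ √((d : ℝ) / H) * √(H * N) := by
    rw [← Real.sqrt_mul (by positivity)]
    apply Real.sqrt_le_sqrt
    rw [show (d : ℝ) / H * (H * N) = d * N by field_simp]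
    exact le_mul_of_one_le_left hN0 hd'
  have h2 : H * √(N : ℝ) ≤ √((d : ℝ) * H) * √(H * N) := by
    rw [← Real.sqrt_mul (by positivity)]
    apply Real.le_sqrt_of_sq_le
    rw [mul_pow, Real.sq_sqrt hN0]
    have : 0 ≤ (H : ℝ) ^ 2 * N := by positivity
    nlinarith
  rw [hpow]
  have h3 : √N * (Bθ + H * Bμ) ≤
      Bθ * (√((d : ℝ) / H) * √(H * N)) + Bμ * (√((d : ℝ) * H) * √(H * N)) := by
    have h4 := mul_le_mul_of_nonneg_left h1 hBθ
    have h5 := mul_le_mul_of_nonneg_left h2 hBμ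
    linarith
  have h6 : (N * H : ℝ) * 1 ≤ (N * H) *
      (Bθ * (√((d : ℝ) / H) * √(H * N)) + Bμ * (√((d : ℝ) * H) * √(H * N))) :=
    mul_le_mul_of_nonneg_left (h.le.trans h3) (by positivity)
  linarith

end Constants

end NonstatRL

/-! ### The main theorem: dichotomy on the variation. -/

theorem mainTheorem7 :
    ∃ c₀ : ℝ, 0 < c₀ ∧ ∀ c : ℝ, c₀ ≤ c → ∃ C : ℝ, 0 < C ∧
      ∀ (S A Ω : Type*) [MeasurableSpace S] [MeasurableSpace A] [Finite A] [Nonempty A]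
        [MeasurableSingletonClass A] [MeasurableSpace Ω] (Pr : Measure Ω) [IsProbabilityMeasure Pr]
        (H K W d j : ℕ) (p β : ℝ)
        (M : EpisodicMDP S A H K) (φ : S → A → EuclideanSpace ℝ (Fin d))
        (μ : ℕ → ℕ → VectorMeasure S (EuclideanSpace ℝ (Fin d)))
        (θ : ℕ → ℕ → EuclideanSpace ℝ (Fin d))
        (sel : (A → ℝ) → A) (s : ℕ → ℕ → Ω → S) (u : ℕ → ℕ → Ω → A),
        0 < W → H ∣ W → 0 < d → 0 < p → p < 1 →
        β = c * d * H * √(Real.log (2 * d * W / p)) →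
        IsLinearMDP M φ μ θ → IsArgmaxRule sel → IsRun Pr M φ β (W / H) sel s u →
        ENNReal.ofReal (1 - p) ≤ Pr {ω |
          epochRegret M φ β (W / H) sel (fun l i => s l i ω) (fun l i => u l i ω) j ≤
            C * (√((d : ℝ) ^ 3 * (H : ℝ) ^ 3 * W) * Real.log (2 * d * W / p)
              + rewardVariation θ H (W / H) K j * √((d : ℝ) / H) * (W : ℝ) ^ (3 / 2 : ℝ)
              + transitionVariation μ H (W / H) K j * √((d : ℝ) * H) * (W : ℝ) ^ (3 / 2 : ℝ))} := by
  refine ⟨20, by norm_num, fun c hc => ⟨3 * c + 2, by linarith, ?_⟩⟩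
  intro S A Ω _ _ _ _ _ _ Pr _ H K W d j p β M φ μ θ sel s u hW hHW hd hp hp1 hβ hlin hsel hrun
  obtain ⟨N, rfl⟩ := hHW
  have hH : 0 < H := Nat.pos_of_mul_pos_right hW
  have hN : 0 < N := Nat.pos_of_mul_pos_left hW
  rw [Nat.mul_div_cancel_left N hH] at hrun ⊢
  have hφ := hlin.measurable_feature
  have hι := log_ge hd hH hN hp hp1
  set ι := Real.log (2 * d * (H * N : ℕ) / p) with hιdef
  set D := √((d : ℝ) ^ 3 * (H : ℝ) ^ 3 * (H * N : ℕ)) with hD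
  set Bθ := rewardVariation θ H N K j with hBθ
  set Bμ := transitionVariation μ H N K j with hBμ
  have hBθ0 : 0 ≤ Bθ := rewardVariation_nonneg _ _ _ _ _
  have hBμ0 : 0 ≤ Bμ := transitionVariation_nonneg _ _ _ _ _
  have hmain0 : 0 ≤ D * ι := mul_nonneg (Real.sqrt_nonneg _) (by linarith)
  have hvar0 : 0 ≤ Bθ * √((d : ℝ) / H) * ((H * N : ℕ) : ℝ) ^ (3 / 2 : ℝ) := by positivity
  have hvar1 : 0 ≤ Bμ * √((d : ℝ) * H) * ((H * N : ℕ) : ℝ) ^ (3 / 2 : ℝ) := by positivity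
  have hp' : ENNReal.ofReal (1 - p) = 1 - ENNReal.ofReal p := by
    rw [ENNReal.ofReal_sub _ hp.le, ENNReal.ofReal_one]
  by_cases hvar : √N * (Bθ + H * Bμ) ≤ 1
  · set n := 5 * (H * N) * gridDenom d (H * N) β with hn
    set L := noiseLevel d (H * N) n p with hL
    set η := √ι / (H * √(H * N)) with hη
    have hH' : (0 : ℝ) < H := by exact_mod_cast hH
    have hN' : (0 : ℝ) < N := by exact_mod_cast hN
    have hη0 : 0 < η := div_pos (Real.sqrt_pos.2 (by linarith)) (by positivity)
    have hbad := measure_bad_le hφ hsel hrun (gridDenom d (H * N) β) n L (Real.log (2 / p)) η j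
    have hprob : N * (H * ((2 * (n : ℝ) + 1) ^ (d + (d + d * d)) * Real.exp (-L))) +
        Real.exp (-Real.log (2 / p)) = p := by
      have h1 := exp_neg_noiseLevel (d := d) hW hp n
      rw [← hL] at h1
      push_cast at h1
      have h2 : Real.exp (-Real.log (2 / p)) = p / 2 := by
        rw [Real.exp_neg, Real.exp_log (by positivity), inv_div]
      rw [h2]
      linarith
    rw [hprob] at hbad
    refine le_trans ?_ (measure_mono (μ := Pr) (s := {ω | (∀ k ∈ epoch N K j, ∀ h, h + 1 < H →
        GridBound M φ β (gridDenom d (H * N) β) n L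
          (fun l i => s l i ω) (fun l i => u l i ω) (j * N) k h) ∧
      ∑ l ∈ epoch N K j, ∑ i ∈ Finset.range (H - 1),
        gapExponent M φ β N sel η (fun l i => s l i ω) (fun l i => u l i ω) l i ≤
          Real.log (2 / p)}) ?_)
    · rw [hp', tsub_le_iff_right]
      refine le_trans ?_ (add_le_add_right hbad _)
      -- Subadditivity over the good event and its complement is enough, so measurability of the
      -- good event is never needed.
      rw [← measure_univ (μ := Pr)]
      refine le_trans (measure_mono fun ω _ => ?_) (measure_union_le _ _)
      exact Classical.em _
    · rintro ω ⟨hgrid, hgap⟩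
      have hgridn : 4 * (N * H : ℝ) * (gridDenom d (H * N) β : ℕ) + 1 ≤ n := by
        have h1 : (1 : ℝ) ≤ H * N * gridDenom d (H * N) β := by
          exact_mod_cast Nat.mul_pos hW (gridDenom_pos hd hW β)
        rw [hn]
        push_cast
        linarith
      have h1 := epochRegret_le_of_good hlin hsel hd hH
        (fun k hk h hh => hrun.action k hk h hh ω) (gridDenom_pos hd hW β) hN hgridn
        (gridDenom_sq_ge hd hH hN β) (noiseLevel_nonneg hW hp hp1 n) hgrid hvar
        (grid_error_le hd hH hN (by rw [hβ]; positivity))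
        (bonus_parameter_ge hc hd hH hN hp hp1 hβ) hη0 hgap
      have h2 := regret_main_le hc hd hH hN hp hp1 hιdef hβ hη
      refine (h1.trans h2).trans (mul_le_mul_of_nonneg_left ?_ (by linarith))
      linarith
  · have huniv : ∀ ω, epochRegret M φ β N sel (fun l i => s l i ω) (fun l i => u l i ω) j ≤
        (3 * c + 2) * (D * ι + Bθ * √((d : ℝ) / H) * ((H * N : ℕ) : ℝ) ^ (3 / 2 : ℝ) +
          Bμ * √((d : ℝ) * H) * ((H * N : ℕ) : ℝ) ^ (3 / 2 : ℝ)) := by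
      intro ω
      have h1 := epochRegret_le_steps (N := N) (β := β) (M := M) hφ hsel
        (fun l i => s l i ω) (fun l i => u l i ω) j
      have h2 := steps_le_variation_terms hBθ0 hBμ0 hd hH (not_le.1 hvar)
      refine h1.trans (h2.trans ?_)
      nlinarith
    refine le_trans ?_ (measure_mono (s := Set.univ) fun ω _ => huniv ω)
    rw [measure_univ, hp']
    exact tsub_le_self
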